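/- Let $N \ge 2$. Let $L \subseteq \mathbf{Z}$ be one of the sets $\mathbf{Z}$, $\{\ell \ge L_-\}$, $\{\ell \le L_+\}$, $\{L_- \le \ell \le L_+\}$, with integers $L_- \le 0 \le L_+$, and let $\{\Omega_\ell\}_{\ell\in L}$ be disjoint open subsets of $\mathbf{R}^N$ such that $\mathbf{R}^N = \bigcup_{\ell\in L} \overline{\Omega_\ell}$ and such that every ball $B_R = \{|x| < R\}$ meets only finitely many $\Omega_\ell$. For each $\ell \in L$ let $\partial\Omega_\ell = S_\ell^{(-)} \cup S_\ell^{(+)}$ with $S_\ell^{(-)} \cap S_\ell^{(+)} = \emptyset$, where $S_\ell^{(+)} = S_{\ell+1}^{(-)}$ if $\ell, \ell+1 \in L$, $S_\ell^{(+)} = \emptyset$ if $\ell + 1 \notin L$, and $S_\ell^{(-)} = \emptyset$ if $\ell - 1 \notin L$. Suppose that each $\partial\Omega_\ell$ is piecewise smooth: outside a set of $(N-1)$-dimensional Hausdorff measure zero, each of its points has a neighbourhood in which $\partial\Omega_\ell$ is the zero set of a $C^1$ function whose differential does not vanish at the point. Let $\mu_0 : \mathbf{R}^N \to (0,\infty)$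 be a function that takes a constant value $\nu_\ell$ on $\Omega_\ell$ for each $\ell \in L$, with $0 < \inf_{\ell\in L} \nu_\ell \le \sup_{\ell\in L} \nu_\ell < \infty$, and suppose that $$(\nu_\ell - \nu_{\ell+1})\,(n^{(\ell)}(x) \cdot x) \le 0$$ for all $\ell$ with $\ell, \ell+1 \in L$ and all $x \in S_\ell^{(+)}$ at which $\Omega_\ell$ has a unit outward normal $n^{(\ell)}(x)$ (that is, near $x$ the set $\Omega_\ell$ is $\{g < 0\}$ for a $C^1$ function $g$ with $g(x) = 0$ and $\nabla g(x) = n^{(\ell)}(x)$, $|n^{(\ell)}(x)| = 1$). Let $\lambda > 0$, $\delta > 1/2$, $f \in L_2(\mathbf{R}^N)_{\rm loc}$ (complex valued), and fix a sign $+$ or $-$. Then the equation $$-\mu_0(x)^{-1}\Delta u - \lambda u = f,$$ with $\Delta u$ in the sense of distributions, has at most one solution $u \in H^2(\mathbf{R}^N)_{\rm loc}$ (up to equality almost everywhere) that satisfies the radiation condition $$\int_{|x|>1} (1+|x|)^{2(\delta-1)}\,\bigl|\mathcal{D}_r^{(\pm)}u(x)\bigr|^2\,dx < \infty, \qquad \mathcal{D}_r^{(\pm)}u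 = \frac{\partial u}{\partial r} + \frac{N-1}{2r}\,u \mp i\sqrt{\lambda\mu_0(x)}\,u, \quad r = |x|,$$ with the chosen sign. -/

import Mathlib

open MeasureTheory Set
open scoped ContDiff ENNReal Laplacian

noncomputable section

namespace ReducedWave

/-- `ℝ^N` with its Euclidean structure. -/
abbrev Space (N : ℕ) := EuclideanSpace ℝ (Fin N)

/-! ### Layered media -/

/-- The index sets of the layers: all of `ℤ`, `{a, a+1, …}` with `a ≤ 0`, `{…, b-1, b}` with
`0 ≤ b`, or `{a, …, b}` with `a ≤ 0 ≤ b`. -/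
def IsLayerIndexSet (L : Set ℤ) : Prop :=
  L = univ ∨ (∃ a ≤ 0, L = Ici a) ∨ (∃ b ≥ 0, L = Iic b) ∨ (∃ a ≤ 0, ∃ b ≥ 0, L = Icc a b)

/-- Near its point `x`, the set `S` is a smooth (`C¹`) hypersurface: it is the zero set of a `C¹`
function whose differential at `x` is not zero. -/
def IsHypersurfaceAt {N : ℕ} (S : Set (Space N)) (x : Space N) : Prop :=
  ∃ (U : Set (Space N)) (g : Space N → ℝ), IsOpen U ∧ x ∈ U ∧ ContDiffOn ℝ 1 g U ∧
    fderiv ℝ g x ≠ 0 ∧ S ∩ U = {y ∈ U | g y = 0}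

/-- `S` is piecewise smooth: it is a smooth hypersurface near each of its points outside a set of
vanishing `(N - 1)`-dimensional Hausdorff measure (edges, corners, vertices). -/
def IsPiecewiseSmooth {N : ℕ} (S : Set (Space N)) : Prop :=
  Measure.hausdorffMeasure ((N : ℝ) - 1) {x ∈ S | ¬ IsHypersurfaceAt S x} = 0

/-- `n` is the unit outward normal of the open set `Ω` at its boundary point `x`: near `x` the set
`Ω` is the sublevel set `{g < 0}` of a `C¹` function `g` that vanishes at `x` and whose gradient
at `x` is the unit vector `n`. -/
def IsOutwardUnitNormal {N : ℕ} (Ω : Set (Space N)) (x n : Space N) : Prop :=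
  ‖n‖ = 1 ∧ ∃ (U : Set (Space N)) (g : Space N → ℝ), IsOpen U ∧ x ∈ U ∧ ContDiffOn ℝ 1 g U ∧
    g x = 0 ∧ HasGradientAt g n x ∧ Ω ∩ U = {y ∈ U | g y < 0}

/-- The assumptions on a layered medium `μ₀` on `ℝ^N`, which takes the value `ν ℓ` on the layer
`Ω ℓ`, with separating surfaces `Sm ℓ` (towards the layer `ℓ - 1`) and `Sp ℓ` (towards the layer
`ℓ + 1`). The values of `Ω`, `Sm`, `Sp`, `ν` outside the index set `L` play no role. -/
structure IsLayeredMedium {N : ℕ} (L : Set ℤ) (Ω Sm Sp : ℤ → Set (Space N)) (ν : ℤ → ℝ)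
    (μ₀ : Space N → ℝ) : Prop where
  index : IsLayerIndexSet L
  isOpen : ∀ ℓ ∈ L, IsOpen (Ω ℓ)
  disjoint : L.PairwiseDisjoint Ω
  cover : ⋃ ℓ ∈ L, closure (Ω ℓ) = univ
  locallyFinite : ∀ R : ℝ, 0 < R → {ℓ ∈ L | (Ω ℓ ∩ Metric.ball 0 R).Nonempty}.Finite
  frontier_eq : ∀ ℓ ∈ L, frontier (Ω ℓ) = Sm ℓ ∪ Sp ℓ
  surfaces_disjoint : ∀ ℓ ∈ L, Disjoint (Sm ℓ) (Sp ℓ)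
  /-- The surface `frontier (Ω ℓ) = Sm ℓ ∪ Sp ℓ` is piecewise smooth. -/
  piecewiseSmooth : ∀ ℓ ∈ L, IsPiecewiseSmooth (frontier (Ω ℓ))
  surfaces_eq : ∀ ℓ ∈ L, ℓ + 1 ∈ L → Sp ℓ = Sm (ℓ + 1)
  surface_last : ∀ ℓ ∈ L, ℓ + 1 ∉ L → Sp ℓ = ∅
  surface_first : ∀ ℓ ∈ L, ℓ - 1 ∉ L → Sm ℓ = ∅
  pos : ∀ x, 0 < μ₀ x
  value : ∀ ℓ ∈ L, ∀ x ∈ Ω ℓ, μ₀ x = ν ℓ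
  bounds : ∃ m M : ℝ, 0 < m ∧ ∀ ℓ ∈ L, m ≤ ν ℓ ∧ ν ℓ ≤ M
  /-- The sign condition on the jumps of `μ₀` across the separating surfaces. -/
  jump : ∀ ℓ ∈ L, ℓ + 1 ∈ L → ∀ x ∈ Sp ℓ, ∀ n, IsOutwardUnitNormal (Ω ℓ) x n →
    (ν ℓ - ν (ℓ + 1)) * inner ℝ n x ≤ 0

/-! ### Local Sobolev spaces -/

/-- `u ∈ L_{2,loc}(ℝ^N)`. -/
def MemL2Loc {N : ℕ} (u : Space N → ℂ) : Prop :=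
  ∀ K : Set (Space N), IsCompact K → MemLp u 2 (volume.restrict K)

/-- The test functions `C_0^∞(ℝ^N)` (real valued). -/
def IsTestFunction {N : ℕ} (φ : Space N → ℝ) : Prop :=
  ContDiff ℝ ∞ φ ∧ HasCompactSupport φ

/-- The partial derivative `∂_i φ` of a differentiable function. -/
def partialDeriv {N : ℕ} (i : Fin N) (φ : Space N → ℝ) (x : Space N) : ℝ :=
  fderiv ℝ φ x (EuclideanSpace.single i 1)

/-- `v` is the distributional derivative `∂_i u`; both are locally integrable. -/
def HasWeakPartial {N : ℕ} (i : Fin N) (u v : Space N → ℂ) : Prop :=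
  LocallyIntegrable u ∧ LocallyIntegrable v ∧ ∀ φ : Space N → ℝ, IsTestFunction φ →
    ∫ x, partialDeriv i φ x • u x = - ∫ x, φ x • v x

/-- `w` is the distributional Laplacian `Δu`; both are locally integrable. -/
def HasWeakLaplacian {N : ℕ} (u w : Space N → ℂ) : Prop :=
  LocallyIntegrable u ∧ LocallyIntegrable w ∧ ∀ φ : Space N → ℝ, IsTestFunction φ →
    ∫ x, (Δ φ) x • u x = ∫ x, φ x • w x

/-- `u ∈ H^2(ℝ^N)_{loc}`: `u` and its distributional derivatives of order at most two are in
`L_{2,loc}(ℝ^N)`. -/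
def MemH2Loc {N : ℕ} (u : Space N → ℂ) : Prop :=
  MemL2Loc u ∧ ∃ (G : Fin N → Space N → ℂ) (H : Fin N → Fin N → Space N → ℂ),
    (∀ i, HasWeakPartial i u (G i) ∧ MemL2Loc (G i)) ∧
    ∀ i j, HasWeakPartial j (G i) (H i j) ∧ MemL2Loc (H i j)

/-! ### The reduced wave equation and the radiation conditions -/

/-- `-μ₀(x)⁻¹ Δu - λ u = f` almost everywhere, with the distributional Laplacian. -/
def SolvesReducedWave {N : ℕ} (μ₀ : Space N → ℝ) (lam : ℝ) (f u : Space N → ℂ) : Prop :=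
  ∃ w : Space N → ℂ, HasWeakLaplacian u w ∧
    ∀ᵐ x, - ((μ₀ x)⁻¹ : ℂ) * w x - (lam : ℂ) * u x = f x

/-- `‖v‖_{t,G}`, where `‖v‖_{t,G}² = ∫_G (1 + |x|)^{2t} |v(x)|² dx`. -/
def weightedNorm {N : ℕ} (t : ℝ) (G : Set (Space N)) (v : Space N → ℂ) : ℝ≥0∞ :=
  (∫⁻ x in G, ENNReal.ofReal ((1 + ‖x‖) ^ (2 * t)) * ‖v x‖ₑ ^ 2) ^ (1 / 2 : ℝ)

/-- The wave number `k(x) = (λ μ₀(x))^{1/2}`, for `λ > 0`. -/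
def waveNumber {N : ℕ} (μ₀ : Space N → ℝ) (lam : ℝ) (x : Space N) : ℝ :=
  Real.sqrt (lam * μ₀ x)

/-- `D_r^{(±)} u = ∂u/∂r + ((N-1)/(2r)) u ∓ i k(x) u`, where `s = ±1` is the sign, `G` is the
gradient of `u`, and `∂u/∂r = ∑ i, (x_i / r) ∂_i u`. -/
def radiationTerm {N : ℕ} (μ₀ : Space N → ℝ) (lam : ℝ) (s : ℤˣ) (u : Space N → ℂ)
    (G : Fin N → Space N → ℂ) (x : Space N) : ℂ :=
  (∑ i, ((x i / ‖x‖ : ℝ) : ℂ) * G i x) + ((((N : ℝ) - 1) / (2 * ‖x‖) : ℝ) : ℂ) * u x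
    - ((s : ℤ) : ℂ) * Complex.I * (waveNumber μ₀ lam x : ℂ) * u x

/-- The radiation condition `‖D_r^{(±)} u‖_{δ-1, E_1} < ∞`, where `E_1 = {|x| > 1}`. The
distributional gradient `G` of `u` is unique up to a null set. -/
def RadiationCondition {N : ℕ} (μ₀ : Space N → ℝ) (lam δ : ℝ) (s : ℤˣ)
    (u : Space N → ℂ) : Prop :=
  ∃ G : Fin N → Space N → ℂ, (∀ i, HasWeakPartial i u (G i)) ∧
    weightedNorm (δ - 1) {x | 1 < ‖x‖} (radiationTerm μ₀ lam s u G) < ⊤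

end ReducedWave

end

namespace ReducedWave

open Filter Topology ContinuousLinearMap Metric

/-! ### Mollification -/

/-! The difference `u` of two solutions satisfies `Δu = -κ u` with `κ = λ μ₀`, and so do its real
and imaginary parts `α`, `β`. The proof is a virial (Pohozaev) argument that gives `u = 0` directly
from the radiation condition; no unique continuation theorem is needed.

Meaning of the jump condition. It says that `μ₀` does not decrease along rays from the origin, that
is, `∫ μ₀ div(w x) ≤ 0` for every nonnegative compactly supported `w` of class `C¹`
(`IsLayeredMedium.radiallyMonotoneOn_univ`). At a smooth point of the interfaces only two layers
meet, and the inequality follows by approximating the indicator of `{g < 0}` by smooth functions of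
`g` (`exists_nhds_integral_sublevel_le`). The remaining points form a set of vanishing
`(N-1)`-dimensional Hausdorff measure. Covering its compact pieces by balls with small `∑ r^(N-1)`
and cutting these off costs only `O(∑ r^(N-1))`, since the gradients are `O(1/r)` on volumes
`O(r^N)` (`RadiallyMonotoneOn.univ_of_hausdorffMeasure`).

Virial inequality. Let `m` be radial with `∇m = 2 d x`. Testing the equation with `2 m x·∇u + (N-1)
m u`, and the monotonicity of `κ` with `w = m u²`, gives `∫ F ≤ 0` for a quadratic form `F` in `u`
and `∇u` (`IsRealSolution.virial_le`). Take `m = χ_R ψ` with `ψ = (1 + ε²|x|²)^(-b)`, `b = max (1-δ)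
0 < 1/2` and `ε` small. Where `χ_R` is not differentiated, `F` is bounded below by a positive
multiple of `χ_R ψ u²` (`bulk_estimate`). The derivative of `χ_R` lives on `R ≤ |x| ≤ 2R` and
contributes at worst a multiple of `ψ (|∂_r u|² + |u|²)` there.

Radiation condition. Expanding `|D_r u|² / √κ` gives positive squares controlling `|∂_r u|² + |u|²`,
plus a constant multiple of the flux density `β ∂_r α - α ∂_r β` (`radiation_estimate`). The radial
integral of the flux vanishes (`IsRealSolution.flux_eq_zero`), so the cut-off terms are bounded by
`∫_{|x| ≥ R} (1+|x|)^(2(δ-1)) |D_r u|²`; the choice of `b` matches the weights. This tail tends to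
`0` as `R → ∞`, which forces `∫ ψ |u|² = 0` on every ball (`ae_eq_zero_of_radiation`). -/

/-- A sequence of smooth bump functions whose supports shrink to the origin. -/
noncomputable def bump (N n : ℕ) : ContDiffBump (0 : Space N) where
  rIn := 1 / (2 * ((n : ℝ) + 1))
  rOut := 1 / ((n : ℝ) + 1)
  rIn_pos := by positivity
  rIn_lt_rOut := by
    apply one_div_lt_one_div_of_lt
    · positivity
    · have : (0 : ℝ) ≤ n := n.cast_nonneg
      linarith

lemma bump_rOut_le_one (N n : ℕ) : (bump N n).rOut ≤ 1 := by
  have : (0 : ℝ) ≤ n := n.cast_nonneg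
  change 1 / ((n : ℝ) + 1) ≤ 1
  rw [div_le_one (by positivity)]
  linarith

lemma tendsto_bump_rOut (N : ℕ) : Tendsto (fun n => (bump N n).rOut) atTop (𝓝 0) :=
  tendsto_one_div_add_atTop_nhds_zero_nat

/-- The convolution of `f` with the `n`-th normalized bump function. -/
noncomputable def mollify {N : ℕ} (n : ℕ) (f : Space N → ℝ) : Space N → ℝ :=
  convolution ((bump N n).normed volume) f (lsmul ℝ ℝ) volume

variable {N : ℕ}

lemma mollify_apply (n : ℕ) (f : Space N → ℝ) (x : Space N) :
    mollify n f x = ∫ t, (bump N n).normed volume t * f (x - t) := rfl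

lemma contDiff_mollify (n : ℕ) {f : Space N → ℝ} (hf : LocallyIntegrable f) :
    ContDiff ℝ ∞ (mollify n f) :=
  (bump N n).hasCompactSupport_normed.contDiff_convolution_left (n := ⊤) _
    (bump N n).contDiff_normed hf

lemma lintegral_bump (n : ℕ) :
    ∫⁻ t, ENNReal.ofReal ((bump N n).normed volume t) = 1 := by
  rw [← ofReal_integral_eq_lintegral_ofReal (bump N n).integrable_normed
    (Eventually.of_forall fun t => (bump N n).nonneg_normed t), (bump N n).integral_normed]
  simp

/-- Jensen's inequality for the probability measure whose density is the bump, obtained from the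
monotonicity of `L^p` norms in `p`. -/
lemma enorm_mollify_sq_le (n : ℕ) {f : Space N → ℝ} (hf : AEStronglyMeasurable f volume)
    (x : Space N) :
    ‖mollify n f x‖ₑ ^ 2 ≤
      ∫⁻ t, ENNReal.ofReal ((bump N n).normed volume t) * ‖f (x - t)‖ₑ ^ 2 := by
  set ρ : Space N → ℝ≥0∞ := fun t => ENNReal.ofReal ((bump N n).normed volume t) with hρ
  have hρm : Measurable ρ := ((bump N n).continuous_normed.measurable).ennreal_ofReal
  have hfx : AEStronglyMeasurable (fun t => f (x - t)) volume :=
    hf.comp_quasiMeasurePreserving (quasiMeasurePreserving_sub_left volume x)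
  have hfx' : AEStronglyMeasurable (fun t => f (x - t)) (volume.withDensity ρ) :=
    hfx.mono_ac (withDensity_absolutelyContinuous _ _)
  have hprob : IsProbabilityMeasure ((volume : Measure (Space N)).withDensity ρ) :=
    ⟨by rw [withDensity_apply _ MeasurableSet.univ, Measure.restrict_univ, lintegral_bump]⟩
  have h1 : ‖mollify n f x‖ₑ ≤ eLpNorm (fun t => f (x - t)) 1 (volume.withDensity ρ) := by
    rw [eLpNorm_one_eq_lintegral_enorm, lintegral_withDensity_eq_lintegral_mul₀ hρm.aemeasurable
      hfx.enorm, mollify_apply]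
    refine (enorm_integral_le_lintegral_enorm _).trans (le_of_eq ?_)
    refine lintegral_congr fun t => ?_
    rw [enorm_mul, Real.enorm_of_nonneg ((bump N n).nonneg_normed t)]
    rfl
  have h2 := h1.trans (eLpNorm_le_eLpNorm_of_exponent_le (p := 1) (q := 2) (by norm_num) hfx')
  have h3 : eLpNorm (fun t => f (x - t)) 2 (volume.withDensity ρ) ^ 2
      = ∫⁻ t, ρ t * ‖f (x - t)‖ₑ ^ 2 := by
    rw [eLpNorm_eq_lintegral_rpow_enorm_toReal (by norm_num) (by norm_num),
      ← ENNReal.rpow_natCast, ← ENNReal.rpow_mul]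
    simp only [ENNReal.toReal_ofNat, Nat.cast_ofNat, one_div, ne_eq, OfNat.ofNat_ne_zero,
      not_false_eq_true, inv_mul_cancel₀, ENNReal.rpow_one, ENNReal.rpow_ofNat]
    rw [lintegral_withDensity_eq_lintegral_mul₀ hρm.aemeasurable (hfx.enorm.pow_const 2)]
    rfl
  rw [← h3]
  gcongr

/-- Integrate the pointwise Jensen bound, exchange the integrals and use translation invariance. -/
lemma eLpNorm_mollify_le (n : ℕ) {f : Space N → ℝ} (hf : AEStronglyMeasurable f volume) :
    eLpNorm (mollify n f) 2 volume ≤ eLpNorm f 2 volume := by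
  have key : ∫⁻ x, ‖mollify n f x‖ₑ ^ 2 ≤ ∫⁻ x, ‖f x‖ₑ ^ 2 := by
    calc ∫⁻ x, ‖mollify n f x‖ₑ ^ 2
        ≤ ∫⁻ x, ∫⁻ t, ENNReal.ofReal ((bump N n).normed volume t) * ‖f (x - t)‖ₑ ^ 2 :=
          lintegral_mono fun x => enorm_mollify_sq_le n hf x
      _ = ∫⁻ t, ∫⁻ x, ENNReal.ofReal ((bump N n).normed volume t) * ‖f (x - t)‖ₑ ^ 2 := by
          apply lintegral_lintegral_swap
          refine AEMeasurable.mul (f := fun z : Space N × Space N =>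
              ENNReal.ofReal ((bump N n).normed volume z.2))
            (g := fun z : Space N × Space N => ‖f (z.1 - z.2)‖ₑ ^ 2) ?_ ?_
          · exact ((bump N n).continuous_normed.measurable.ennreal_ofReal.comp
              measurable_snd).aemeasurable
          · exact (hf.comp_quasiMeasurePreserving
              (quasiMeasurePreserving_sub_of_right_invariant volume volume)).enorm.pow_const 2
      _ = ∫⁻ t, ENNReal.ofReal ((bump N n).normed volume t) * ∫⁻ x, ‖f x‖ₑ ^ 2 := by
          refine lintegral_congr fun t => ?_
          rw [lintegral_const_mul' _ _ ENNReal.ofReal_ne_top,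
            lintegral_sub_right_eq_self (fun x => ‖f x‖ₑ ^ 2) t]
      _ = ∫⁻ x, ‖f x‖ₑ ^ 2 := by
          rw [lintegral_mul_const'' _
            (bump N n).continuous_normed.measurable.ennreal_ofReal.aemeasurable, lintegral_bump,
            one_mul]
  rw [eLpNorm_eq_lintegral_rpow_enorm_toReal (by norm_num) (by norm_num),
    eLpNorm_eq_lintegral_rpow_enorm_toReal (by norm_num) (by norm_num)]
  simp only [ENNReal.toReal_ofNat, ENNReal.rpow_ofNat]
  gcongr

lemma mollify_sub (n : ℕ) {f g : Space N → ℝ} (hf : LocallyIntegrable f)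
    (hg : LocallyIntegrable g) : mollify n (f - g) = mollify n f - mollify n g := by
  funext x
  have h1 := ((bump N n).hasCompactSupport_normed (μ := volume).convolutionExists_left
    (lsmul ℝ ℝ) (bump N n).continuous_normed hf x).integrable
  have h2 := ((bump N n).hasCompactSupport_normed (μ := volume).convolutionExists_left
    (lsmul ℝ ℝ) (bump N n).continuous_normed hg x).integrable
  simp only [lsmul_apply, smul_eq_mul] at h1 h2
  simp only [mollify_apply, Pi.sub_apply, mul_sub]
  exact integral_sub h1 h2

/-- Uniform continuity makes the convergence uniform, and all differences vanish off one compact set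
of finite measure because the bumps have radius at most `1`. -/
lemma tendsto_eLpNorm_mollify_sub_of_continuous {g : Space N → ℝ} (hg : Continuous g)
    (hgc : HasCompactSupport g) :
    Tendsto (fun n => eLpNorm (mollify n g - g) 2 volume) atTop (𝓝 0) := by
  set K := cthickening 1 (tsupport g) with hK
  have hKc : IsCompact K := hgc.isCompact.cthickening
  have hout : ∀ n x, x ∉ K → (mollify n g - g) x = 0 := by
    intro n x hx
    have hgx : g x = 0 := by
      by_contra h
      exact hx (self_subset_cthickening _ (subset_tsupport g h))
    have hb : ∀ y ∈ ball x (bump N n).rOut, g y = g x := by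
      intro y hy
      rw [hgx]
      by_contra h
      refine hx (mem_cthickening_of_dist_le x y 1 _ (subset_tsupport g h) ?_)
      rw [dist_comm]
      exact (mem_ball.1 hy).le.trans (bump_rOut_le_one N n)
    have : mollify n g x = g x := (bump N n).normed_convolution_eq_right hb
    simp [this]
  have hKv : volume K ^ ((2 : ℝ≥0∞).toReal⁻¹) ≠ ⊤ :=
    ENNReal.rpow_ne_top_of_nonneg (by positivity) hKc.measure_lt_top.ne
  rw [ENNReal.tendsto_nhds_zero]
  intro ε hε
  obtain ⟨c, hc0, hc⟩ : ∃ c : ℝ, 0 < c ∧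
      volume K ^ ((2 : ℝ≥0∞).toReal⁻¹) * ENNReal.ofReal c ≤ ε := by
    have : Tendsto (fun c : ℝ => volume K ^ ((2 : ℝ≥0∞).toReal⁻¹) * ENNReal.ofReal c)
        (𝓝[>] 0) (𝓝 0) := by
      have h := (ENNReal.tendsto_ofReal (tendsto_id (x := 𝓝 (0 : ℝ)))).mono_left
        (nhdsWithin_le_nhds (s := Ioi 0))
      have := ENNReal.Tendsto.const_mul h (Or.inr hKv)
      simpa using this
    obtain ⟨c, h1, h2⟩ := (((ENNReal.tendsto_nhds_zero.1 this) ε hε).and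
      self_mem_nhdsWithin).exists
    exact ⟨c, h2, h1⟩
  obtain ⟨d, hd0, hd⟩ := Metric.uniformContinuous_iff.1
    (hg.uniformContinuous_of_tendsto_cocompact (x := 0) hgc.is_zero_at_infty) c hc0
  filter_upwards [(tendsto_bump_rOut N).eventually (gt_mem_nhds hd0)] with n hn
  have hbd : ∀ x, ‖(mollify n g - g) x‖ ≤ c := by
    intro x
    rw [Pi.sub_apply, ← dist_eq_norm]
    refine (bump N n).dist_normed_convolution_le hg.aestronglyMeasurable fun y hy => ?_
    exact (hd (lt_trans (mem_ball.1 hy) hn)).le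
  have hind : mollify n g - g = K.indicator (mollify n g - g) := by
    funext x
    by_cases hx : x ∈ K
    · rw [indicator_of_mem hx]
    · rw [indicator_of_notMem hx, hout n x hx]
  rw [hind, eLpNorm_indicator_eq_eLpNorm_restrict hKc.measurableSet]
  refine (eLpNorm_le_of_ae_bound (C := c) (Eventually.of_forall hbd)).trans ?_
  simpa using hc

/-- Continuous compactly supported functions are dense and mollification is an `L²` contraction, so
three errors of size `ε / 3` suffice. -/
lemma tendsto_eLpNorm_mollify_sub {f : Space N → ℝ} (hf : MemLp f 2 volume) :
    Tendsto (fun n => eLpNorm (mollify n f - f) 2 volume) atTop (𝓝 0) := by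
  rw [ENNReal.tendsto_nhds_zero]
  intro ε hε
  by_cases hεt : ε = ⊤
  · simp [hεt]
  have hε3 : ε / 3 ≠ 0 := (ENNReal.div_pos hε.ne' (by norm_num)).ne'
  obtain ⟨g, hgc, hfg, hg, hgm⟩ := hf.exists_hasCompactSupport_eLpNorm_sub_le (by norm_num) hε3
  have hfl := hf.locallyIntegrable (by norm_num : (1 : ℝ≥0∞) ≤ 2)
  have hgl := hgm.locallyIntegrable (by norm_num : (1 : ℝ≥0∞) ≤ 2)
  filter_upwards [(ENNReal.tendsto_nhds_zero.1
    (tendsto_eLpNorm_mollify_sub_of_continuous hg hgc)) (ε / 3) (pos_iff_ne_zero.2 hε3)] with n hn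
  have hm : ∀ {h : Space N → ℝ}, LocallyIntegrable h → AEStronglyMeasurable (mollify n h) volume :=
    fun hh => (contDiff_mollify n hh).continuous.aestronglyMeasurable
  have hdec : mollify n f - f = mollify n (f - g) + (mollify n g - g) - (f - g) := by
    rw [mollify_sub n hfl hgl]; abel
  rw [hdec]
  have hfgm := hf.1.sub hgm.1
  calc eLpNorm (mollify n (f - g) + (mollify n g - g) - (f - g)) 2 volume
      ≤ eLpNorm (mollify n (f - g)) 2 volume + eLpNorm (mollify n g - g) 2 volume
        + eLpNorm (f - g) 2 volume := by
        refine (eLpNorm_sub_le ((hm (hfl.sub hgl)).add ((hm hgl).sub hgm.1)) hfgm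
          (by norm_num)).trans ?_
        gcongr
        exact eLpNorm_add_le (hm (hfl.sub hgl)) ((hm hgl).sub hgm.1) (by norm_num)
    _ ≤ ε / 3 + ε / 3 + ε / 3 := by
        gcongr
        exact (eLpNorm_mollify_le n hfgm).trans hfg
    _ = ε := ENNReal.add_thirds ε

end ReducedWave

namespace ReducedWave

open Filter Topology ContinuousLinearMap Metric

/-! ### Real valued weak derivatives -/

/-- A real valued function in `L_{2,loc}`. -/
def RealL2Loc {N : ℕ} (f : Space N → ℝ) : Prop :=
  ∀ K : Set (Space N), IsCompact K → MemLp f 2 (volume.restrict K)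

/-- `F` is the weak derivative `∂_i f` of a real valued function. -/
def WeakPartial {N : ℕ} (i : Fin N) (f F : Space N → ℝ) : Prop :=
  LocallyIntegrable f ∧ LocallyIntegrable F ∧ ∀ φ : Space N → ℝ, IsTestFunction φ →
    ∫ x, partialDeriv i φ x * f x = - ∫ x, φ x * F x

variable {N : ℕ}

lemma RealL2Loc.ball {f : Space N → ℝ} (hf : RealL2Loc f) (R : ℝ) :
    MemLp f 2 (volume.restrict (ball 0 R)) :=
  (hf _ (isCompact_closedBall 0 R)).mono_measure (Measure.restrict_mono ball_subset_closedBall le_rfl)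

lemma Continuous.realL2Loc {f : Space N → ℝ} (hf : Continuous f) : RealL2Loc f := by
  intro K hK
  obtain ⟨C, hC⟩ := hK.exists_bound_of_continuousOn hf.continuousOn
  have : IsFiniteMeasure (volume.restrict K) := ⟨by simpa using hK.measure_lt_top⟩
  exact MemLp.of_bound hf.aestronglyMeasurable C
    ((ae_restrict_iff' hK.measurableSet).2 (Eventually.of_forall hC))

/-- On the ball of radius `R` the mollification sees only the values of `f` on the ball of radius `R
+ 1`, so `f` may be cut off there. -/
lemma tendsto_eLpNorm_mollify_sub_ball {f : Space N → ℝ} (hf : RealL2Loc f) (R : ℝ) :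
    Tendsto (fun n => eLpNorm (mollify n f - f) 2 (volume.restrict (ball 0 R))) atTop (𝓝 0) := by
  set g := (closedBall (0 : Space N) (R + 1)).indicator f with hg
  have hgm : MemLp g 2 volume :=
    (memLp_indicator_iff_restrict isClosed_closedBall.measurableSet).2
      (hf _ (isCompact_closedBall _ _))
  refine tendsto_of_tendsto_of_tendsto_of_le_of_le tendsto_const_nhds
    (tendsto_eLpNorm_mollify_sub hgm) (fun _ => zero_le) fun n => ?_
  refine le_trans (le_of_eq (eLpNorm_congr_ae ?_)) (eLpNorm_mono_measure _ Measure.restrict_le_self)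
  refine (ae_restrict_iff' measurableSet_ball).2 (Eventually.of_forall fun x hx => ?_)
  have hx' : ‖x‖ < R := by simpa using hx
  have h1 : g x = f x := indicator_of_mem (by simpa using by linarith) _
  have h2 : mollify n g x = mollify n f x := by
    refine integral_congr_ae (Eventually.of_forall fun t => ?_)
    by_cases ht : (bump N n).normed volume t = 0
    · simp [ht]
    · have ht' : t ∈ ball (0 : Space N) (bump N n).rOut := by
        rw [← (bump N n).support_normed_eq (μ := volume)]; exact ht
      have : ‖t‖ < 1 := lt_of_lt_of_le (by simpa using ht') (bump_rOut_le_one N n)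
      have hm : x - t ∈ closedBall (0 : Space N) (R + 1) := by
        have := norm_sub_le x t
        simpa using by linarith
      simp [hg, indicator_of_mem hm]
  simp [h1, h2]

/-- The derivative falls on the bump, and `t ↦ ρ (x - t)` is an admissible test function for the
weak derivative. -/
lemma partialDeriv_mollify (n : ℕ) {i : Fin N} {f F : Space N → ℝ} (h : WeakPartial i f F)
    (x : Space N) : partialDeriv i (mollify n f) x = mollify n F x := by
  obtain ⟨hf, hF, hφ⟩ := h
  set ρ := (bump N n).normed volume with hρ
  have hρs : ContDiff ℝ ∞ ρ := (bump N n).contDiff_normed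
  have hρc : HasCompactSupport ρ := (bump N n).hasCompactSupport_normed
  have hd := hρc.hasFDerivAt_convolution_left (lsmul ℝ ℝ) (hρs.of_le (by norm_cast))
    hf x
  have hint := ((hρc.fderiv (𝕜 := ℝ)).convolutionExists_left
    ((lsmul ℝ ℝ : ℝ →L[ℝ] ℝ →L[ℝ] ℝ).precompL (Space N))
    (hρs.continuous_fderiv (by norm_cast)) hf x).integrable
  have e1 : partialDeriv i (mollify n f) x
      = ∫ t, fderiv ℝ ρ t (EuclideanSpace.single i 1) * f (x - t) := by
    have : fderiv ℝ (mollify n f) x = _ := hd.fderiv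
    rw [partialDeriv, this, convolution_def, ContinuousLinearMap.integral_apply hint]
    rfl
  have hτ : IsTestFunction (fun t => ρ (x - t)) :=
    ⟨hρs.comp (contDiff_const.sub contDiff_id),
      hρc.comp_homeomorph (Homeomorph.subLeft x)⟩
  have h2 := hφ _ hτ
  have e3 : ∀ t, partialDeriv i (fun t => ρ (x - t)) t
      = - fderiv ℝ ρ (x - t) (EuclideanSpace.single i 1) := by
    intro t
    have h1 : HasFDerivAt ρ (fderiv ℝ ρ (x - t)) (x - t) :=
      (hρs.differentiable (by norm_cast)).differentiableAt.hasFDerivAt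
    have h2 : HasFDerivAt (fun t : Space N => x - t) (-ContinuousLinearMap.id ℝ (Space N)) t := by
      simpa using (hasFDerivAt_id t).const_sub x
    have h3 : HasFDerivAt (fun t : Space N => ρ (x - t)) _ t := h1.comp t h2
    rw [partialDeriv, h3.fderiv]
    simp
  simp only [e3, neg_mul, integral_neg, neg_inj] at h2
  rw [e1, mollify_apply, ← integral_sub_left_eq_self _ volume x,
    ← integral_sub_left_eq_self (fun t => ρ t * F (x - t)) volume x]
  simpa using h2

lemma contDiff_partialDeriv {φ : Space N → ℝ} (hφ : ContDiff ℝ ∞ φ) (i : Fin N) :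
    ContDiff ℝ ∞ (partialDeriv i φ) :=
  (hφ.fderiv_right (m := ∞) (by norm_cast)).clm_apply contDiff_const

lemma IsTestFunction.partialDeriv {φ : Space N → ℝ} (hφ : IsTestFunction φ) (i : Fin N) :
    IsTestFunction (partialDeriv i φ) :=
  ⟨contDiff_partialDeriv hφ.1 i, hφ.2.fderiv_apply (𝕜 := ℝ) _⟩

lemma partialDeriv_mul {f g : Space N → ℝ} {x : Space N} (hf : DifferentiableAt ℝ f x)
    (hg : DifferentiableAt ℝ g x) (i : Fin N) :
    partialDeriv i (fun y => f y * g y) x = partialDeriv i f x * g x + f x * partialDeriv i g x := by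
  rw [partialDeriv, fderiv_fun_mul hf hg]
  simp [partialDeriv]
  ring

/-! ### Passing to the limit in integrals of products -/

lemma tendsto_integral_mul {α : Type*} [MeasurableSpace α] {μ : Measure α} {f g : α → ℝ}
    {fn gn : ℕ → α → ℝ} (hf : MemLp f 2 μ) (hg : MemLp g 2 μ) (hfn : ∀ n, MemLp (fn n) 2 μ)
    (hgn : ∀ n, MemLp (gn n) 2 μ)
    (tf : Tendsto (fun n => eLpNorm (fn n - f) 2 μ) atTop (𝓝 0))
    (tg : Tendsto (fun n => eLpNorm (gn n - g) 2 μ) atTop (𝓝 0)) :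
    Tendsto (fun n => ∫ x, fn n x * gn n x ∂μ) atTop (𝓝 (∫ x, f x * g x ∂μ)) := by
  have h1 := (Lp.tendsto_Lp_iff_tendsto_eLpNorm'' fn hfn f hf).2 tf
  have h2 := (Lp.tendsto_Lp_iff_tendsto_eLpNorm'' gn hgn g hg).2 tg
  have key : ∀ {u v : α → ℝ} (hu : MemLp u 2 μ) (hv : MemLp v 2 μ),
      inner ℝ (hv.toLp v) (hu.toLp u) = ∫ x, u x * v x ∂μ := by
    intro u v hu hv
    rw [L2.inner_def]
    refine integral_congr_ae ?_
    filter_upwards [hu.coeFn_toLp, hv.coeFn_toLp] with x hx hy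
    rw [hx, hy]
    rfl
  have := Filter.Tendsto.inner (𝕜 := ℝ) h2 h1
  simpa only [key] using this

/-- The weight `c` is only bounded and measurable, not continuous, because it will contain the
discontinuous coefficient; it is absorbed into `f`. -/
lemma tendsto_integral_bdd_mul {α : Type*} [MeasurableSpace α] {μ : Measure α} {c f g : α → ℝ}
    {fn gn : ℕ → α → ℝ} {C : ℝ} (hcm : AEStronglyMeasurable c μ) (hc : ∀ᵐ x ∂μ, ‖c x‖ ≤ C)
    (hf : MemLp f 2 μ) (hg : MemLp g 2 μ) (hfn : ∀ n, MemLp (fn n) 2 μ)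
    (hgn : ∀ n, MemLp (gn n) 2 μ)
    (tf : Tendsto (fun n => eLpNorm (fn n - f) 2 μ) atTop (𝓝 0))
    (tg : Tendsto (fun n => eLpNorm (gn n - g) 2 μ) atTop (𝓝 0)) :
    Tendsto (fun n => ∫ x, c x * (fn n x * gn n x) ∂μ) atTop
      (𝓝 (∫ x, c x * (f x * g x) ∂μ)) := by
  have hmul : ∀ {u : α → ℝ}, MemLp u 2 μ → MemLp (fun x => c x * u x) 2 μ := fun {u} hu =>
    hu.of_le_mul (c := C) (hcm.mul hu.1) (by
      filter_upwards [hc] with x hx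
      rw [norm_mul]
      gcongr)
  have ht : Tendsto (fun n => eLpNorm ((fun x => c x * fn n x) - fun x => c x * f x) 2 μ)
      atTop (𝓝 0) := by
    have h0 := ENNReal.Tendsto.const_mul (a := ENNReal.ofReal C) tf (Or.inr ENNReal.ofReal_ne_top)
    rw [mul_zero] at h0
    refine tendsto_of_tendsto_of_tendsto_of_le_of_le tendsto_const_nhds h0 (fun _ => zero_le)
      fun n => eLpNorm_le_mul_eLpNorm_of_ae_le_mul ?_ 2
    filter_upwards [hc] with x hx
    simp only [Pi.sub_apply, ← mul_sub, norm_mul]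
    gcongr
  simpa only [mul_assoc] using tendsto_integral_mul (hmul hf) hg (fun n => hmul (hfn n)) hgn ht tg

lemma setIntegral_eq_of_tsupport_subset {c h : Space N → ℝ} {s : Set (Space N)}
    (hc : tsupport c ⊆ s) : ∫ x in s, c x * h x = ∫ x, c x * h x :=
  setIntegral_eq_integral_of_forall_compl_eq_zero fun x hx => by
    rw [image_eq_zero_of_notMem_tsupport fun h => hx (hc h), zero_mul]

lemma HasCompactSupport.exists_tsupport_subset_ball {c : Space N → ℝ} (hc : HasCompactSupport c) :
    ∃ R, tsupport c ⊆ ball 0 R := by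
  obtain ⟨R, hR⟩ := hc.isCompact.isBounded.subset_ball 0
  exact ⟨R, hR⟩

/-- Convergence of integrals of products against a compactly supported bounded weight. -/
lemma tendsto_integral_mul_mul {c f g : Space N → ℝ} {fn gn : ℕ → Space N → ℝ} {C : ℝ}
    (hcs : HasCompactSupport c) (hcm : AEStronglyMeasurable c) (hc : ∀ᵐ x, ‖c x‖ ≤ C)
    (hf : RealL2Loc f) (hg : RealL2Loc g) (hfn : ∀ n, RealL2Loc (fn n)) (hgn : ∀ n, RealL2Loc (gn n))
    (tf : ∀ R, Tendsto (fun n => eLpNorm (fn n - f) 2 (volume.restrict (ball 0 R))) atTop (𝓝 0))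
    (tg : ∀ R, Tendsto (fun n => eLpNorm (gn n - g) 2 (volume.restrict (ball 0 R))) atTop (𝓝 0)) :
    Tendsto (fun n => ∫ x, c x * (fn n x * gn n x)) atTop (𝓝 (∫ x, c x * (f x * g x))) := by
  obtain ⟨R, hR⟩ := HasCompactSupport.exists_tsupport_subset_ball hcs
  have := tendsto_integral_bdd_mul (hcm.mono_measure (Measure.restrict_le_self (s := ball 0 R)))
    (ae_restrict_of_ae hc) (hf.ball R) (hg.ball R) (fun n => (hfn n).ball R)
    (fun n => (hgn n).ball R) (tf R) (tg R)
  simpa only [setIntegral_eq_of_tsupport_subset hR] using this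

lemma integrable_mul_mul {c f g : Space N → ℝ} {C : ℝ} (hcs : HasCompactSupport c)
    (hcm : AEStronglyMeasurable c) (hc : ∀ᵐ x, ‖c x‖ ≤ C) (hf : RealL2Loc f) (hg : RealL2Loc g) :
    Integrable (fun x => c x * (f x * g x)) := by
  obtain ⟨R, hR⟩ := HasCompactSupport.exists_tsupport_subset_ball hcs
  have h1 : IntegrableOn (fun x => f x * g x) (ball 0 R) := (hf.ball R).integrable_mul (hg.ball R)
  have h2 : IntegrableOn (fun x => c x * (f x * g x)) (ball 0 R) :=
    h1.bdd_mul (c := C) (hcm.mono_measure Measure.restrict_le_self) (ae_restrict_of_ae hc)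
  refine (integrableOn_iff_integrable_of_support_subset fun x hx => ?_).1 h2
  by_contra h
  exact hx (by beta_reduce; rw [image_eq_zero_of_notMem_tsupport fun h' => h (hR h'), zero_mul])

lemma RealL2Loc.locallyIntegrable {f : Space N → ℝ} (hf : RealL2Loc f) : LocallyIntegrable f :=
  (locallyIntegrable_iff).2 fun K hK => by
    have : IsFiniteMeasure (volume.restrict K) := ⟨by simpa using hK.measure_lt_top⟩
    exact (hf K hK).integrable (by norm_num)

lemma exists_bound_of_hasCompactSupport {φ : Space N → ℝ} (hφ : Continuous φ)
    (hφc : HasCompactSupport φ) : ∃ C, ∀ᵐ x, ‖φ x‖ ≤ C := by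
  obtain ⟨C, hC⟩ := hφ.bounded_above_of_compact_support hφc
  exact ⟨C, Eventually.of_forall hC⟩

/-- Integration by parts for a product of two functions with square integrable weak
derivatives. -/
lemma integral_weakPartial_mul {i : Fin N} {f g F G φ : Space N → ℝ} (hf : WeakPartial i f F)
    (hg : WeakPartial i g G) (lf : RealL2Loc f) (lg : RealL2Loc g) (lF : RealL2Loc F)
    (lG : RealL2Loc G) (hφ : IsTestFunction φ) :
    (∫ x, partialDeriv i φ x * (f x * g x)) + (∫ x, φ x * (F x * g x))
      + ∫ x, φ x * (f x * G x) = 0 := by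
  set v := fun n => mollify n f with hv
  have sv : ∀ n, ContDiff ℝ ∞ (v n) := fun n => contDiff_mollify n hf.1
  have sV : ∀ n, ContDiff ℝ ∞ (mollify n F) := fun n => contDiff_mollify n hf.2.1
  have tv := fun R => tendsto_eLpNorm_mollify_sub_ball lf R
  have tV := fun R => tendsto_eLpNorm_mollify_sub_ball lF R
  have t0 : ∀ (u : Space N → ℝ) (R : ℝ), Tendsto (fun _ : ℕ => eLpNorm (u - u) 2
      (volume.restrict (ball 0 R))) atTop (𝓝 0) := fun u R => by simp
  have lv : ∀ n, RealL2Loc (v n) := fun n => Continuous.realL2Loc (sv n).continuous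
  have lV : ∀ n, RealL2Loc (mollify n F) := fun n => Continuous.realL2Loc (sV n).continuous
  have hφ' := hφ.partialDeriv i
  obtain ⟨C, hC⟩ := exists_bound_of_hasCompactSupport hφ.1.continuous hφ.2
  obtain ⟨C', hC'⟩ := exists_bound_of_hasCompactSupport hφ'.1.continuous hφ'.2
  have m1 := hφ.1.continuous.aestronglyMeasurable (μ := volume)
  have m2 := hφ'.1.continuous.aestronglyMeasurable (μ := volume)
  have l1 := tendsto_integral_mul_mul hφ'.2 m2 hC' lf lg lv (fun _ => lg) tv (t0 g)
  have l2 := tendsto_integral_mul_mul hφ.2 m1 hC lF lg lV (fun _ => lg) tV (t0 g)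
  have l3 := tendsto_integral_mul_mul hφ.2 m1 hC lf lG lv (fun _ => lG) tv (t0 G)
  refine tendsto_nhds_unique ((l1.add l2).add l3) ?_
  refine tendsto_const_nhds.congr fun n => ?_
  -- Only `f` is mollified: `φ v_n` is then a test function for the weak derivative of `g` itself.
  have hψ : IsTestFunction (fun x => φ x * v n x) := ⟨hφ.1.mul (sv n), hφ.2.mul_right⟩
  have h := hg.2.2 _ hψ
  have hpd : ∀ x, partialDeriv i (fun x => φ x * v n x) x
      = partialDeriv i φ x * v n x + φ x * mollify n F x := by
    intro x
    rw [partialDeriv_mul ((hφ.1.differentiable (by norm_cast)) x)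
      (((sv n).differentiable (by norm_cast)) x), partialDeriv_mollify n hf]
  simp only [hpd] at h
  have i1 := integrable_mul_mul hφ'.2 m2 hC' (lv n) lg
  have i2 := integrable_mul_mul hφ.2 m1 hC (lV n) lg
  have e1 : ∫ x, (partialDeriv i φ x * v n x + φ x * mollify n F x) * g x
      = (∫ x, partialDeriv i φ x * (v n x * g x)) + ∫ x, φ x * (mollify n F x * g x) := by
    rw [← integral_add i1 i2]
    congr 1
    funext x
    ring
  have e2 : ∫ x, φ x * v n x * G x = ∫ x, φ x * (v n x * G x) := by
    congr 1
    funext x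
    ring
  rw [e1, e2] at h
  rw [h]
  ring

end ReducedWave

namespace ReducedWave

open Filter Topology ContinuousLinearMap Metric

variable {N : ℕ}

/-! ### Radial monotonicity of a function with a jump across a smooth surface -/

/-- The divergence of the vector field `x ↦ w(x) x`. -/
noncomputable def radialDiv {N : ℕ} (w : Space N → ℝ) (x : Space N) : ℝ :=
  N * w x + fderiv ℝ w x x

lemma integral_fderiv_apply_eq_zero {h : Space N → ℝ} (hh : ContDiff ℝ 1 h)
    (hc : HasCompactSupport h) (v : Space N) : ∫ x, fderiv ℝ h x v = 0 := by
  have h1 : Integrable (fun x => fderiv ℝ h x v) :=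
    ((hh.continuous_fderiv (by norm_num)).clm_apply continuous_const).integrable_of_hasCompactSupport
      (hc.fderiv_apply (𝕜 := ℝ) v)
  have h2 := hh.continuous.integrable_of_hasCompactSupport (μ := volume) hc
  have := integral_mul_fderiv_eq_neg_fderiv_mul_of_integrable (μ := volume) (f := fun _ => (1 : ℝ))
    (g := h) (v := v) (by simp) (by simpa using h1) (by simpa using h2)
    (fun x _ => differentiableAt_const _) (fun x _ => hh.differentiable (by norm_num) x)
  simpa using this

lemma fderiv_apply_self_eq_sum (w : Space N → ℝ) (x : Space N) :
    fderiv ℝ w x x = ∑ i, x i * fderiv ℝ w x (EuclideanSpace.single i 1) := by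
  have h : x = ∑ i, x i • EuclideanSpace.single i (1 : ℝ) := by
    simpa using ((EuclideanSpace.basisFun (Fin N) ℝ).sum_repr x).symm
  conv_lhs => rw [h, map_sum, ← h]
  simp

lemma hasFDerivAt_coord (i : Fin N) (x : Space N) :
    HasFDerivAt (fun y : Space N => y i) (EuclideanSpace.proj i : Space N →L[ℝ] ℝ) x :=
  (EuclideanSpace.proj i : Space N →L[ℝ] ℝ).hasFDerivAt

lemma contDiff_coord {n : ℕ∞ω} (i : Fin N) : ContDiff ℝ n (fun y : Space N => y i) :=
  (EuclideanSpace.proj i : Space N →L[ℝ] ℝ).contDiff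

lemma continuous_radialDiv {w : Space N → ℝ} (hw : ContDiff ℝ 1 w) : Continuous (radialDiv w) :=
  (continuous_const.mul hw.continuous).add
    ((hw.continuous_fderiv (by norm_num)).clm_apply continuous_id)

lemma radialDiv_eq_zero {w : Space N → ℝ} {x : Space N} (hx : x ∉ tsupport w) :
    radialDiv w x = 0 := by
  have h2 : fderiv ℝ w x = 0 := image_eq_zero_of_notMem_tsupport
    fun h => hx (tsupport_fderiv_subset ℝ h)
  simp [radialDiv, image_eq_zero_of_notMem_tsupport hx, h2]

lemma hasCompactSupport_radialDiv {w : Space N → ℝ} (hc : HasCompactSupport w) :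
    HasCompactSupport (radialDiv w) :=
  HasCompactSupport.intro hc.isCompact fun _ => radialDiv_eq_zero

lemma integrable_radialDiv {w : Space N → ℝ} (hw : ContDiff ℝ 1 w) (hc : HasCompactSupport w) :
    Integrable (radialDiv w) :=
  (continuous_radialDiv hw).integrable_of_hasCompactSupport (hasCompactSupport_radialDiv hc)

lemma radialDiv_mul {f g : Space N → ℝ} {x : Space N} (hf : DifferentiableAt ℝ f x)
    (hg : DifferentiableAt ℝ g x) :
    radialDiv (fun y => f y * g y) x = f x * radialDiv g x + fderiv ℝ f x x * g x := by
  simp only [radialDiv, fderiv_fun_mul hf hg]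
  simp
  ring

lemma integral_radialDiv {h : Space N → ℝ} (hh : ContDiff ℝ 1 h) (hc : HasCompactSupport h) :
    ∫ x, radialDiv h x = 0 := by
  have hd : ∀ (i : Fin N) (x : Space N),
      fderiv ℝ (fun y => y i * h y) x (EuclideanSpace.single i 1)
        = h x + x i * fderiv ℝ h x (EuclideanSpace.single i 1) := by
    intro i x
    rw [fderiv_fun_mul (hasFDerivAt_coord i x).differentiableAt
      (hh.differentiable (by norm_num) x), (hasFDerivAt_coord i x).fderiv]
    simp
    ring
  have hs : ∀ i : Fin N, ContDiff ℝ 1 (fun y : Space N => y i * h y) :=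
    fun i => (contDiff_coord i).mul hh
  have hsc : ∀ i : Fin N, HasCompactSupport (fun y : Space N => y i * h y) :=
    fun i => hc.mul_left
  have e : ∀ x, radialDiv h x
      = ∑ i, fderiv ℝ (fun y => y i * h y) x (EuclideanSpace.single i 1) := by
    intro x
    simp only [hd, Finset.sum_add_distrib, Finset.sum_const, Finset.card_univ, Fintype.card_fin,
      nsmul_eq_mul, radialDiv, fderiv_apply_self_eq_sum h x]
  simp only [e]
  rw [integral_finsetSum]
  · exact Finset.sum_eq_zero fun i _ => integral_fderiv_apply_eq_zero (hs i) (hsc i) _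
  · intro i _
    exact (((hs i).continuous_fderiv (by norm_num)).clm_apply
      continuous_const).integrable_of_hasCompactSupport ((hsc i).fderiv_apply (𝕜 := ℝ) _)

/-- A smooth approximation of the indicator function of the negative half line. -/
noncomputable def negStep (ε s : ℝ) : ℝ := Real.smoothTransition (-s / ε)

lemma contDiff_negStep (ε : ℝ) : ContDiff ℝ 1 (negStep ε) :=
  (Real.smoothTransition.contDiff (n := 1)).comp (contDiff_neg.div_const ε)

lemma negStep_nonneg (ε s : ℝ) : 0 ≤ negStep ε s := Real.smoothTransition.nonneg _

lemma negStep_le_one (ε s : ℝ) : negStep ε s ≤ 1 := Real.smoothTransition.le_one _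

lemma negStep_of_nonneg {ε s : ℝ} (hε : 0 < ε) (hs : 0 ≤ s) : negStep ε s = 0 :=
  Real.smoothTransition.zero_of_nonpos (div_nonpos_of_nonpos_of_nonneg (by linarith) hε.le)

lemma negStep_of_le {ε s : ℝ} (hε : 0 < ε) (hs : s ≤ -ε) : negStep ε s = 1 :=
  Real.smoothTransition.one_of_one_le ((one_le_div hε).2 (by linarith))

lemma antitone_negStep {ε : ℝ} (hε : 0 < ε) : Antitone (negStep ε) := fun a b hab =>
  Real.smoothTransition.monotone (div_le_div_of_nonneg_right (by linarith) hε.le)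

lemma deriv_negStep_nonpos {ε : ℝ} (hε : 0 < ε) (s : ℝ) : deriv (negStep ε) s ≤ 0 :=
  (antitone_negStep hε).deriv_nonpos

lemma deriv_negStep_eq_zero {ε s : ℝ} (hε : 0 < ε) (hs : s < -ε ∨ 0 < s) :
    deriv (negStep ε) s = 0 := by
  rcases hs with hs | hs
  · have : negStep ε =ᶠ[𝓝 s] fun _ => 1 := by
      filter_upwards [Iio_mem_nhds hs] with t ht
      exact negStep_of_le hε (le_of_lt ht)
    rw [this.deriv_eq]; simp
  · have : negStep ε =ᶠ[𝓝 s] fun _ => 0 := by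
      filter_upwards [Ioi_mem_nhds hs] with t ht
      exact negStep_of_nonneg hε (le_of_lt ht)
    rw [this.deriv_eq]; simp

lemma add_le_along {g : Space N → ℝ} {e y : Space N} {ε : ℝ}
    (hd : ∀ s ∈ Icc 0 ε, DifferentiableAt ℝ g (y + s • e) ∧ 1 ≤ fderiv ℝ g (y + s • e) e)
    (hε : 0 ≤ ε) : g y + ε ≤ g (y + ε • e) := by
  have hder : ∀ s ∈ Icc 0 ε,
      HasDerivAt (fun s : ℝ => g (y + s • e)) (fderiv ℝ g (y + s • e) e) s := by
    intro s hs
    have h3 : HasDerivAt (fun s : ℝ => y + s • e) e s := by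
      simpa using ((hasDerivAt_id s).smul_const e).const_add y
    exact (hd s hs).1.hasFDerivAt.comp_hasDerivAt s h3
  have hcont : ContinuousOn (fun s : ℝ => g (y + s • e)) (Icc 0 ε) :=
    fun s hs => (hder s hs).continuousAt.continuousWithinAt
  have hgrow := (convex_Icc (0 : ℝ) ε).mul_sub_le_image_sub_of_le_deriv (C := 1) hcont
    (fun s hs => (hder s (interior_subset hs)).differentiableAt.differentiableWithinAt)
    (fun s hs => by
      rw [(hder s (interior_subset hs)).deriv]
      exact (hd s (interior_subset hs)).2)
    0 (left_mem_Icc.2 hε) ε (right_mem_Icc.2 hε) hε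
  simp only [zero_smul, add_zero, sub_zero, one_mul] at hgrow
  linarith

/-- Over a time `ε` the function gains at least `ε`, enough to carry it from `[-ε, 0]` across zero.
-/
lemma exists_zero_along {g : Space N → ℝ} {e y : Space N} {ε : ℝ}
    (hd : ∀ s ∈ Icc 0 ε, DifferentiableAt ℝ g (y + s • e) ∧ 1 ≤ fderiv ℝ g (y + s • e) e)
    (hε : 0 < ε) (h1 : -ε ≤ g y) (h2 : g y ≤ 0) : ∃ s ∈ Icc 0 ε, g (y + s • e) = 0 := by
  have hcont : ContinuousOn (fun s : ℝ => g (y + s • e)) (Icc 0 ε) := fun s hs => by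
    have hc : ContinuousAt (fun s : ℝ => y + s • e) s := by fun_prop
    exact (ContinuousAt.comp (f := fun s : ℝ => y + s • e) (hd s hs).1.continuousAt
      hc).continuousWithinAt
  have hgrow := add_le_along hd hε.le
  obtain ⟨s, hs, hs0⟩ := intermediate_value_Icc hε.le hcont (show (0 : ℝ) ∈ Icc _ _ by
    constructor
    · simpa using h2
    · linarith)
  exact ⟨s, hs, hs0⟩

/-- Near a point where `dg ≠ 0`, there is a direction along which `g` grows at unit speed. -/
lemma exists_ball_one_le_fderiv {V : Set (Space N)} {g : Space N → ℝ} {x₀ : Space N}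
    (hV : IsOpen V) (hx₀ : x₀ ∈ V) (hg : ContDiffOn ℝ 1 g V) (hd : fderiv ℝ g x₀ ≠ 0) :
    ∃ (e : Space N) (r : ℝ), 0 < r ∧ closedBall x₀ (2 * r) ⊆ V ∧
      ∀ y ∈ closedBall x₀ (2 * r), 1 ≤ fderiv ℝ g y e := by
  obtain ⟨e', he'⟩ : ∃ e, fderiv ℝ g x₀ e ≠ 0 := by
    by_contra! h
    exact hd (ContinuousLinearMap.ext h)
  set e := (2 / fderiv ℝ g x₀ e') • e' with he
  have he2 : fderiv ℝ g x₀ e = 2 := by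
    rw [he, map_smul, smul_eq_mul, div_mul_cancel₀ _ he']
  have hcont : ContinuousAt (fun y => fderiv ℝ g y e) x₀ :=
    ((hg.continuousOn_fderiv_of_isOpen hV le_rfl).continuousAt (hV.mem_nhds hx₀)).clm_apply
      continuousAt_const
  have h1 : ∀ᶠ y in 𝓝 x₀, 1 ≤ fderiv ℝ g y e ∧ y ∈ V := by
    refine ((hcont.eventually (lt_mem_nhds (a := 1) ?_)).mono fun y hy => le_of_lt hy).and
      (hV.mem_nhds hx₀)
    change 1 < fderiv ℝ g x₀ e
    rw [he2]; norm_num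
  obtain ⟨r, hr, hball⟩ := Metric.nhds_basis_closedBall.eventually_iff.1 h1
  refine ⟨e, r / 2, by positivity, ?_, ?_⟩
  · intro y hy
    exact (hball (by convert hy using 2; ring)).2
  · intro y hy
    exact (hball (by convert hy using 2; ring)).1

lemma contDiff_of_contDiffAt_tsupport {f : Space N → ℝ} {n : ℕ∞ω}
    (hf : ∀ x ∈ tsupport f, ContDiffAt ℝ n f x) : ContDiff ℝ n f :=
  contDiff_iff_contDiffAt.2 fun x => by
    by_cases hx : x ∈ tsupport f
    · exact hf x hx
    · exact (contDiffAt_const (c := (0 : ℝ))).congr_of_eventuallyEq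
        (notMem_tsupport_iff_eventuallyEq.1 hx)

/-- If `σ (dg(y) y) ≤ 0` on the surface `g = 0`, then `σ` times the indicator function of
`{g < 0}` is radially nonincreasing near each point of the surface where `dg ≠ 0`. -/
lemma exists_nhds_integral_sublevel_le {V : Set (Space N)} {g : Space N → ℝ} {x₀ : Space N}
    {σ : ℝ} (hV : IsOpen V) (hx₀ : x₀ ∈ V) (hg : ContDiffOn ℝ 1 g V) (hd : fderiv ℝ g x₀ ≠ 0)
    (hσ : ∀ y ∈ V, g y = 0 → σ * fderiv ℝ g y y ≤ 0) :
    ∃ V' ∈ 𝓝 x₀, ∀ w : Space N → ℝ, ContDiff ℝ 1 w → HasCompactSupport w → tsupport w ⊆ V' →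
      (∀ x, 0 ≤ w x) → σ * ∫ x in {y ∈ V | g y < 0}, radialDiv w x ≤ 0 := by
  obtain ⟨e, r, hr, hrV, hre⟩ := exists_ball_one_le_fderiv hV hx₀ hg hd
  refine ⟨ball x₀ r, ball_mem_nhds _ hr, fun w hw hwc hws hw0 => ?_⟩
  have hwV : tsupport w ⊆ V := hws.trans ((ball_subset_closedBall.trans
    (closedBall_subset_closedBall (by linarith))).trans hrV)
  have hgd : ∀ y ∈ V, ContDiffAt ℝ 1 g y := fun y hy => hg.contDiffAt (hV.mem_nhds hy)
  have hgdiff : ∀ y ∈ V, DifferentiableAt ℝ g y := fun y hy =>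
    (hgd y hy).differentiableAt (by norm_num)
  -- the cut-off functions
  have hTs : ∀ ε, ∀ y ∈ V, ContDiffAt ℝ 1 (fun y => negStep ε (g y)) y := fun ε y hy =>
    (contDiff_negStep ε).contDiffAt.comp y (hgd y hy)
  -- Nothing is assumed of `g` outside `V`; the product is still globally `C¹` because `w` is
  -- supported in `V`.
  set h : ℝ → Space N → ℝ := fun ε y => negStep ε (g y) * w y with hh
  have hts : ∀ ε, tsupport (h ε) ⊆ tsupport w := fun ε => tsupport_mul_subset_right
  have hhs : ∀ ε, ContDiff ℝ 1 (h ε) := fun ε => contDiff_of_contDiffAt_tsupport fun y hy =>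
    (hTs ε y (hwV (hts ε hy))).mul hw.contDiffAt
  have hhc : ∀ ε, HasCompactSupport (h ε) := fun ε => hwc.mul_left
  have hTd : ∀ ε, ∀ y ∈ V, ∀ v, fderiv ℝ (fun y => negStep ε (g y)) y v
      = deriv (negStep ε) (g y) * fderiv ℝ g y v := by
    intro ε y hy v
    have h1 : HasDerivAt (negStep ε) (deriv (negStep ε) (g y)) (g y) :=
      ((contDiff_negStep ε).differentiable (by norm_num) _).hasDerivAt
    have h2 : HasFDerivAt (fun y => negStep ε (g y)) _ y :=
      h1.comp_hasFDerivAt y (hgdiff y hy).hasFDerivAt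
    rw [h2.fderiv]
    rfl
  have hdh : ∀ ε, ∀ y ∈ V, ∀ v, fderiv ℝ (h ε) y v
      = negStep ε (g y) * fderiv ℝ w y v + deriv (negStep ε) (g y) * fderiv ℝ g y v * w y := by
    intro ε y hy v
    rw [hh]
    simp only
    rw [fderiv_fun_mul ((hTs ε y hy).differentiableAt (by norm_num))
      (hw.differentiable (by norm_num) y)]
    simp only [_root_.add_apply, _root_.smul_apply, smul_eq_mul, hTd ε y hy v]
    ring
  have hzero : ∀ y, y ∉ tsupport w → w y = 0 ∧ fderiv ℝ w y = 0 := fun y hy =>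
    ⟨image_eq_zero_of_notMem_tsupport hy, image_eq_zero_of_notMem_tsupport
      fun h => hy (tsupport_fderiv_subset ℝ h)⟩
  have hgf : ContinuousOn (fderiv ℝ g) V := hg.continuousOn_fderiv_of_isOpen hV le_rfl
  -- integrable functions
  have cont : ∀ (f : Space N → ℝ), (∀ y ∈ tsupport w, ContinuousAt f y) →
      (∀ y, y ∉ tsupport w → f y = 0) → Integrable f := by
    intro f hf hf0
    have hs : tsupport f ⊆ tsupport w := by
      refine closure_minimal (fun y hy => ?_) (isClosed_tsupport w)
      by_contra hy'
      exact hy (hf0 y hy')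
    exact (continuous_of_tsupport fun y hy => hf y (hs hy)).integrable_of_hasCompactSupport
      (hwc.of_isClosed_subset (isClosed_tsupport f) hs)
  have hTc : ∀ ε, ∀ y ∈ tsupport w, ContinuousAt (fun y => negStep ε (g y)) y := fun ε y hy =>
    (hTs ε y (hwV hy)).continuousAt
  have hT'c : ∀ ε, ∀ y ∈ tsupport w, ContinuousAt (fun y => deriv (negStep ε) (g y)) y :=
    fun ε y hy => (((contDiff_negStep ε).continuous_deriv le_rfl).continuousAt).comp
      (hgd y (hwV hy)).continuousAt
  have hgfc : ∀ y ∈ tsupport w, ContinuousAt (fderiv ℝ g) y := fun y hy =>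
    hgf.continuousAt (hV.mem_nhds (hwV hy))
  have i1 : ∀ ε, Integrable (fun y => negStep ε (g y) * radialDiv w y) := fun ε =>
    cont _ (fun y hy => (hTc ε y hy).mul (continuous_radialDiv hw).continuousAt)
      fun y hy => by rw [radialDiv_eq_zero hy, mul_zero]
  have i2 : ∀ ε (v : Space N → Space N), Continuous v →
      Integrable (fun y => -deriv (negStep ε) (g y) * fderiv ℝ g y (v y) * w y) := fun ε v hv =>
    cont _ (fun y hy => ((hT'c ε y hy).neg.mul ((hgfc y hy).clm_apply hv.continuousAt)).mul
      hw.continuous.continuousAt) fun y hy => by rw [(hzero y hy).1, mul_zero]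
  have i3 : ∀ ε, Integrable (fun y => negStep ε (g y) * fderiv ℝ w y e) := fun ε =>
    cont _ (fun y hy => (hTc ε y hy).mul ((hw.continuous_fderiv (by norm_num)).clm_apply
      continuous_const).continuousAt) fun y hy => by rw [(hzero y hy).2]; simp
  have i4 : Integrable (fun y => |fderiv ℝ w y e|) :=
    cont _ (fun y _ => ((hw.continuous_fderiv (by norm_num)).clm_apply
      continuous_const).abs.continuousAt) fun y hy => by rw [(hzero y hy).2]; simp
  -- Here `div(h y)` integrates to zero. `eq2` is the same with the constant field `e` in place of
  -- the position field; it bounds the mass of `-negStep' (g)` independently of `ε`.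
  have eq1 : ∀ ε, ∫ y, negStep ε (g y) * radialDiv w y
      = ∫ y, -deriv (negStep ε) (g y) * fderiv ℝ g y y * w y := by
    intro ε
    rw [← sub_eq_zero, ← integral_sub (i1 ε) (i2 ε (fun y => y) continuous_id),
      ← integral_radialDiv (hhs ε) (hhc ε)]
    refine integral_congr_ae (Eventually.of_forall fun y => ?_)
    by_cases hy : y ∈ tsupport w
    · simp only [radialDiv, hdh ε y (hwV hy)]
      simp only [hh]
      ring
    · rw [radialDiv_eq_zero (fun h' => hy (hts ε h'))]
      simp only [radialDiv_eq_zero hy, (hzero y hy).1]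
      ring
  have eq2 : ∀ ε, ∫ y, negStep ε (g y) * fderiv ℝ w y e
      = ∫ y, -deriv (negStep ε) (g y) * fderiv ℝ g y e * w y := by
    intro ε
    rw [← sub_eq_zero, ← integral_sub (i3 ε) (i2 ε (fun _ => e) continuous_const),
      ← integral_fderiv_apply_eq_zero (hhs ε) (hhc ε) e]
    refine integral_congr_ae (Eventually.of_forall fun y => ?_)
    by_cases hy : y ∈ tsupport w
    · simp only [hdh ε y (hwV hy)]
      ring
    · have : fderiv ℝ (h ε) y = 0 := image_eq_zero_of_notMem_tsupport
        fun h' => hy (hts ε (tsupport_fderiv_subset ℝ h'))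
      simp only [this, (hzero y hy).1, (hzero y hy).2]
      simp
  set C := ∫ y, |fderiv ℝ w y e| with hC
  have hC0 : 0 ≤ C := integral_nonneg fun y => abs_nonneg _
  -- uniform continuity of `σ dg(y) y`
  have huc : UniformContinuousOn (fun y => σ * fderiv ℝ g y y) (closedBall x₀ (2 * r)) := by
    refine (isCompact_closedBall x₀ (2 * r)).uniformContinuousOn_of_continuous ?_
    exact continuousOn_const.mul ((hgf.mono hrV).clm_apply continuousOn_id)
  -- Where `negStep' (g)` is nonzero, moving by at most `ε ‖e‖` along `e` reaches `g = 0`, where the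
  -- sign hypothesis applies. By uniform continuity `σ dg(y) y ≤ κ ≤ κ dg(y) e` there, and `eq2`
  -- then bounds the integral by `κ C`. This avoids surface measures.
  have bound : ∀ κ > 0, ∀ᶠ ε in 𝓝[>] (0 : ℝ),
      σ * ∫ y, negStep ε (g y) * radialDiv w y ≤ κ * C := by
    intro κ hκ
    obtain ⟨δ, hδ, hδq⟩ := Metric.uniformContinuousOn_iff.1 huc κ hκ
    have hsmall : ∀ᶠ ε in 𝓝[>] (0 : ℝ), ε * ‖e‖ < min r δ := by
      have : Tendsto (fun ε : ℝ => ε * ‖e‖) (𝓝[>] 0) (𝓝 0) := by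
        have h0 : Tendsto (fun ε : ℝ => ε * ‖e‖) (𝓝 0) (𝓝 (0 * ‖e‖)) :=
          tendsto_id.mul_const _
        rw [zero_mul] at h0
        exact h0.mono_left nhdsWithin_le_nhds
      exact this.eventually (gt_mem_nhds (lt_min hr hδ))
    filter_upwards [hsmall, self_mem_nhdsWithin] with ε hε hε0
    have hε0 : 0 < ε := hε0
    have hpt : ∀ y, σ * (-deriv (negStep ε) (g y) * fderiv ℝ g y y * w y)
        ≤ κ * (-deriv (negStep ε) (g y) * fderiv ℝ g y e * w y) := by
      intro y
      by_cases hy : y ∈ tsupport w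
      swap
      · simp [(hzero y hy).1]
      by_cases hgy : deriv (negStep ε) (g y) = 0
      · simp [hgy]
      have hg1 : -ε ≤ g y ∧ g y ≤ 0 := by
        constructor
        · by_contra! hlt
          exact hgy (deriv_negStep_eq_zero hε0 (Or.inl hlt))
        · by_contra! hlt
          exact hgy (deriv_negStep_eq_zero hε0 (Or.inr hlt))
      have hyr : dist y x₀ < r := hws hy
      have hmove : ∀ s ∈ Icc (0 : ℝ) ε, dist (y + s • e) y ≤ ε * ‖e‖ := by
        intro s hs
        rw [dist_eq_norm, add_sub_cancel_left, norm_smul, Real.norm_of_nonneg hs.1]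
        gcongr
        exact hs.2
      have hmove' : ∀ s ∈ Icc (0 : ℝ) ε, y + s • e ∈ closedBall x₀ (2 * r) := by
        intro s hs
        have h1 := dist_triangle (y + s • e) y x₀
        have h2 := hmove s hs
        have h3 := hε.trans_le (min_le_left _ _)
        rw [mem_closedBall]
        linarith
      obtain ⟨s, hs, hs0⟩ := exists_zero_along (g := g) (e := e) (y := y) (ε := ε)
        (fun s hs => ⟨hgdiff _ (hrV (hmove' s hs)), hre _ (hmove' s hs)⟩) hε0 hg1.1 hg1.2
      have hy2 : y ∈ closedBall x₀ (2 * r) := by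
        rw [mem_closedBall]; linarith
      have hq := hδq y hy2 _ (hmove' s hs) (by
        rw [dist_comm]
        exact (hmove s hs).trans_lt (hε.trans_le (min_le_right _ _)))
      have hq0 := hσ _ (hrV (hmove' s hs)) hs0
      rw [Real.dist_eq] at hq
      have hqy : σ * fderiv ℝ g y y ≤ κ := by
        have := (abs_lt.1 hq).2
        linarith
      have hge := hre y hy2
      have hnn : 0 ≤ -deriv (negStep ε) (g y) * w y :=
        mul_nonneg (neg_nonneg.2 (deriv_negStep_nonpos hε0 _)) (hw0 y)
      calc σ * (-deriv (negStep ε) (g y) * fderiv ℝ g y y * w y)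
          = (-deriv (negStep ε) (g y) * w y) * (σ * fderiv ℝ g y y) := by ring
        _ ≤ (-deriv (negStep ε) (g y) * w y) * (κ * fderiv ℝ g y e) := by
            apply mul_le_mul_of_nonneg_left _ hnn
            nlinarith
        _ = _ := by ring
    calc σ * ∫ y, negStep ε (g y) * radialDiv w y
        = ∫ y, σ * (-deriv (negStep ε) (g y) * fderiv ℝ g y y * w y) := by
          rw [eq1, integral_const_mul]
      _ ≤ ∫ y, κ * (-deriv (negStep ε) (g y) * fderiv ℝ g y e * w y) :=
          integral_mono ((i2 ε (fun y => y) continuous_id).const_mul σ)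
            ((i2 ε (fun _ => e) continuous_const).const_mul κ) hpt
      _ = κ * ∫ y, negStep ε (g y) * fderiv ℝ w y e := by
          rw [integral_const_mul, eq2]
      _ ≤ κ * C := by
          refine mul_le_mul_of_nonneg_left (integral_mono (i3 ε) i4 fun y => ?_) hκ.le
          calc negStep ε (g y) * fderiv ℝ w y e ≤ negStep ε (g y) * |fderiv ℝ w y e| := by
                gcongr
                · exact negStep_nonneg _ _
                · exact le_abs_self _
            _ ≤ 1 * |fderiv ℝ w y e| := by gcongr; exact negStep_le_one _ _
            _ = _ := one_mul _
  -- passage to the limit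
  have hms : MeasurableSet {y ∈ V | g y < 0} := by
    have : IsOpen {y ∈ V | g y < 0} := hg.continuousOn.isOpen_inter_preimage hV isOpen_Iio
    exact this.measurableSet
  -- `negStep ε` vanishes at `0`, so the pointwise limit is the indicator of the strict sublevel set
  -- everywhere, and it does not matter whether the surface is null.
  have lim : Tendsto (fun ε => ∫ y, negStep ε (g y) * radialDiv w y) (𝓝[>] 0)
      (𝓝 (∫ y in {y ∈ V | g y < 0}, radialDiv w y)) := by
    rw [← integral_indicator hms]
    refine tendsto_integral_filter_of_dominated_convergence (fun y => ‖radialDiv w y‖)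
      (Eventually.of_forall fun ε => (i1 ε).aestronglyMeasurable)
      (Eventually.of_forall fun ε => Eventually.of_forall fun y => ?_)
      (integrable_radialDiv hw hwc).norm (Eventually.of_forall fun y => ?_)
    · rw [norm_mul, Real.norm_of_nonneg (negStep_nonneg _ _)]
      exact mul_le_of_le_one_left (norm_nonneg _) (negStep_le_one _ _)
    · by_cases hy : y ∈ tsupport w
      swap
      · simp [radialDiv_eq_zero hy, indicator]
      by_cases hgy : g y < 0
      · rw [indicator_of_mem (show y ∈ {y ∈ V | g y < 0} from ⟨hwV hy, hgy⟩)]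
        refine tendsto_const_nhds.congr' ?_
        have : Ioo 0 (-g y) ∈ 𝓝[>] (0 : ℝ) := Ioo_mem_nhdsGT (by linarith)
        filter_upwards [this] with ε hε
        rw [negStep_of_le hε.1 (by linarith [hε.2]), one_mul]
      · rw [indicator_of_notMem (fun h' => hgy h'.2)]
        refine tendsto_const_nhds.congr' ?_
        filter_upwards [self_mem_nhdsWithin] with ε hε
        rw [negStep_of_nonneg hε (not_lt.1 hgy), zero_mul]
  refine le_of_forall_pos_le_add fun κ hκ => ?_
  -- The denominator `C + 1` allows for `C = 0`.
  have h1 := le_of_tendsto (lim.const_mul σ) (bound (κ / (C + 1)) (by positivity))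
  refine h1.trans ?_
  rw [zero_add, div_mul_eq_mul_div, div_le_iff₀ (by positivity)]
  nlinarith

end ReducedWave

namespace ReducedWave

open Filter Topology ContinuousLinearMap Metric
open scoped Pointwise

variable {N : ℕ}

/-! ### Open sets bounded by smooth hypersurfaces -/

/-- Off its frontier, space splits into the two disjoint open sets `Ω` and the exterior of `Ω`. -/
lemma IsPreconnected.subset_or_disjoint_of_frontier {X : Type*} [TopologicalSpace X] {P Ω : Set X}
    (hP : IsPreconnected P) (hΩ : IsOpen Ω) (h : Disjoint P (frontier Ω)) :
    P ⊆ Ω ∨ Disjoint P Ω := by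
  have hsub : P ⊆ Ω ∪ (closure Ω)ᶜ := by
    intro y hy
    by_cases hyc : y ∈ closure Ω
    · left
      by_contra hn
      exact disjoint_left.1 h hy (by rw [hΩ.frontier_eq]; exact ⟨hyc, hn⟩)
    · exact Or.inr hyc
  have hd : Disjoint Ω (closure Ω)ᶜ :=
    disjoint_left.2 fun y hy hy' => hy' (subset_closure hy)
  rcases hP.subset_or_subset hΩ isClosed_closure.isOpen_compl hd hsub with h1 | h1
  · exact Or.inl h1
  · exact Or.inr (disjoint_left.2 fun y hy hy' => h1 hy (subset_closure hy'))

/-- Near a point where `dg ≠ 0`, both sides of the surface `g = 0` are connected. -/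
lemma exists_isPreconnected_sides {U : Set (Space N)} {g : Space N → ℝ} {x : Space N}
    (hU : IsOpen U) (hx : x ∈ U) (hg : ContDiffOn ℝ 1 g U)
    (hd : fderiv ℝ g x ≠ 0) :
    ∃ V ⊆ U, IsOpen V ∧ x ∈ V ∧ IsPreconnected {y ∈ V | g y < 0} ∧
      IsPreconnected {y ∈ V | 0 < g y} := by
  have hst : HasStrictFDerivAt g (fderiv ℝ g x) x :=
    (hg.contDiffAt (hU.mem_nhds hx)).hasStrictFDerivAt (by norm_num)
  have hr : (fderiv ℝ g x).range = ⊤ := by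
    refine LinearMap.range_eq_top.2 (LinearMap.surjective ?_)
    intro h
    exact hd (ContinuousLinearMap.ext fun v => by simpa using LinearMap.congr_fun h v)
  set φ := hst.implicitToOpenPartialHomeomorph g (fderiv ℝ g x) hr with hφ
  have hφ1 : ∀ y, (φ y).1 = g y := fun y => hst.implicitToOpenPartialHomeomorph_fst hr y
  have hxs : x ∈ φ.source := hst.mem_implicitToOpenPartialHomeomorph_source hr
  have hT : IsOpen (φ.target ∩ φ.symm ⁻¹' U) := φ.isOpen_inter_preimage_symm hU
  have hxT : φ x ∈ φ.target ∩ φ.symm ⁻¹' U := ⟨φ.map_source hxs, by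
    rw [mem_preimage, φ.left_inv hxs]; exact hx⟩
  obtain ⟨r, hr0, hrT⟩ := Metric.isOpen_iff.1 hT _ hxT
  -- In the implicit function chart `g` is the first coordinate, so each side of the surface is the
  -- image of a convex piece of a ball.
  have hconn : ∀ S : Set ℝ, Convex ℝ S →
      IsPreconnected {y ∈ φ.source ∩ φ ⁻¹' ball (φ x) r | g y ∈ S} := by
    intro S hS
    have e : {y ∈ φ.source ∩ φ ⁻¹' ball (φ x) r | g y ∈ S}
        = φ.symm '' (ball (φ x) r ∩ Prod.fst ⁻¹' S) := by
      ext y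
      constructor
      · rintro ⟨⟨h1, h2⟩, h3⟩
        exact ⟨φ y, ⟨h2, by rw [mem_preimage, hφ1]; exact h3⟩, φ.left_inv h1⟩
      · rintro ⟨p, ⟨h1, h2⟩, rfl⟩
        have hp : p ∈ φ.target := (hrT h1).1
        refine ⟨⟨φ.map_target hp, ?_⟩, ?_⟩
        · rw [mem_preimage, φ.right_inv hp]; exact h1
        · rw [← hφ1, φ.right_inv hp]; exact h2
    rw [e]
    refine IsPreconnected.image ?_ _ (φ.continuousOn_symm.mono fun p hp => (hrT hp.1).1)
    exact ((convex_ball (φ x) r).inter (hS.linear_preimage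
      (LinearMap.fst ℝ ℝ (fderiv ℝ g x).ker))).isPreconnected
  refine ⟨φ.source ∩ φ ⁻¹' ball (φ x) r, ?_, φ.isOpen_inter_preimage isOpen_ball,
    ⟨hxs, mem_ball_self hr0⟩, hconn (Iio 0) (convex_Iio 0), hconn (Ioi 0) (convex_Ioi 0)⟩
  rintro y ⟨h1, h2⟩
  have := (hrT h2).2
  rwa [mem_preimage, φ.left_inv h1] at this

/-- Near a smooth boundary point an open set lies on one side of its boundary, or on both. -/
lemma exists_side_of_isHypersurfaceAt {Ω : Set (Space N)} (hΩ : IsOpen Ω) {x : Space N}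
    (hx : x ∈ frontier Ω) (h : IsHypersurfaceAt (frontier Ω) x) :
    ∃ (V : Set (Space N)) (g : Space N → ℝ), IsOpen V ∧ x ∈ V ∧ ContDiffOn ℝ 1 g V ∧ g x = 0 ∧
      fderiv ℝ g x ≠ 0 ∧ frontier Ω ∩ V = {y ∈ V | g y = 0} ∧
      (Ω ∩ V = {y ∈ V | g y < 0} ∨ Ω ∩ V = {y ∈ V | g y ≠ 0}) := by
  obtain ⟨U, g, hU, hxU, hg, hd, hS⟩ := h
  have hgx : g x = 0 := by
    have : x ∈ {y ∈ U | g y = 0} := hS ▸ ⟨hx, hxU⟩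
    exact this.2
  obtain ⟨V, hVU, hV, hxV, hneg, hpos⟩ := exists_isPreconnected_sides hU hxU hg hd
  have hS' : frontier Ω ∩ V = {y ∈ V | g y = 0} := by
    ext y
    constructor
    · rintro ⟨h1, h2⟩
      have : y ∈ {y ∈ U | g y = 0} := hS ▸ ⟨h1, hVU h2⟩
      exact ⟨h2, this.2⟩
    · rintro ⟨h1, h2⟩
      have : y ∈ frontier Ω ∩ U := hS ▸ ⟨hVU h1, h2⟩
      exact ⟨this.1, h1⟩
  have hfr : ∀ y ∈ V, g y ≠ 0 → y ∉ frontier Ω := fun y hy h0 hyf =>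
    h0 (show y ∈ {y ∈ V | g y = 0} from hS' ▸ ⟨hyf, hy⟩).2
  have hΩ0 : ∀ y ∈ Ω, y ∈ V → g y ≠ 0 := fun y hy hyV h0 => by
    have : y ∈ frontier Ω ∩ V := hS' ▸ ⟨hyV, h0⟩
    rw [hΩ.frontier_eq] at this
    exact this.1.2 hy
  have c1 := IsPreconnected.subset_or_disjoint_of_frontier hneg hΩ
    (disjoint_left.2 fun y hy => hfr y hy.1 hy.2.ne)
  have c2 := IsPreconnected.subset_or_disjoint_of_frontier hpos hΩ
    (disjoint_left.2 fun y hy => hfr y hy.1 hy.2.ne')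
  -- Each side is inside `Ω` or misses it. If both are inside, `Ω` lies on both sides of the
  -- surface; if only the positive side is, replace `g` by `-g`; if neither is, `x` would not be in
  -- the closure of `Ω`.
  rcases c1 with c1 | c1 <;> rcases c2 with c2 | c2
  · refine ⟨V, g, hV, hxV, hg.mono hVU, hgx, hd, hS', Or.inr ?_⟩
    ext y
    refine ⟨fun hy => ⟨hy.2, hΩ0 y hy.1 hy.2⟩, fun hy => ⟨?_, hy.1⟩⟩
    rcases lt_or_gt_of_ne hy.2 with h0 | h0
    · exact c1 ⟨hy.1, h0⟩
    · exact c2 ⟨hy.1, h0⟩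
  · refine ⟨V, g, hV, hxV, hg.mono hVU, hgx, hd, hS', Or.inl ?_⟩
    ext y
    refine ⟨fun hy => ⟨hy.2, ?_⟩, fun hy => ⟨c1 hy, hy.1⟩⟩
    rcases lt_or_gt_of_ne (hΩ0 y hy.1 hy.2) with h0 | h0
    · exact h0
    · exact absurd hy.1 (disjoint_left.1 c2 ⟨hy.2, h0⟩)
  · refine ⟨V, fun y => -g y, hV, hxV, (hg.mono hVU).neg, by simp [hgx], ?_, ?_, Or.inl ?_⟩
    · rw [fderiv_fun_neg]; exact neg_ne_zero.2 hd
    · simpa using hS'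
    · ext y
      refine ⟨fun hy => ⟨hy.2, ?_⟩, fun hy => ⟨c2 ⟨hy.1, by simpa using hy.2⟩, hy.1⟩⟩
      rcases lt_or_gt_of_ne (hΩ0 y hy.1 hy.2) with h0 | h0
      · exact absurd hy.1 (disjoint_left.1 c1 ⟨hy.2, h0⟩)
      · simpa using h0
  · exfalso
    have hxc : x ∈ closure Ω := frontier_subset_closure hx
    obtain ⟨y, hyV, hyΩ⟩ := mem_closure_iff.1 hxc V hV hxV
    rcases lt_or_gt_of_ne (hΩ0 y hyΩ hyV) with h0 | h0
    · exact disjoint_left.1 c1 ⟨hyV, h0⟩ hyΩ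
    · exact disjoint_left.1 c2 ⟨hyV, h0⟩ hyΩ

lemma eventually_lt_zero_along {g : Space N → ℝ} {x v : Space N} (hg : DifferentiableAt ℝ g x)
    (hgx : g x = 0) (hv : fderiv ℝ g x v < 0) : ∀ᶠ t in 𝓝[>] (0 : ℝ), g (x + t • v) < 0 := by
  have h3 : HasDerivAt (fun t : ℝ => x + t • v) v 0 := by
    simpa using ((hasDerivAt_id (0 : ℝ)).smul_const v).const_add x
  have h4 : HasDerivAt (fun t : ℝ => g (x + t • v)) (fderiv ℝ g x v) 0 := by
    refine HasFDerivAt.comp_hasDerivAt (0 : ℝ) (f := fun t : ℝ => x + t • v) ?_ h3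
    simpa using hg.hasFDerivAt
  have h5 := h4.tendsto_slope_zero_right.eventually (gt_mem_nhds hv)
  filter_upwards [h5, self_mem_nhdsWithin] with t ht ht0
  have ht0 : 0 < t := ht0
  simp only [zero_add, zero_smul, add_zero, hgx, sub_zero, smul_eq_mul] at ht
  have := mul_neg_of_pos_of_neg ht0 ht
  rwa [← mul_assoc, mul_inv_cancel₀ ht0.ne', one_mul] at this

/-- A linear functional `a ≠ 0` such that `Ω` contains the initial segments at `x` of all directions
in the half space `a < 0`. -/
def ContainsHalfSpaceAt (Ω : Set (Space N)) (x : Space N) (a : Space N →L[ℝ] ℝ) : Prop :=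
  a ≠ 0 ∧ ∀ v, a v < 0 → ∀ᶠ t in 𝓝[>] (0 : ℝ), x + t • v ∈ Ω

lemma containsHalfSpaceAt_of_sublevel {Ω V : Set (Space N)} {g : Space N → ℝ} {x : Space N}
    (hV : IsOpen V) (hxV : x ∈ V) (hg : DifferentiableAt ℝ g x) (hgx : g x = 0)
    (hd : fderiv ℝ g x ≠ 0) (hsub : {y ∈ V | g y < 0} ⊆ Ω) :
    ContainsHalfSpaceAt Ω x (fderiv ℝ g x) := by
  refine ⟨hd, fun v hv => ?_⟩
  have hc : Tendsto (fun t : ℝ => x + t • v) (𝓝[>] 0) (𝓝 x) := by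
    have : Continuous fun t : ℝ => x + t • v := by fun_prop
    simpa using (this.tendsto 0).mono_left nhdsWithin_le_nhds
  filter_upwards [eventually_lt_zero_along hg hgx hv, hc.eventually (hV.mem_nhds hxV)] with t h1 h2
  exact hsub ⟨h2, h1⟩

lemma exists_containsHalfSpaceAt {Ω : Set (Space N)} (hΩ : IsOpen Ω) {x : Space N}
    (hx : x ∈ frontier Ω) (h : IsHypersurfaceAt (frontier Ω) x) :
    ∃ a, ContainsHalfSpaceAt Ω x a := by
  obtain ⟨V, g, hV, hxV, hg, hgx, hd, -, hs⟩ := exists_side_of_isHypersurfaceAt hΩ hx h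
  refine ⟨fderiv ℝ g x, containsHalfSpaceAt_of_sublevel hV hxV
    ((hg.contDiffAt (hV.mem_nhds hxV)).differentiableAt (by norm_num)) hgx hd fun y hy => ?_⟩
  rcases hs with hs | hs
  · exact (hs.ge hy).1
  · exact (hs.ge ⟨hy.1, hy.2.ne⟩).1

/-- If `a₁ v` and `a₂ v` have the same sign, then `v` or `-v` lies in both half spaces, and a short
segment in that direction lies in both sets. -/
lemma ContainsHalfSpaceAt.not_disjoint {Ω₁ Ω₂ : Set (Space N)} {x v : Space N}
    {a₁ a₂ : Space N →L[ℝ] ℝ} (h₁ : ContainsHalfSpaceAt Ω₁ x a₁)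
    (h₂ : ContainsHalfSpaceAt Ω₂ x a₂) (hv : 0 < a₁ v * a₂ v) : ¬ Disjoint Ω₁ Ω₂ := by
  have key : ∀ v, a₁ v < 0 → a₂ v < 0 → ¬ Disjoint Ω₁ Ω₂ := by
    intro v h1 h2 hd
    obtain ⟨t, ht1, ht2⟩ := ((h₁.2 v h1).and (h₂.2 v h2)).exists
    exact disjoint_left.1 hd ht1 ht2
  rcases pos_and_pos_or_neg_and_neg_of_mul_pos hv with ⟨h1, h2⟩ | ⟨h1, h2⟩
  · exact key (-v) (by simpa using h1) (by simpa using h2)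
  · exact key v h1 h2

/-- Three pairwise disjoint sets cannot all contain a half space at the same point. -/
lemma ContainsHalfSpaceAt.false_of_three {Ω₁ Ω₂ Ω₃ : Set (Space N)} {x : Space N}
    {a₁ a₂ a₃ : Space N →L[ℝ] ℝ} (h₁ : ContainsHalfSpaceAt Ω₁ x a₁)
    (h₂ : ContainsHalfSpaceAt Ω₂ x a₂) (h₃ : ContainsHalfSpaceAt Ω₃ x a₃)
    (h12 : Disjoint Ω₁ Ω₂) (h13 : Disjoint Ω₁ Ω₃) (h23 : Disjoint Ω₂ Ω₃) : False := by
  have hne : ∀ {a : Space N →L[ℝ] ℝ}, a ≠ 0 → ∃ v, a v ≠ 0 := by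
    intro a ha
    by_contra! h
    exact ha (ContinuousLinearMap.ext h)
  -- Three proper hyperplanes do not cover the space. Of the three nonzero values at `v` two have
  -- the same sign, so two of the sets meet.
  obtain ⟨v, hv⟩ := Module.Dual.exists_forall_ne_zero_of_forall_exists (K := ℝ) (M := Space N)
    (![(a₁ : Space N →ₗ[ℝ] ℝ), (a₂ : Space N →ₗ[ℝ] ℝ), (a₃ : Space N →ₗ[ℝ] ℝ)])
    (fun i => by
      fin_cases i
      · exact hne h₁.1
      · exact hne h₂.1
      · exact hne h₃.1)
  have v1 : a₁ v ≠ 0 := hv 0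
  have v2 : a₂ v ≠ 0 := hv 1
  have v3 : a₃ v ≠ 0 := hv 2
  have n12 : a₁ v * a₂ v ≤ 0 := not_lt.1 fun h => h₁.not_disjoint h₂ h h12
  have n13 : a₁ v * a₃ v ≤ 0 := not_lt.1 fun h => h₁.not_disjoint h₃ h h13
  have n23 : a₂ v * a₃ v ≤ 0 := not_lt.1 fun h => h₂.not_disjoint h₃ h h23
  have p1 := lt_of_le_of_ne n12 (mul_ne_zero v1 v2)
  have p2 := lt_of_le_of_ne n13 (mul_ne_zero v1 v3)
  have p3 : 0 < a₁ v ^ 2 * (a₂ v * a₃ v) := by nlinarith [mul_pos_of_neg_of_neg p1 p2]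
  nlinarith [sq_nonneg (a₁ v)]

/-! ### Null sets -/

/-- Hausdorff measures decrease in the dimension, and Lebesgue measure is a multiple of the
`N`-dimensional one. -/
lemma volume_eq_zero_of_hausdorffMeasure_eq_zero {S : Set (Space N)}
    (hS : Measure.hausdorffMeasure ((N : ℝ) - 1) S = 0) : volume S = 0 := by
  have h : Measure.hausdorffMeasure (N : ℝ) S = 0 :=
    le_antisymm ((Measure.hausdorffMeasure_mono (by linarith) S).trans hS.le) zero_le
  rw [Measure.isAddLeftInvariant_eq_smul (volume : Measure (Space N))
    (Measure.hausdorffMeasure (N : ℝ)), Measure.smul_apply, h, smul_zero]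

/-- Inside a small ball `g` is strictly increasing along `e`, so the surface meets each line in that
direction at most once. Its translates by `e / (n + 1)` are disjoint and bounded, hence it is null.
-/
lemma exists_nhds_volume_eq_zero {S : Set (Space N)} {x : Space N} (h : IsHypersurfaceAt S x) :
    ∃ V ∈ 𝓝 x, volume (S ∩ V) = 0 := by
  obtain ⟨U, g, hU, hxU, hg, hd, hS⟩ := h
  obtain ⟨e, r, hr, hrU, hre⟩ := exists_ball_one_le_fderiv hU hxU hg hd
  set B := closedBall x (2 * r) with hB
  refine ⟨B, closedBall_mem_nhds _ (by positivity), ?_⟩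
  set A := B ∩ g ⁻¹' {0} with hA
  have hAm : MeasurableSet A := ((hg.continuousOn.mono hrU).preimage_isClosed_of_isClosed
    isClosed_closedBall isClosed_singleton).measurableSet
  have hSA : S ∩ B ⊆ A := fun y hy =>
    ⟨hy.2, (show y ∈ {y ∈ U | g y = 0} from hS ▸ ⟨hy.1, hrU hy.2⟩).2⟩
  refine measure_mono_null hSA ?_
  have hno : ∀ y ∈ A, ∀ s > (0 : ℝ), y + s • e ∉ A := by
    intro y hy s hs hys
    have hseg : ∀ τ ∈ Icc 0 s, y + τ • e ∈ B := by
      intro τ hτ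
      have := (convex_closedBall x (2 * r)).add_smul_mem (x := y) (y := s • e) hy.1 hys.1
        (t := τ / s) ⟨div_nonneg hτ.1 hs.le, (div_le_one hs).2 hτ.2⟩
      rwa [smul_smul, div_mul_cancel₀ _ hs.ne'] at this
    have := add_le_along (g := g) (e := e) (y := y) (ε := s) (fun τ hτ =>
      ⟨(hg.contDiffAt (hU.mem_nhds (hrU (hseg τ hτ)))).differentiableAt (by norm_num),
        hre _ (hseg τ hτ)⟩) hs.le
    have h1 : g y = 0 := hy.2
    have h2 : g (y + s • e) = 0 := hys.2
    linarith
  refine Measure.addHaar_eq_zero_of_disjoint_translates volume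
    (fun n : ℕ => (1 / ((n : ℝ) + 1)) • e) ?_ ?_ hAm
  · refine isBounded_iff_forall_norm_le.2 ⟨‖e‖, ?_⟩
    rintro _ ⟨n, rfl⟩
    rw [norm_smul, Real.norm_of_nonneg (by positivity)]
    refine mul_le_of_le_one_left (norm_nonneg _) ?_
    rw [div_le_one (by positivity)]
    have : (0 : ℝ) ≤ n := n.cast_nonneg
    linarith
  · have key : ∀ m n : ℕ, m < n →
        Disjoint (({(1 / ((m : ℝ) + 1)) • e} : Set (Space N)) + A)
          (({(1 / ((n : ℝ) + 1)) • e} : Set (Space N)) + A) := by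
      intro m n hmn
      rw [disjoint_left]
      rintro z hz1 hz2
      rw [singleton_add] at hz1 hz2
      obtain ⟨y1, hy1, rfl⟩ := hz1
      obtain ⟨y2, hy2, hy⟩ := hz2
      have hlt : 1 / ((n : ℝ) + 1) < 1 / ((m : ℝ) + 1) := by
        apply one_div_lt_one_div_of_lt (by positivity)
        have : (m : ℝ) < n := by exact_mod_cast hmn
        linarith
      refine hno y1 hy1 (1 / ((m : ℝ) + 1) - 1 / ((n : ℝ) + 1)) (by linarith) ?_
      convert hy2 using 1
      simp only at hy
      rw [sub_smul]
      rw [← sub_eq_zero] at hy ⊢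
      rw [← neg_eq_zero, ← hy]
      abel
    intro m n hmn
    rcases lt_or_gt_of_ne hmn with h | h
    · exact key m n h
    · exact (key n m h).symm

lemma IsPiecewiseSmooth.volume_eq_zero {S : Set (Space N)} (hS : IsPiecewiseSmooth S) :
    volume S = 0 := by
  have h1 := volume_eq_zero_of_hausdorffMeasure_eq_zero hS
  have h2 : volume {x ∈ S | IsHypersurfaceAt S x} = 0 := by
    refine measure_null_of_locally_null _ fun x hx => ?_
    obtain ⟨V, hV, h0⟩ := exists_nhds_volume_eq_zero hx.2
    refine ⟨{x ∈ S | IsHypersurfaceAt S x} ∩ V, inter_mem self_mem_nhdsWithin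
      (mem_nhdsWithin_of_mem_nhds hV), measure_mono_null ?_ h0⟩
    exact inter_subset_inter_left _ fun y hy => hy.1
  refine measure_mono_null (fun x hx => ?_) (measure_union_null h1 h2)
  by_cases h : IsHypersurfaceAt S x
  · exact Or.inr ⟨hx, h⟩
  · exact Or.inl ⟨hx, h⟩

end ReducedWave

namespace ReducedWave

open Filter Topology ContinuousLinearMap Metric

variable {N : ℕ} {L : Set ℤ} {Ω Sm Sp : ℤ → Set (Space N)} {ν : ℤ → ℝ} {μ₀ : Space N → ℝ}

/-! ### Local radial monotonicity of a layered medium -/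

/-- The closures cover the space, and the countably many boundaries are null. -/
lemma IsLayeredMedium.ae_mem (hμ : IsLayeredMedium L Ω Sm Sp ν μ₀) : ∀ᵐ x, ∃ ℓ ∈ L, x ∈ Ω ℓ := by
  have h : ∀ᵐ x, ∀ ℓ ∈ L, x ∉ frontier (Ω ℓ) := by
    rw [ae_ball_iff L.to_countable]
    intro ℓ hℓ
    exact measure_eq_zero_iff_ae_notMem.1 (hμ.piecewiseSmooth ℓ hℓ).volume_eq_zero
  filter_upwards [h] with x hx
  have hxc : x ∈ ⋃ ℓ ∈ L, closure (Ω ℓ) := hμ.cover ▸ mem_univ x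
  obtain ⟨ℓ, hℓ, hxℓ⟩ := mem_iUnion₂.1 hxc
  refine ⟨ℓ, hℓ, ?_⟩
  by_contra hn
  exact hx ℓ hℓ (by rw [(hμ.isOpen ℓ hℓ).frontier_eq]; exact ⟨hxℓ, hn⟩)

/-- The values of `μ₀` off the layers are arbitrary, but that set is null: almost everywhere `μ₀` is
a countable sum of constants times indicators of open sets. -/
lemma IsLayeredMedium.exists_measurable (hμ : IsLayeredMedium L Ω Sm Sp ν μ₀) :
    AEStronglyMeasurable μ₀ volume := by
  classical
  have hms : ∀ ℓ : L, MeasurableSet (Ω ℓ) := fun ℓ => (hμ.isOpen ℓ ℓ.2).measurableSet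
  refine AEStronglyMeasurable.congr (f := fun x => ∑' ℓ : L, (Ω ℓ).indicator (fun _ => ν ℓ) x) ?_ ?_
  · exact (Measurable.tsum fun ℓ => measurable_const.indicator (hms ℓ)).aestronglyMeasurable
  · filter_upwards [hμ.ae_mem] with x hx
    obtain ⟨ℓ, hℓ, hxℓ⟩ := hx
    rw [tsum_eq_single ⟨ℓ, hℓ⟩]
    · rw [indicator_of_mem hxℓ, hμ.value ℓ hℓ x hxℓ]
    · intro m hm
      refine indicator_of_notMem (fun hxm => ?_) _
      have : (m : ℤ) ≠ ℓ := fun h => hm (Subtype.ext h)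
      exact disjoint_left.1 (hμ.disjoint m.2 hℓ this) hxm hxℓ

lemma IsLayeredMedium.exists_bounds (hμ : IsLayeredMedium L Ω Sm Sp ν μ₀) :
    ∃ m M : ℝ, 0 < m ∧ ∀ᵐ x, m ≤ μ₀ x ∧ μ₀ x ≤ M := by
  obtain ⟨m, M, hm, h⟩ := hμ.bounds
  refine ⟨m, M, hm, ?_⟩
  filter_upwards [hμ.ae_mem] with x hx
  obtain ⟨ℓ, hℓ, hxℓ⟩ := hx
  rw [hμ.value ℓ hℓ x hxℓ]
  exact h ℓ hℓ

/-- The function `μ` is radially nondecreasing on `V`, in the sense of distributions. -/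
def RadiallyMonotoneOn (μ : Space N → ℝ) (V : Set (Space N)) : Prop :=
  ∀ w : Space N → ℝ, ContDiff ℝ 1 w → HasCompactSupport w → tsupport w ⊆ V → (∀ x, 0 ≤ w x) →
    ∫ x, μ x * radialDiv w x ≤ 0

lemma RadiallyMonotoneOn.mono {μ : Space N → ℝ} {V W : Set (Space N)}
    (h : RadiallyMonotoneOn μ V) (hWV : W ⊆ V) : RadiallyMonotoneOn μ W :=
  fun w h1 h2 h3 => h w h1 h2 (h3.trans hWV)

lemma radiallyMonotoneOn_of_ae_eq_const {μ : Space N → ℝ} {V : Set (Space N)} {c : ℝ}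
    (h : ∀ᵐ x, x ∈ V → μ x = c) : RadiallyMonotoneOn μ V := by
  intro w hw hc hs _
  have : ∫ x, μ x * radialDiv w x = ∫ x, c * radialDiv w x := by
    refine integral_congr_ae ?_
    filter_upwards [h] with x hx
    by_cases hxw : x ∈ tsupport w
    · rw [hx (hs hxw)]
    · rw [radialDiv_eq_zero hxw, mul_zero, mul_zero]
  rw [this, integral_const_mul, integral_radialDiv hw hc, mul_zero]

/-- On `V`, `μ` is `(c - d)` times the indicator of `{g < 0}` plus the constant `d`, which
contributes nothing. -/
lemma radiallyMonotoneOn_of_ae_eq_sublevel {μ g : Space N → ℝ} {V V' : Set (Space N)} {c d : ℝ}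
    (hV : IsOpen V) (hg : ContDiffOn ℝ 1 g V) (hV' : V' ⊆ V)
    (hσ : ∀ w : Space N → ℝ, ContDiff ℝ 1 w → HasCompactSupport w → tsupport w ⊆ V' →
      (∀ x, 0 ≤ w x) → (c - d) * ∫ x in {y ∈ V | g y < 0}, radialDiv w x ≤ 0)
    (h1 : ∀ᵐ x, x ∈ V → g x < 0 → μ x = c) (h2 : ∀ᵐ x, x ∈ V → 0 ≤ g x → μ x = d) :
    RadiallyMonotoneOn μ V' := by
  intro w hw hc hs h0
  have hms : MeasurableSet {y ∈ V | g y < 0} :=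
    (hg.continuousOn.isOpen_inter_preimage hV isOpen_Iio).measurableSet
  have hi := integrable_radialDiv hw hc
  have : ∫ x, μ x * radialDiv w x
      = ∫ x, ((c - d) * ({y ∈ V | g y < 0}.indicator (radialDiv w) x) + d * radialDiv w x) := by
    refine integral_congr_ae ?_
    filter_upwards [h1, h2] with x hx1 hx2
    by_cases hxw : x ∈ tsupport w
    swap
    · simp [indicator, radialDiv_eq_zero hxw]
    have hxV := hV' (hs hxw)
    by_cases hgx : g x < 0
    · rw [hx1 hxV hgx, indicator_of_mem (show x ∈ {y ∈ V | g y < 0} from ⟨hxV, hgx⟩)]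
      ring
    · rw [hx2 hxV (not_lt.1 hgx), indicator_of_notMem (fun h => hgx h.2)]
      ring
  rw [this, integral_add ((hi.indicator hms).const_mul _) (hi.const_mul _), integral_const_mul,
    integral_const_mul, integral_radialDiv hw hc, mul_zero, add_zero, integral_indicator hms]
  exact hσ w hw hc hs h0

/-- The unit outward normal of a sublevel set, in terms of the differential. -/
lemma isOutwardUnitNormal_of_sublevel {D V : Set (Space N)} {g : Space N → ℝ} {y : Space N}
    (hV : IsOpen V) (hy : y ∈ V) (hg : ContDiffOn ℝ 1 g V) (hgy : g y = 0)
    (hd : fderiv ℝ g y ≠ 0) (hD : D ∩ V = {z ∈ V | g z < 0}) :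
    ∃ n, IsOutwardUnitNormal D y n ∧ ∀ v, inner ℝ n v = ‖fderiv ℝ g y‖⁻¹ * fderiv ℝ g y v := by
  have hc : 0 < ‖fderiv ℝ g y‖ := norm_pos_iff.2 hd
  set c := ‖fderiv ℝ g y‖⁻¹ with hcdef
  have hc' : 0 < c := inv_pos.2 hc
  set n := (InnerProductSpace.toDual ℝ (Space N)).symm (c • fderiv ℝ g y) with hn
  have hinner : ∀ v, inner ℝ n v = c * fderiv ℝ g y v := fun v => by
    rw [hn, InnerProductSpace.toDual_symm_apply]; rfl
  refine ⟨n, ⟨?_, V, fun z => c * g z, hV, hy, contDiffOn_const.mul hg, by simp [hgy], ?_, ?_⟩,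
    hinner⟩
  · rw [hn, LinearIsometryEquiv.norm_map, norm_smul, Real.norm_of_nonneg hc'.le, hcdef,
      inv_mul_cancel₀ hc.ne']
  · rw [hasGradientAt_iff_hasFDerivAt, hn, LinearIsometryEquiv.apply_symm_apply]
    exact ((hg.contDiffAt (hV.mem_nhds hy)).differentiableAt
      (by norm_num)).hasFDerivAt.const_mul c
  · rw [hD]
    ext z
    simp [mul_neg_iff, hc', hc'.not_gt]

/-- A point of a boundary lies on the surface between two consecutive layers. -/
lemma IsLayeredMedium.exists_mem_surface (hμ : IsLayeredMedium L Ω Sm Sp ν μ₀) {ℓ : ℤ}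
    (hℓ : ℓ ∈ L) {x : Space N} (hx : x ∈ frontier (Ω ℓ)) :
    ∃ j ∈ L, j + 1 ∈ L ∧ x ∈ Sp j ∧ x ∈ frontier (Ω j) ∧ x ∈ frontier (Ω (j + 1)) := by
  have key : ∀ j ∈ L, x ∈ Sp j → ∃ j ∈ L, j + 1 ∈ L ∧ x ∈ Sp j ∧ x ∈ frontier (Ω j) ∧
      x ∈ frontier (Ω (j + 1)) := by
    intro j hj hxj
    have hj1 : j + 1 ∈ L := by
      by_contra h
      rw [hμ.surface_last j hj h] at hxj
      exact hxj
    refine ⟨j, hj, hj1, hxj, ?_, ?_⟩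
    · rw [hμ.frontier_eq j hj]; exact Or.inr hxj
    · rw [hμ.frontier_eq _ hj1, ← hμ.surfaces_eq j hj hj1]; exact Or.inl hxj
  rw [hμ.frontier_eq ℓ hℓ] at hx
  rcases hx with hx | hx
  · have hl : ℓ - 1 ∈ L := by
      by_contra h
      rw [hμ.surface_first ℓ hℓ h] at hx
      exact hx
    refine key (ℓ - 1) hl ?_
    rw [hμ.surfaces_eq (ℓ - 1) hl (by simpa using hℓ)]
    simpa using hx
  · exact key ℓ hℓ hx

/-- Near a point where all boundaries are smooth, only two layers meet. -/
lemma IsLayeredMedium.exists_nhds_two_layers (hμ : IsLayeredMedium L Ω Sm Sp ν μ₀) {x : Space N}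
    (hgood : ∀ ℓ ∈ L, x ∈ frontier (Ω ℓ) → IsHypersurfaceAt (frontier (Ω ℓ)) x) {j : ℤ}
    (hj : j ∈ L) (hj1 : j + 1 ∈ L) (hxj : x ∈ frontier (Ω j)) (hxj1 : x ∈ frontier (Ω (j + 1))) :
    ∃ W, IsOpen W ∧ x ∈ W ∧ ∀ ℓ ∈ L, (Ω ℓ ∩ W).Nonempty → ℓ = j ∨ ℓ = j + 1 := by
  have hfin := hμ.locallyFinite (‖x‖ + 1) (by positivity)
  set F := {ℓ ∈ L | (Ω ℓ ∩ ball 0 (‖x‖ + 1)).Nonempty} with hF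
  -- A third layer touching `x` either contains `x`, and then meets `Ω j`, or has `x` on its smooth
  -- boundary, and then three disjoint sets contain half spaces at `x`.
  have hncl : ∀ ℓ ∈ L, ℓ ≠ j → ℓ ≠ j + 1 → x ∉ closure (Ω ℓ) := by
    intro ℓ hℓ h1 h2 hxc
    have d1 := hμ.disjoint hj hj1 (by omega : j ≠ j + 1)
    have d2 := hμ.disjoint hj hℓ h1.symm
    have d3 := hμ.disjoint hj1 hℓ h2.symm
    by_cases hxℓ : x ∈ Ω ℓ
    · obtain ⟨y, hy1, hy2⟩ := mem_closure_iff.1 (frontier_subset_closure hxj) _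
        (hμ.isOpen ℓ hℓ) hxℓ
      exact disjoint_left.1 d2 hy2 hy1
    · have hxf : x ∈ frontier (Ω ℓ) := by
        rw [(hμ.isOpen ℓ hℓ).frontier_eq]; exact ⟨hxc, hxℓ⟩
      obtain ⟨a₁, h₁⟩ := exists_containsHalfSpaceAt (hμ.isOpen j hj) hxj (hgood j hj hxj)
      obtain ⟨a₂, h₂⟩ := exists_containsHalfSpaceAt (hμ.isOpen _ hj1) hxj1 (hgood _ hj1 hxj1)
      obtain ⟨a₃, h₃⟩ := exists_containsHalfSpaceAt (hμ.isOpen ℓ hℓ) hxf (hgood ℓ hℓ hxf)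
      exact h₁.false_of_three h₂ h₃ d1 d2 d3
  -- Local finiteness makes the intersection of the complements of the other closures open.
  refine ⟨ball 0 (‖x‖ + 1) ∩ ⋂ ℓ ∈ F \ {j, j + 1}, (closure (Ω ℓ))ᶜ, ?_, ⟨by simp, ?_⟩, ?_⟩
  · exact isOpen_ball.inter ((hfin.subset sdiff_subset).isOpen_biInter fun ℓ _ =>
      isClosed_closure.isOpen_compl)
  · refine mem_iInter₂.2 fun ℓ hℓ => hncl ℓ hℓ.1.1 (fun h => hℓ.2 (by simp [h])) fun h =>
      hℓ.2 (by simp [h])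
  · rintro ℓ hℓ ⟨y, hy, hyb, hyW⟩
    by_contra hcon
    have hℓF : ℓ ∈ F \ {j, j + 1} := ⟨⟨hℓ, y, hy, hyb⟩, by simpa using hcon⟩
    exact mem_iInter₂.1 hyW ℓ hℓF (subset_closure hy)

/-- A layered medium is radially nondecreasing near each point where all boundaries are smooth. -/
lemma IsLayeredMedium.exists_nhds_radiallyMonotoneOn (hμ : IsLayeredMedium L Ω Sm Sp ν μ₀)
    {x : Space N}
    (hgood : ∀ ℓ ∈ L, x ∈ frontier (Ω ℓ) → IsHypersurfaceAt (frontier (Ω ℓ)) x) :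
    ∃ V ∈ 𝓝 x, RadiallyMonotoneOn μ₀ V := by
  have hxc : x ∈ ⋃ ℓ ∈ L, closure (Ω ℓ) := hμ.cover ▸ mem_univ x
  obtain ⟨ℓ, hℓ, hxℓ⟩ := mem_iUnion₂.1 hxc
  by_cases hxΩ : x ∈ Ω ℓ
  · exact ⟨Ω ℓ, (hμ.isOpen ℓ hℓ).mem_nhds hxΩ, radiallyMonotoneOn_of_ae_eq_const
      (Eventually.of_forall fun y hy => hμ.value ℓ hℓ y hy)⟩
  have hxf : x ∈ frontier (Ω ℓ) := by
    rw [(hμ.isOpen ℓ hℓ).frontier_eq]; exact ⟨hxℓ, hxΩ⟩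
  obtain ⟨j, hj, hj1, hxS, hxj, hxj1⟩ := hμ.exists_mem_surface hℓ hxf
  obtain ⟨V, g, hV, hxV, hg, hgx, hd, hfr, hside⟩ :=
    exists_side_of_isHypersurfaceAt (hμ.isOpen j hj) hxj (hgood j hj hxj)
  have hnfr : ∀ᵐ y, y ∉ frontier (Ω j) :=
    measure_eq_zero_iff_ae_notMem.1 (hμ.piecewiseSmooth j hj).volume_eq_zero
  rcases hside with hside | hside
  swap
  -- When `Ω j` lies on both sides of its boundary, `μ₀` equals `ν j` almost everywhere near `x` and
  -- there is no jump.
  · refine ⟨V, hV.mem_nhds hxV, radiallyMonotoneOn_of_ae_eq_const (c := ν j) ?_⟩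
    filter_upwards [hnfr] with y hy hyV
    have hgy : g y ≠ 0 := fun h => hy (hfr.ge ⟨hyV, h⟩).1
    exact hμ.value j hj y (hside.ge ⟨hyV, hgy⟩).1
  obtain ⟨W, hW, hxW, hWL⟩ := hμ.exists_nhds_two_layers hgood hj hj1 hxj hxj1
  have hdo : IsOpen {y ∈ V | fderiv ℝ g y ≠ 0} :=
    (hg.continuousOn_fderiv_of_isOpen hV le_rfl).isOpen_inter_preimage hV
      (isOpen_compl_singleton (x := (0 : Space N →L[ℝ] ℝ)))
  -- On `V₁` every zero of `g` has a normal, so the jump condition applies, and only `Ω j` and `Ω (j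
  -- + 1)` occur.
  set V₁ := {y ∈ V | fderiv ℝ g y ≠ 0} ∩ W with hV₁
  have hV₁o : IsOpen V₁ := hdo.inter hW
  have hV₁V : V₁ ⊆ V := fun y hy => hy.1.1
  have hxV₁ : x ∈ V₁ := ⟨⟨hxV, hd⟩, hxW⟩
  have hg₁ := hg.mono hV₁V
  have hside₁ : Ω j ∩ V₁ = {y ∈ V₁ | g y < 0} := by
    ext y
    constructor
    · rintro ⟨h1, h2⟩
      exact ⟨h2, (hside.le ⟨h1, hV₁V h2⟩).2⟩
    · rintro ⟨h1, h2⟩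
      exact ⟨(hside.ge ⟨hV₁V h1, h2⟩).1, h1⟩
  have hσ : ∀ y ∈ V₁, g y = 0 → (ν j - ν (j + 1)) * fderiv ℝ g y y ≤ 0 := by
    intro y hy hgy
    have hyf : y ∈ frontier (Ω j) := (hfr.ge ⟨hV₁V hy, hgy⟩).1
    -- A point of `Sm j` would be on the boundary of `Ω (j - 1)`, which does not meet `W`.
    have hyS : y ∈ Sp j := by
      rw [hμ.frontier_eq j hj] at hyf
      refine hyf.resolve_left fun hym => ?_
      have hl : j - 1 ∈ L := by
        by_contra h
        rw [hμ.surface_first j hj h] at hym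
        exact hym
      have : y ∈ frontier (Ω (j - 1)) := by
        rw [hμ.frontier_eq _ hl, hμ.surfaces_eq (j - 1) hl (by simpa using hj)]
        right
        simpa using hym
      obtain ⟨z, hz1, hz2⟩ := mem_closure_iff.1 (frontier_subset_closure this) W hW hy.2
      rcases hWL (j - 1) hl ⟨z, hz2, hz1⟩ with h | h <;> omega
    obtain ⟨n, hn, hin⟩ := isOutwardUnitNormal_of_sublevel hV₁o hy hg₁ hgy hy.1.2 hside₁
    have := hμ.jump j hj hj1 y hyS n hn
    rw [hin, ← mul_assoc, mul_comm _ (‖fderiv ℝ g y‖⁻¹), mul_assoc] at this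
    exact nonpos_of_mul_nonpos_right this (inv_pos.2 (norm_pos_iff.2 hy.1.2))
  obtain ⟨V', hV', hloc⟩ := exists_nhds_integral_sublevel_le hV₁o hxV₁ hg₁ hd hσ
  refine ⟨V' ∩ V₁, inter_mem hV' (hV₁o.mem_nhds hxV₁), radiallyMonotoneOn_of_ae_eq_sublevel
    (c := ν j) (d := ν (j + 1)) hV₁o hg₁ inter_subset_right
    (fun w h1 h2 h3 h4 => hloc w h1 h2 (h3.trans inter_subset_left) h4) ?_ ?_⟩
  · exact Eventually.of_forall fun y hy hgy => hμ.value j hj y (hside₁.ge ⟨hy, hgy⟩).1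
  · filter_upwards [hμ.ae_mem] with y hy hyV hgy
    obtain ⟨m, hm, hym⟩ := hy
    rcases hWL m hm ⟨y, hym, hyV.2⟩ with rfl | rfl
    · exact absurd (hside₁.le ⟨hym, hyV⟩).2 (not_lt.2 hgy)
    · exact hμ.value _ hm y hym

/-- Outside a set of vanishing `(N - 1)`-dimensional Hausdorff measure, a layered medium is
locally radially nondecreasing. -/
lemma IsLayeredMedium.hausdorffMeasure_bad_eq_zero (hμ : IsLayeredMedium L Ω Sm Sp ν μ₀) :
    Measure.hausdorffMeasure ((N : ℝ) - 1)
      {x | ¬ ∃ V ∈ 𝓝 x, RadiallyMonotoneOn μ₀ V} = 0 := by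
  refine measure_mono_null (t := ⋃ ℓ ∈ L, {x ∈ frontier (Ω ℓ) |
    ¬ IsHypersurfaceAt (frontier (Ω ℓ)) x}) (fun x hx => ?_)
    ((measure_biUnion_null_iff L.to_countable).2 fun ℓ hℓ => hμ.piecewiseSmooth ℓ hℓ)
  by_contra hcon
  refine hx (hμ.exists_nhds_radiallyMonotoneOn fun ℓ hℓ hxf => ?_)
  by_contra hn
  exact hcon (mem_iUnion₂.2 ⟨ℓ, hℓ, hxf, hn⟩)

end ReducedWave

namespace ReducedWave

open Filter Topology ContinuousLinearMap Metric

variable {N : ℕ}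

/-! ### Removal of small singular sets -/

lemma radialDiv_sum {ι : Type*} (s : Finset ι) {f : ι → Space N → ℝ} {x : Space N}
    (hf : ∀ i ∈ s, DifferentiableAt ℝ (f i) x) :
    radialDiv (fun y => ∑ i ∈ s, f i y) x = ∑ i ∈ s, radialDiv (f i) x := by
  simp only [radialDiv, fderiv_fun_sum hf, Finset.mul_sum, Finset.sum_add_distrib]
  simp

/-- The tested expression is linear in `w`, so a partition of unity over the compact support reduces
to the local inequalities. -/
lemma RadiallyMonotoneOn.of_locally {μ : Space N → ℝ} {M : ℝ} (hμ : AEStronglyMeasurable μ)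
    (hM : ∀ᵐ x, ‖μ x‖ ≤ M) {G : Set (Space N)}
    (hG : ∀ x ∈ G, ∃ V ∈ 𝓝 x, RadiallyMonotoneOn μ V) : RadiallyMonotoneOn μ G := by
  intro w hw hc hs h0
  have hloc : ∀ x : Space N, ∃ V, IsOpen V ∧ (x ∈ tsupport w → x ∈ V) ∧ RadiallyMonotoneOn μ V := by
    intro x
    by_cases hx : x ∈ tsupport w
    · obtain ⟨V, hV, h⟩ := hG x (hs hx)
      exact ⟨interior V, isOpen_interior, fun _ => mem_interior_iff_mem_nhds.2 hV,
        h.mono interior_subset⟩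
    · refine ⟨∅, isOpen_empty, fun h => absurd h hx, radiallyMonotoneOn_of_ae_eq_const (c := 0) ?_⟩
      simp
  choose V hVo hVm hVr using hloc
  obtain ⟨t, ht⟩ := hc.isCompact.elim_finite_subcover V hVo
    fun x hx => mem_iUnion.2 ⟨x, hVm x hx⟩
  obtain ⟨f, hf⟩ := SmoothPartitionOfUnity.exists_isSubordinate
    (modelWithCornersSelf ℝ (Space N)) (isClosed_tsupport w) (fun i : t => V i)
    (fun i => hVo i) (by simpa [iUnion_subtype] using ht)
  have hfs : ∀ i, ContDiff ℝ 1 (fun x => f i x) := fun i =>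
    ((f i).contMDiff.contDiff).of_le (by norm_cast)
  have hfw : ∀ i, ContDiff ℝ 1 (fun x => f i x * w x) := fun i => (hfs i).mul hw
  have hcw : ∀ i, HasCompactSupport (fun x => f i x * w x) := fun i => hc.mul_left
  have hsum : w = fun x => ∑ i : t, f i x * w x := by
    funext x
    rw [← Finset.sum_mul]
    by_cases hx : x ∈ tsupport w
    · have := f.sum_eq_one hx
      rw [finsum_eq_sum_of_fintype] at this
      rw [this, one_mul]
    · rw [image_eq_zero_of_notMem_tsupport hx, mul_zero]
  have e : ∀ x, radialDiv w x = ∑ i : t, radialDiv (fun x => f i x * w x) x := by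
    intro x
    conv_lhs => rw [hsum]
    exact radialDiv_sum _ fun i _ => (hfw i).differentiable (by norm_num) x
  simp only [e, Finset.mul_sum]
  rw [integral_finsetSum]
  · refine Finset.sum_nonpos fun i _ => hVr i _ (hfw i) (hcw i) ?_ fun x =>
      mul_nonneg (f.nonneg i x) (h0 x)
    exact (tsupport_mul_subset_left).trans (hf i)
  · exact fun i _ => (integrable_radialDiv (hfw i) (hcw i)).bdd_mul (c := M) hμ hM

/-- A compact set of vanishing `(N - 1)`-dimensional Hausdorff measure is covered by finitely many
balls with small total `(N - 1)`-dimensional content. -/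
lemma exists_finite_cover_of_hausdorffMeasure_eq_zero (hN : 2 ≤ N) {B : Set (Space N)}
    (hB : IsCompact B) (h0 : Measure.hausdorffMeasure ((N : ℝ) - 1) B = 0) {ε : ℝ} (hε : 0 < ε) :
    ∃ (s : Finset ℕ) (x : ℕ → Space N) (r : ℕ → ℝ), (∀ i, 0 < r i ∧ r i ≤ 1) ∧
      B ⊆ ⋃ i ∈ s, ball (x i) (r i) ∧ ∑ i ∈ s, r i ^ (N - 1) ≤ ε := by
  have hN1 : ((N : ℝ) - 1) = ((N - 1 : ℕ) : ℝ) := by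
    rw [Nat.cast_sub (by omega)]; simp
  have hε2 : ENNReal.ofReal (ε / 2) ≠ 0 := by
    rw [Ne, ENNReal.ofReal_eq_zero, not_le]; positivity
  obtain ⟨t, htB, htd, hts⟩ : ∃ t : ℕ → Set (Space N), B ⊆ ⋃ n, t n ∧
      (∀ n, ediam (t n) ≤ ENNReal.ofReal (1 / 2)) ∧
      ∑' n, ⨆ _ : (t n).Nonempty, ediam (t n) ^ ((N : ℝ) - 1) < ENNReal.ofReal (ε / 2) := by
    rw [Measure.hausdorffMeasure_apply] at h0
    have h1 := le_iSup₂ (f := fun (r : ℝ≥0∞) (_ : 0 < r) =>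
      ⨅ (t : ℕ → Set (Space N)) (_ : B ⊆ ⋃ n, t n) (_ : ∀ n, ediam (t n) ≤ r),
          ∑' n, ⨆ _ : (t n).Nonempty, ediam (t n) ^ ((N : ℝ) - 1))
      (ENNReal.ofReal (1 / 2)) (by norm_num)
    rw [h0] at h1
    have h2 := lt_of_le_of_lt h1 (pos_iff_ne_zero.2 hε2)
    simp only [iInf_lt_iff] at h2
    obtain ⟨t, a, b, c⟩ := h2
    exact ⟨t, a, b, c⟩
  obtain ⟨δ, hδ, hδs⟩ := ENNReal.exists_pos_sum_of_countable hε2 ℕ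
  set d : ℕ → ℝ := fun n => (ediam (t n)).toReal with hd
  have hdf : ∀ n, ediam (t n) ≠ ⊤ := fun n => ((htd n).trans_lt ENNReal.ofReal_lt_top).ne
  have hd0 : ∀ n, 0 ≤ d n := fun n => ENNReal.toReal_nonneg
  have hd1 : ∀ n, d n ≤ 1 / 2 := fun n => ENNReal.toReal_le_of_le_ofReal (by norm_num) (htd n)
  -- The radius must exceed the diameter strictly, so that an open ball contains the set even when
  -- the diameter is zero; `δ n` is the price, and its sum is below `ε / 2`.
  have hr : ∀ n, ∃ r : ℝ, d n < r ∧ r ≤ 1 ∧ r ^ (N - 1) < d n ^ (N - 1) + δ n := by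
    intro n
    have hc : Tendsto (fun r : ℝ => r ^ (N - 1)) (𝓝[>] d n) (𝓝 (d n ^ (N - 1))) :=
      ((continuous_pow (N - 1)).tendsto (d n)).mono_left nhdsWithin_le_nhds
    have h1 := hc.eventually (gt_mem_nhds (show d n ^ (N - 1) < d n ^ (N - 1) + δ n by
      have := hδ n
      have : (0 : ℝ) < δ n := by exact_mod_cast this
      linarith))
    have h2 : ∀ᶠ r in 𝓝[>] d n, r ∈ Ioo (d n) 1 := Ioo_mem_nhdsGT (by linarith [hd1 n])
    obtain ⟨r, hr1, hr2⟩ := (h1.and h2).exists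
    exact ⟨r, hr2.1, hr2.2.le, hr1⟩
  choose r hr1 hr2 hr3 using hr
  have hx : ∀ n, ∃ x, t n ⊆ ball x (r n) := by
    intro n
    rcases (t n).eq_empty_or_nonempty with h | ⟨x, hx⟩
    · exact ⟨0, by simp [h]⟩
    · refine ⟨x, fun y hy => ?_⟩
      rw [mem_ball, dist_edist]
      exact (ENNReal.toReal_mono (hdf n) (edist_le_ediam_of_mem hy hx)).trans_lt (hr1 n)
  choose x hx using hx
  obtain ⟨s, hs⟩ := hB.elim_finite_subcover (fun n => ball (x n) (r n)) (fun _ => isOpen_ball)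
    (htB.trans (iUnion_mono hx))
  refine ⟨s, x, r, fun i => ⟨(hd0 i).trans_lt (hr1 i), hr2 i⟩, hs, ?_⟩
  -- The supremum ignores empty sets; for them the left side is `0 ^ (N - 1)`, which is zero only
  -- because `N ≥ 2`.
  have hpow : ∀ n, ENNReal.ofReal (d n ^ (N - 1))
      = ⨆ _ : (t n).Nonempty, ediam (t n) ^ ((N : ℝ) - 1) := by
    intro n
    rcases (t n).eq_empty_or_nonempty with h | h
    · have : d n = 0 := by simp [hd, h]
      rw [this, zero_pow (by omega)]
      simp [h]
    · rw [ciSup_pos h, hN1, ENNReal.rpow_natCast, ENNReal.ofReal_pow (hd0 n),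
        ENNReal.ofReal_toReal (hdf n)]
  have key : ENNReal.ofReal (∑ i ∈ s, r i ^ (N - 1)) ≤ ENNReal.ofReal ε := by
    rw [ENNReal.ofReal_sum_of_nonneg fun i _ => pow_nonneg ((hd0 i).trans (hr1 i).le) _]
    calc ∑ i ∈ s, ENNReal.ofReal (r i ^ (N - 1))
        ≤ ∑ i ∈ s, (ENNReal.ofReal (d i ^ (N - 1)) + δ i) := by
          refine Finset.sum_le_sum fun i _ => ?_
          rw [← ENNReal.ofReal_coe_nnreal,
            ← ENNReal.ofReal_add (pow_nonneg (hd0 i) _) (NNReal.coe_nonneg _)]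
          exact ENNReal.ofReal_le_ofReal (hr3 i).le
      _ ≤ ∑' i, (ENNReal.ofReal (d i ^ (N - 1)) + δ i) := ENNReal.sum_le_tsum s
      _ = (∑' i, ENNReal.ofReal (d i ^ (N - 1))) + ∑' i, (δ i : ℝ≥0∞) := ENNReal.tsum_add
      _ ≤ ENNReal.ofReal (ε / 2) + ENNReal.ofReal (ε / 2) := by
          simp only [hpow]
          exact add_le_add hts.le hδs.le
      _ = ENNReal.ofReal ε := by
          rw [← ENNReal.ofReal_add (by positivity) (by positivity), add_halves]
  exact (ENNReal.ofReal_le_ofReal_iff hε.le).1 key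

/-! ### Cut-off functions of balls -/

lemma deriv_smoothTransition_eq_zero {t : ℝ} (ht : t ∉ Icc (0 : ℝ) 1) :
    deriv Real.smoothTransition t = 0 := by
  rw [mem_Icc, not_and_or, not_le, not_le] at ht
  rcases ht with ht | ht
  · have : Real.smoothTransition =ᶠ[𝓝 t] fun _ => 0 := by
      filter_upwards [Iio_mem_nhds ht] with s hs
      exact Real.smoothTransition.zero_of_nonpos (le_of_lt hs)
    rw [this.deriv_eq]; simp
  · have : Real.smoothTransition =ᶠ[𝓝 t] fun _ => 1 := by
      filter_upwards [Ioi_mem_nhds ht] with s hs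
      exact Real.smoothTransition.one_of_one_le (le_of_lt hs)
    rw [this.deriv_eq]; simp

lemma exists_bound_deriv_smoothTransition :
    ∃ C : ℝ, 0 ≤ C ∧ ∀ t, |deriv Real.smoothTransition t| ≤ C := by
  have hc : Continuous (deriv Real.smoothTransition) :=
    (Real.smoothTransition.contDiff (n := 1)).continuous_deriv le_rfl
  obtain ⟨C, hC⟩ := (isCompact_Icc (a := (0 : ℝ)) (b := 1)).exists_bound_of_continuousOn
    hc.continuousOn
  refine ⟨C, (norm_nonneg _).trans (hC 0 (by simp)), fun t => ?_⟩
  by_cases ht : t ∈ Icc (0 : ℝ) 1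
  · exact hC t ht
  · rw [deriv_smoothTransition_eq_zero ht, abs_zero]
    exact (norm_nonneg _).trans (hC 0 (by simp))

/-- A smooth cut-off function equal to `1` on the ball of radius `r` and supported in the ball of
radius `2 r`. -/
noncomputable def ballCutoff (x : Space N) (r : ℝ) (y : Space N) : ℝ :=
  Real.smoothTransition (2 - ‖y - x‖ ^ 2 / r ^ 2)

lemma contDiff_ballCutoff (x : Space N) (r : ℝ) : ContDiff ℝ 1 (ballCutoff x r) :=
  (Real.smoothTransition.contDiff (n := 1)).comp
    (contDiff_const.sub (((contDiff_id.sub contDiff_const).norm_sq ℝ).div_const _))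

lemma ballCutoff_nonneg (x : Space N) (r : ℝ) (y : Space N) : 0 ≤ ballCutoff x r y :=
  Real.smoothTransition.nonneg _

lemma ballCutoff_le_one (x : Space N) (r : ℝ) (y : Space N) : ballCutoff x r y ≤ 1 :=
  Real.smoothTransition.le_one _

lemma ballCutoff_eq_one {x : Space N} {r : ℝ} (hr : 0 < r) {y : Space N} (hy : y ∈ ball x r) :
    ballCutoff x r y = 1 := by
  refine Real.smoothTransition.one_of_one_le ?_
  have h1 : ‖y - x‖ < r := by rwa [← dist_eq_norm]
  have : ‖y - x‖ ^ 2 / r ^ 2 ≤ 1 := by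
    rw [div_le_one (by positivity)]
    gcongr
  linarith

lemma ballCutoff_eq_zero {x : Space N} {r : ℝ} (hr : 0 < r) {y : Space N}
    (hy : 2 * r ^ 2 ≤ ‖y - x‖ ^ 2) : ballCutoff x r y = 0 := by
  refine Real.smoothTransition.zero_of_nonpos ?_
  have : 2 ≤ ‖y - x‖ ^ 2 / r ^ 2 := by
    rwa [le_div_iff₀ (by positivity)]
  linarith

lemma ballCutoff_le_indicator {x : Space N} {r : ℝ} (hr : 0 < r) (y : Space N) :
    ballCutoff x r y ≤ (ball x (2 * r)).indicator 1 y := by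
  by_cases hy : y ∈ ball x (2 * r)
  · rw [indicator_of_mem hy]; exact ballCutoff_le_one _ _ _
  · rw [indicator_of_notMem hy, ballCutoff_eq_zero hr]
    rw [mem_ball, not_lt, dist_eq_norm] at hy
    nlinarith [norm_nonneg (y - x)]

/-- The chain rule gives a factor `2 ‖y - x‖ / r²`, which is at most `4 / r` on the ball of radius
`2 r`; outside it the cut-off vanishes near `y`. -/
lemma abs_fderiv_ballCutoff_le {C : ℝ} (hC0 : 0 ≤ C) (hC : ∀ t, |deriv Real.smoothTransition t| ≤ C)
    {x : Space N} {r : ℝ} (hr : 0 < r) (y v : Space N) :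
    |fderiv ℝ (ballCutoff x r) y v| ≤ (ball x (2 * r)).indicator (fun _ => 4 * C / r * ‖v‖) y := by
  have h1 : HasFDerivAt (fun y : Space N => 2 - ‖y - x‖ ^ 2 / r ^ 2)
      (-((r ^ 2)⁻¹ • (2 • (innerSL ℝ (y - x))))) y := by
    have h2 := ((hasFDerivAt_id (𝕜 := ℝ) y).sub_const x).norm_sq
    have h3 := (h2.const_mul (r ^ 2)⁻¹).const_sub 2
    simpa [div_eq_inv_mul] using h3
  have h2 : HasDerivAt Real.smoothTransition
      (deriv Real.smoothTransition (2 - ‖y - x‖ ^ 2 / r ^ 2)) (2 - ‖y - x‖ ^ 2 / r ^ 2) :=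
    ((Real.smoothTransition.contDiff (n := 1)).differentiable (by norm_num) _).hasDerivAt
  have h3 : HasFDerivAt (ballCutoff x r) _ y := h2.comp_hasFDerivAt y h1
  by_cases hy : y ∈ ball x (2 * r)
  · rw [indicator_of_mem hy, h3.fderiv]
    have hy' : ‖y - x‖ ≤ 2 * r := by rw [← dist_eq_norm]; exact (mem_ball.1 hy).le
    have h4 : |inner ℝ (y - x) v| ≤ 2 * r * ‖v‖ :=
      (abs_real_inner_le_norm _ _).trans (by gcongr)
    simp only [_root_.smul_apply, _root_.neg_apply, innerSL_apply_apply, smul_eq_mul, nsmul_eq_mul,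
      abs_mul, abs_neg, Nat.cast_ofNat]
    rw [abs_of_pos (by positivity : (0 : ℝ) < (r ^ 2)⁻¹), abs_of_pos (by norm_num : (0 : ℝ) < 2)]
    calc _ ≤ C * ((r ^ 2)⁻¹ * (2 * (2 * r * ‖v‖))) := by gcongr; exact hC _
      _ = 4 * C / r * ‖v‖ := by field_simp; ring
  · have hy' : 2 * r ≤ ‖y - x‖ := by
      rwa [mem_ball, not_lt, dist_eq_norm] at hy
    have h0 : ballCutoff x r =ᶠ[𝓝 y] fun _ => 0 := by
      have hc : Continuous fun z : Space N => ‖z - x‖ ^ 2 := by fun_prop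
      have hlt : 2 * r ^ 2 < ‖y - x‖ ^ 2 := by nlinarith
      filter_upwards [hc.continuousAt.eventually (lt_mem_nhds hlt)] with z hz
      exact ballCutoff_eq_zero hr hz.le
    rw [indicator_of_notMem hy, h0.fderiv_eq]
    simp

end ReducedWave

namespace ReducedWave

open Filter Topology ContinuousLinearMap Metric

variable {N : ℕ}

/-- The product of the functions `1 - θ_i` of a finite family. -/
lemma prod_one_sub_cutoff_bounds {ι : Type*} (s : Finset ι) {θ : ι → Space N → ℝ}
    (hs : ∀ i, ContDiff ℝ 1 (θ i)) (h0 : ∀ i y, 0 ≤ θ i y) (h1 : ∀ i y, θ i y ≤ 1) :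
    ContDiff ℝ 1 (fun y => ∏ i ∈ s, (1 - θ i y)) ∧
      ∀ y, (0 ≤ ∏ i ∈ s, (1 - θ i y)) ∧ (∏ i ∈ s, (1 - θ i y) ≤ 1) ∧
        (1 - ∏ i ∈ s, (1 - θ i y) ≤ ∑ i ∈ s, θ i y) ∧
        ∀ v, |fderiv ℝ (fun y => ∏ i ∈ s, (1 - θ i y)) y v| ≤ ∑ i ∈ s, |fderiv ℝ (θ i) y v| := by
  classical
  induction s using Finset.induction_on with
  | empty => exact ⟨by simpa using contDiff_const, fun y => by simp⟩
  | insert a s ha ih =>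
    obtain ⟨ihs, ih⟩ := ih
    have e : (fun y => ∏ i ∈ insert a s, (1 - θ i y))
        = fun y => (1 - θ a y) * ∏ i ∈ s, (1 - θ i y) := by
      funext y
      rw [Finset.prod_insert ha]
    rw [e]
    refine ⟨(contDiff_const.sub (hs a)).mul ihs, fun y => ?_⟩
    obtain ⟨i0, i1, i2, i3⟩ := ih y
    have a0 := h0 a y
    have a1 := h1 a y
    rw [Finset.prod_insert ha, Finset.sum_insert ha]
    refine ⟨mul_nonneg (by linarith) i0, ?_, ?_, fun v => ?_⟩
    · exact mul_le_one₀ (by linarith) i0 i1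
    · nlinarith
    · rw [Finset.sum_insert ha, fderiv_fun_mul
        ((contDiff_const.sub (hs a)).differentiable (by norm_num) y)
        (ihs.differentiable (by norm_num) y), fderiv_const_sub]
      simp only [_root_.add_apply, _root_.smul_apply, _root_.neg_apply, smul_eq_mul]
      have i3 := i3 v
      set A := fderiv ℝ (fun y => ∏ i ∈ s, (1 - θ i y)) y v
      calc |(1 - θ a y) * A + (∏ i ∈ s, (1 - θ i y)) * -fderiv ℝ (θ a) y v|
          ≤ |(1 - θ a y) * A| + |(∏ i ∈ s, (1 - θ i y)) * -fderiv ℝ (θ a) y v| := abs_add_le _ _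
        _ ≤ 1 * |A| + 1 * |fderiv ℝ (θ a) y v| := by
            rw [abs_mul, abs_mul, abs_neg]
            gcongr
            · rw [abs_le]; constructor <;> linarith
            · rw [abs_le]; constructor <;> linarith
        _ ≤ _ := by linarith

/-- Density `1 / r` on volume of order `r ^ N`: this is why the codimension-one content is what has
to be small. -/
lemma integral_const_div_indicator_ball {A r : ℝ} (hr : 0 < r) (hN : 2 ≤ N) (x : Space N) :
    Integrable ((ball x (2 * r)).indicator fun _ => A / r) ∧
    ∫ y, (ball x (2 * r)).indicator (fun _ => A / r) y
      = A * 2 ^ N * volume.real (ball (0 : Space N) 1) * r ^ (N - 1) := by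
  have hfin : volume (ball x (2 * r)) ≠ ⊤ := measure_ball_lt_top.ne
  refine ⟨(integrable_indicator_iff measurableSet_ball).2 (integrableOn_const hfin), ?_⟩
  rw [integral_indicator measurableSet_ball, setIntegral_const, measureReal_def,
    Measure.addHaar_ball_of_pos _ _ (by positivity), ENNReal.toReal_mul,
    ENNReal.toReal_ofReal (by positivity), finrank_euclideanSpace_fin, smul_eq_mul,
    ← measureReal_def]
  obtain ⟨k, rfl⟩ : ∃ k, N = k + 1 := ⟨N - 1, by omega⟩
  rw [Nat.add_sub_cancel, mul_pow]
  field_simp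
  ring

/-- A bounded function that is locally radially nondecreasing outside a set of vanishing
`(N - 1)`-dimensional Hausdorff measure is radially nondecreasing. -/
lemma RadiallyMonotoneOn.univ_of_hausdorffMeasure (hN : 2 ≤ N) {μ : Space N → ℝ} {M : ℝ}
    (hμ : AEStronglyMeasurable μ) (hM : ∀ᵐ x, ‖μ x‖ ≤ M)
    (h0 : Measure.hausdorffMeasure ((N : ℝ) - 1)
      {x | ¬ ∃ V ∈ 𝓝 x, RadiallyMonotoneOn μ V} = 0) : RadiallyMonotoneOn μ univ := by
  intro w hw hc _ hw0
  have hM0 : 0 ≤ M := by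
    obtain ⟨x, hx⟩ := hM.exists
    exact (norm_nonneg _).trans hx
  set G : Set (Space N) := {x | ∃ V ∈ 𝓝 x, RadiallyMonotoneOn μ V} with hG
  have hGo : IsOpen G := by
    refine isOpen_iff_mem_nhds.2 fun x hx => ?_
    obtain ⟨V, hV, h⟩ := hx
    filter_upwards [eventually_mem_nhds_iff.2 hV] with y hy
    exact ⟨V, hy, h⟩
  have hBc : IsCompact (tsupport w \ G) := hc.isCompact.diff hGo
  have hB0 : Measure.hausdorffMeasure ((N : ℝ) - 1) (tsupport w \ G) = 0 :=
    measure_mono_null (fun x hx => hx.2) h0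
  have hi := integrable_radialDiv hw hc
  obtain ⟨A₁, hA₁⟩ := (continuous_radialDiv hw).bounded_above_of_compact_support
    (hasCompactSupport_radialDiv hc)
  have hwn : Continuous fun y => w y * ‖y‖ := hw.continuous.mul continuous_norm
  obtain ⟨A₂, hA₂⟩ := hwn.bounded_above_of_compact_support hc.mul_right
  obtain ⟨C, hC0, hC⟩ := exists_bound_deriv_smoothTransition
  have hA₁0 : 0 ≤ A₁ := (norm_nonneg _).trans (hA₁ 0)
  have hA₂0 : 0 ≤ A₂ := (norm_nonneg _).trans (hA₂ 0)
  -- `A / r` bounds the error density of one cut-off ball: `A₁` for the loss `1 - η` (with `r ≤ 1`),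
  -- `4 C A₂` for the gradient of the cut-off.
  set A := M * (A₁ + 4 * C * A₂) with hA
  have hA0 : 0 ≤ A := by positivity
  set Q := A * 2 ^ N * volume.real (ball (0 : Space N) 1) with hQ
  have hQ0 : 0 ≤ Q := by positivity
  have key : ∀ ε > 0, ∫ x, μ x * radialDiv w x ≤ Q * ε := by
    intro ε hε
    obtain ⟨s, x, r, hr, hcov, hsum⟩ :=
      exists_finite_cover_of_hausdorffMeasure_eq_zero hN hBc hB0 hε
    set θ : ℕ → Space N → ℝ := fun i => ballCutoff (x i) (r i) with hθ
    obtain ⟨hηs, hη⟩ := prod_one_sub_cutoff_bounds s (θ := θ) (fun i => contDiff_ballCutoff _ _)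
      (fun i => ballCutoff_nonneg _ _) (fun i => ballCutoff_le_one _ _)
    set η : Space N → ℝ := fun y => ∏ i ∈ s, (1 - θ i y) with hηdef
    have hηw : ContDiff ℝ 1 (fun y => η y * w y) := hηs.mul hw
    have hηc : HasCompactSupport (fun y => η y * w y) := hc.mul_left
    -- `η` vanishes on every covering ball, and these cover the part of the support of `w` outside
    -- `G`.
    have hsupp : tsupport (fun y => η y * w y) ⊆ G := by
      intro y hy
      by_contra hyG
      have hyB : y ∈ tsupport w \ G := ⟨tsupport_mul_subset_right hy, hyG⟩
      obtain ⟨i, hi, hyi⟩ := mem_iUnion₂.1 (hcov hyB)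
      refine notMem_tsupport_iff_eventuallyEq.2 ?_ hy
      filter_upwards [isOpen_ball.mem_nhds hyi] with z hz
      have : η z = 0 := Finset.prod_eq_zero hi (by
        rw [hθ]; simp only; rw [ballCutoff_eq_one (hr i).1 hz, sub_self])
      simp [this]
    have hle := RadiallyMonotoneOn.of_locally hμ hM (G := G) (fun _ h => h) _ hηw hηc hsupp
      fun y => mul_nonneg (hη y).1 (hw0 y)
    set b : ℕ → Space N → ℝ := fun i => (ball (x i) (2 * r i)).indicator fun _ => A / r i with hb
    have hbi : ∀ i, Integrable (b i) := fun i =>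
      (integral_const_div_indicator_ball (hr i).1 hN (x i)).1
    have hpt : ∀ᵐ y, μ y * radialDiv w y
        ≤ μ y * radialDiv (fun y => η y * w y) y + ∑ i ∈ s, b i y := by
      filter_upwards [hM] with y hy
      obtain ⟨e0, e1, e2, e3⟩ := hη y
      rw [radialDiv_mul (hηs.differentiable (by norm_num) y) (hw.differentiable (by norm_num) y)]
      have h1 : |1 - η y| * |radialDiv w y| ≤ ∑ i ∈ s, θ i y * A₁ := by
        rw [abs_of_nonneg (by simp only [hηdef]; linarith), ← Finset.sum_mul]
        exact mul_le_mul e2 (hA₁ y) (abs_nonneg _)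
          (Finset.sum_nonneg fun i _ => ballCutoff_nonneg _ _ _)
      have h2 : |fderiv ℝ η y y * w y| ≤ ∑ i ∈ s, |fderiv ℝ (θ i) y y| * w y := by
        rw [abs_mul, abs_of_nonneg (hw0 y), ← Finset.sum_mul]
        exact mul_le_mul_of_nonneg_right (e3 y) (hw0 y)
      have h3 : ∀ i, M * (θ i y * A₁ + |fderiv ℝ (θ i) y y| * w y) ≤ b i y := by
        intro i
        have t1 := ballCutoff_le_indicator (x := x i) (hr i).1 y
        have t2 := abs_fderiv_ballCutoff_le hC0 hC (x := x i) (hr i).1 y y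
        by_cases hyb : y ∈ ball (x i) (2 * r i)
        · rw [indicator_of_mem hyb] at t1 t2
          simp only [hb, indicator_of_mem hyb, hA, mul_div_assoc]
          have hwy : w y * ‖y‖ ≤ A₂ := (le_abs_self _).trans (hA₂ y)
          have hri := (hr i).1
          have hAr : A₁ ≤ A₁ / r i := by
            rw [le_div_iff₀ hri]
            exact mul_le_of_le_one_right hA₁0 (hr i).2
          gcongr
          rw [add_div]
          refine add_le_add ?_ ?_
          · exact (mul_le_of_le_one_left hA₁0 t1).trans hAr
          · calc |fderiv ℝ (θ i) y y| * w y ≤ (4 * C / r i * ‖y‖) * w y :=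
                  mul_le_mul_of_nonneg_right t2 (hw0 y)
              _ = 4 * C / r i * (w y * ‖y‖) := by ring
              _ ≤ 4 * C / r i * A₂ := by gcongr
              _ = 4 * C * A₂ / r i := by ring
        · rw [indicator_of_notMem hyb] at t1 t2
          have u1 : θ i y = 0 := le_antisymm t1 (ballCutoff_nonneg _ _ _)
          have u2 : |fderiv ℝ (θ i) y y| = 0 := le_antisymm t2 (abs_nonneg _)
          simp [u1, u2, hb, hyb]
      have h4 : μ y * ((1 - η y) * radialDiv w y - fderiv ℝ η y y * w y) ≤ ∑ i ∈ s, b i y := by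
        calc μ y * ((1 - η y) * radialDiv w y - fderiv ℝ η y y * w y)
            ≤ |μ y| * |(1 - η y) * radialDiv w y - fderiv ℝ η y y * w y| := by
              rw [← abs_mul]; exact le_abs_self _
          _ ≤ M * (|1 - η y| * |radialDiv w y| + |fderiv ℝ η y y * w y|) := by
              gcongr
              · exact hy
              · rw [← abs_mul]; exact abs_sub _ _
          _ ≤ M * ((∑ i ∈ s, θ i y * A₁) + ∑ i ∈ s, |fderiv ℝ (θ i) y y| * w y) := by gcongr
          _ = ∑ i ∈ s, M * (θ i y * A₁ + |fderiv ℝ (θ i) y y| * w y) := by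
              rw [← Finset.sum_add_distrib, Finset.mul_sum]
          _ ≤ _ := Finset.sum_le_sum fun i _ => h3 i
      linarith
    have i1 : Integrable fun y => μ y * radialDiv w y := hi.bdd_mul (c := M) hμ hM
    have i2 : Integrable fun y => μ y * radialDiv (fun y => η y * w y) y :=
      (integrable_radialDiv hηw hηc).bdd_mul (c := M) hμ hM
    have i3 : Integrable fun y => ∑ i ∈ s, b i y := integrable_finsetSum _ fun i _ => hbi i
    calc ∫ y, μ y * radialDiv w y
        ≤ ∫ y, (μ y * radialDiv (fun y => η y * w y) y + ∑ i ∈ s, b i y) :=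
          integral_mono_ae i1 (i2.add i3) hpt
      _ = (∫ y, μ y * radialDiv (fun y => η y * w y) y) + ∑ i ∈ s, ∫ y, b i y := by
          rw [integral_add i2 i3, integral_finsetSum _ fun i _ => hbi i]
      _ ≤ 0 + ∑ i ∈ s, Q * r i ^ (N - 1) := by
          refine add_le_add hle (Finset.sum_le_sum fun i _ => le_of_eq ?_)
          exact (integral_const_div_indicator_ball (hr i).1 hN (x i)).2
      _ ≤ Q * ε := by
          rw [zero_add, ← Finset.mul_sum]
          gcongr
  refine le_of_forall_pos_le_add fun κ hκ => ?_
  refine (key (κ / (Q + 1)) (by positivity)).trans ?_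
  rw [zero_add, ← mul_div_assoc, div_le_iff₀ (by positivity)]
  nlinarith

/-- A layered medium is radially nondecreasing. -/
theorem IsLayeredMedium.radiallyMonotoneOn_univ (hN : 2 ≤ N) {L : Set ℤ}
    {Ω Sm Sp : ℤ → Set (Space N)} {ν : ℤ → ℝ} {μ₀ : Space N → ℝ}
    (hμ : IsLayeredMedium L Ω Sm Sp ν μ₀) : RadiallyMonotoneOn μ₀ univ := by
  obtain ⟨m, M, hm, hb⟩ := hμ.exists_bounds
  refine RadiallyMonotoneOn.univ_of_hausdorffMeasure hN hμ.exists_measurable (M := M) ?_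
    hμ.hausdorffMeasure_bad_eq_zero
  filter_upwards [hb] with x hx
  rw [Real.norm_of_nonneg (hμ.pos x).le]
  exact hx.2

end ReducedWave

namespace ReducedWave

open Filter Topology ContinuousLinearMap Metric

variable {N : ℕ}

/-! ### The virial inequality -/

/-- A real valued `H²_loc` solution of `Δu = -κ u` with gradient `U` and Hessian `H`. -/
structure IsRealSolution {N : ℕ} (κ u : Space N → ℝ) (U : Fin N → Space N → ℝ)
    (H : Fin N → Fin N → Space N → ℝ) : Prop where
  memL2 : RealL2Loc u
  gradMemL2 : ∀ i, RealL2Loc (U i)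
  hessMemL2 : ∀ i j, RealL2Loc (H i j)
  grad : ∀ i, WeakPartial i u (U i)
  hess : ∀ i j, WeakPartial j (U i) (H i j)
  eqn : ∀ᵐ x, ∑ i, H i i x = -κ x * u x

/-- A radial test function `m`, with `∇m = 2 d(x) x`. -/
structure IsRadialTest {N : ℕ} (m d : Space N → ℝ) : Prop where
  test : IsTestFunction m
  cont : Continuous d
  supp : HasCompactSupport d
  partial_eq : ∀ x i, partialDeriv i m x = 2 * d x * x i

lemma partialDeriv_comm {φ : Space N → ℝ} (hφ : ContDiff ℝ ∞ φ) (i j : Fin N) (x : Space N) :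
    partialDeriv i (partialDeriv j φ) x = partialDeriv j (partialDeriv i φ) x := by
  have hd : DifferentiableAt ℝ (fderiv ℝ φ) x :=
    ((hφ.fderiv_right (m := ∞) (by norm_cast)).differentiable (by norm_cast)) x
  have key : ∀ a b : Space N, fderiv ℝ (fun y => fderiv ℝ φ y a) x b
      = fderiv ℝ (fderiv ℝ φ) x b a := by
    intro a b
    rw [fderiv_clm_apply hd (differentiableAt_const _)]
    simp
  have hs : IsSymmSndFDerivAt ℝ φ x :=
    hφ.contDiffAt.isSymmSndFDerivAt (by simp; norm_cast)
  change fderiv ℝ (fun y => fderiv ℝ φ y _) x _ = fderiv ℝ (fun y => fderiv ℝ φ y _) x _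
  rw [key, key]
  exact hs _ _

/-- Both second derivatives are tested against `φ`, where the order of differentiation is
immaterial. -/
lemma WeakPartial.ae_eq_of_second {i j : Fin N} {u Ui Uj Hij Hji : Space N → ℝ}
    (hi : WeakPartial i u Ui) (hj : WeakPartial j u Uj) (hij : WeakPartial j Ui Hij)
    (hji : WeakPartial i Uj Hji) : Hij =ᵐ[volume] Hji := by
  refine ae_eq_of_integral_contDiff_smul_eq hij.2.1 hji.2.1 fun φ hφ hφc => ?_
  have hT : IsTestFunction φ := ⟨hφ, hφc⟩
  have h1 := hij.2.2 φ hT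
  have h2 := hi.2.2 _ (hT.partialDeriv j)
  have h3 := hji.2.2 φ hT
  have h4 := hj.2.2 _ (hT.partialDeriv i)
  simp only [partialDeriv_comm hφ i j] at h2
  simp only [smul_eq_mul]
  linarith

lemma IsRadialTest.mul_coord {m d : Space N → ℝ} (h : IsRadialTest m d) (k : Fin N) :
    IsTestFunction fun x => m x * x k :=
  ⟨h.test.1.mul (contDiff_coord k), h.test.2.mul_right⟩

lemma IsRadialTest.partialDeriv_mul_coord {m d : Space N → ℝ} (h : IsRadialTest m d) (j k : Fin N)
    (x : Space N) : partialDeriv j (fun x => m x * x k) x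
      = 2 * d x * x j * x k + if j = k then m x else 0 := by
  rw [partialDeriv_mul ((h.test.1.differentiable (by norm_cast)) x)
    (hasFDerivAt_coord k x).differentiableAt, h.partial_eq]
  congr 1
  rw [partialDeriv, (hasFDerivAt_coord k x).fderiv]
  by_cases hjk : j = k
  · simp [hjk]
  · simp [hjk, Ne.symm hjk]

lemma integrable_testFunction_mul_mul {φ f g : Space N → ℝ} (hφ : Continuous φ)
    (hc : HasCompactSupport φ) (hf : RealL2Loc f) (hg : RealL2Loc g) :
    Integrable fun x => φ x * (f x * g x) := by
  obtain ⟨C, hC⟩ := exists_bound_of_hasCompactSupport hφ hc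
  exact integrable_mul_mul hc hφ.aestronglyMeasurable hC hf hg

lemma integral_weakPartial_mul' {i : Fin N} {f g F G φ : Space N → ℝ} (hf : WeakPartial i f F)
    (hg : WeakPartial i g G) (lf : RealL2Loc f) (lg : RealL2Loc g) (lF : RealL2Loc F)
    (lG : RealL2Loc G) (hφ : IsTestFunction φ) :
    Integrable (fun x => partialDeriv i φ x * (f x * g x) + φ x * (F x * g x)
      + φ x * (f x * G x)) ∧
    ∫ x, (partialDeriv i φ x * (f x * g x) + φ x * (F x * g x) + φ x * (f x * G x)) = 0 := by
  have hφ' := hφ.partialDeriv i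
  have i1 := integrable_testFunction_mul_mul hφ'.1.continuous hφ'.2 lf lg
  have i2 := integrable_testFunction_mul_mul hφ.1.continuous hφ.2 lF lg
  have i3 := integrable_testFunction_mul_mul hφ.1.continuous hφ.2 lf lG
  refine ⟨(i1.add i2).add i3, ?_⟩
  have := integral_weakPartial_mul hf hg lf lg lF lG hφ
  rw [← this, ← integral_add i1 i2]
  exact integral_add (i1.add i2) i3

/-- The radial derivative `x · U`. -/
def radialPart {N : ℕ} (U : Fin N → Space N → ℝ) (x : Space N) : ℝ := ∑ k, x k * U k x

/-- `|U|²`. -/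
def gradSq {N : ℕ} (U : Fin N → Space N → ℝ) (x : Space N) : ℝ := ∑ k, U k x ^ 2

lemma norm_sq_eq_sum (x : Space N) : ‖x‖ ^ 2 = ∑ k, x k ^ 2 := by
  rw [EuclideanSpace.norm_sq_eq]
  simp

variable {κ u : Space N → ℝ} {U : Fin N → Space N → ℝ} {H : Fin N → Fin N → Space N → ℝ}
  {m d : Space N → ℝ}

/-- The Pohozaev identity for the multiplier `2 m x · ∇u + (N - 1) m u`. -/
lemma IsRealSolution.virial_identity (hu : IsRealSolution κ u U H) (hm : IsRadialTest m d) :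
    let J := fun x => (m x - 2 * ‖x‖ ^ 2 * d x) * gradSq U x + 4 * d x * radialPart U x ^ 2
      - (2 * m x * radialPart U x + (N - 1) * m x * u x) * (κ x * u x)
      + 2 * (N - 1) * d x * u x * radialPart U x
    Integrable J ∧ ∫ x, J x = 0 := by
  intro J
  -- The divergences used are those of `m x_k ∂_j u ∂_k u` (in `j`), of `m x_k (∂_j u)²` (in `k`),
  -- and of `m u ∂_j u` (in `j`).
  have h1 := fun j k => integral_weakPartial_mul' (hu.hess j j) (hu.hess k j) (hu.gradMemL2 j)
    (hu.gradMemL2 k) (hu.hessMemL2 j j) (hu.hessMemL2 k j) (hm.mul_coord k)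
  have h2 := fun j k => integral_weakPartial_mul' (hu.hess j k) (hu.hess j k) (hu.gradMemL2 j)
    (hu.gradMemL2 j) (hu.hessMemL2 j k) (hu.hessMemL2 j k) (hm.mul_coord k)
  have h3 := fun j => integral_weakPartial_mul' (hu.grad j) (hu.hess j j) hu.memL2
    (hu.gradMemL2 j) (hu.gradMemL2 j) (hu.hessMemL2 j j) hm.test
  simp only [hm.partialDeriv_mul_coord, if_true] at h1 h2
  simp only [hm.partial_eq] at h3
  have hsym : ∀ᵐ x, ∀ j k, H j k x = H k j x := by
    rw [ae_all_iff]; intro j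
    rw [ae_all_iff]; intro k
    exact WeakPartial.ae_eq_of_second (hu.grad j) (hu.grad k) (hu.hess j k) (hu.hess k j)
  set A : Fin N → Fin N → Space N → ℝ := fun j k x =>
    (2 * d x * x j * x k + if j = k then m x else 0) * (U j x * U k x)
      + m x * x k * (H j j x * U k x) + m x * x k * (U j x * H k j x) with hA
  set B : Fin N → Fin N → Space N → ℝ := fun j k x =>
    (2 * d x * x k * x k + m x) * (U j x * U j x)
      + m x * x k * (H j k x * U j x) + m x * x k * (U j x * H j k x) with hB
  set C : Fin N → Space N → ℝ := fun j x =>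
    2 * d x * x j * (u x * U j x) + m x * (U j x * U j x) + m x * (u x * H j j x) with hC
  have iA : ∀ j k, Integrable (A j k) := fun j k => (h1 j k).1
  have iB : ∀ j k, Integrable (B j k) := fun j k => (h2 j k).1
  have iC : ∀ j, Integrable (C j) := fun j => (h3 j).1
  -- The multiplier `x·∇u` produces `(2 - N) m |∇u|²`; adding `N - 1` times the third family reduces
  -- the coefficient to `m`, independently of `N`.
  set T : Space N → ℝ := fun x => (∑ j, ∑ k, (2 * A j k x - B j k x)) + (N - 1) * ∑ j, C j x with hT
  have iD : ∀ j k, Integrable fun x => 2 * A j k x - B j k x := fun j k =>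
    ((iA j k).const_mul 2).sub (iB j k)
  have iDs : ∀ j, Integrable fun x => ∑ k, (2 * A j k x - B j k x) := fun j =>
    integrable_finsetSum _ fun k _ => iD j k
  have iS : Integrable fun x => ∑ j, ∑ k, (2 * A j k x - B j k x) :=
    integrable_finsetSum _ fun j _ => iDs j
  have iS' : Integrable fun x => ((N : ℝ) - 1) * ∑ j, C j x :=
    (integrable_finsetSum _ fun j _ => iC j).const_mul _
  have hTint : ∫ x, T x = 0 := by
    rw [hT, integral_add iS iS', integral_const_mul, integral_finsetSum _ fun j _ => iC j,
      integral_finsetSum _ fun j _ => iDs j]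
    have e1 : ∀ j, ∫ x, ∑ k, (2 * A j k x - B j k x) = 0 := by
      intro j
      rw [integral_finsetSum _ fun k _ => iD j k]
      refine Finset.sum_eq_zero fun k _ => ?_
      rw [integral_sub ((iA j k).const_mul 2) (iB j k), integral_const_mul, (h1 j k).2, (h2 j k).2]
      simp
    rw [Finset.sum_eq_zero fun j _ => e1 j, Finset.sum_eq_zero fun j _ => (h3 j).2]
    simp
  have hJT : T =ᵐ[volume] J := by
    filter_upwards [hsym, hu.eqn] with x hs he
    have e1 : ∑ j, ∑ k, (2 * A j k x - B j k x)
        = 4 * d x * radialPart U x ^ 2 + 2 * m x * gradSq U x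
          + 2 * m x * radialPart U x * (∑ i, H i i x)
          - (2 * d x * ‖x‖ ^ 2 + N * m x) * gradSq U x := by
      have r1 : radialPart U x ^ 2 = ∑ j, ∑ k, (x j * U j x) * (x k * U k x) := by
        rw [radialPart, sq, Finset.sum_mul_sum]
      have r2 : m x * gradSq U x = ∑ j, ∑ k, (if j = k then m x else 0) * (U j x * U k x) := by
        simp only [gradSq, Finset.mul_sum, ite_mul, zero_mul, Finset.sum_ite_eq, Finset.mem_univ,
          if_true, sq]
      have r3 : radialPart U x * (∑ i, H i i x) = ∑ j, ∑ k, H j j x * (x k * U k x) := by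
        rw [radialPart, mul_comm, Finset.sum_mul_sum]
      have r4 : ‖x‖ ^ 2 * gradSq U x = ∑ j, ∑ k, U j x ^ 2 * x k ^ 2 := by
        rw [norm_sq_eq_sum, gradSq, mul_comm, Finset.sum_mul_sum]
      have r5 : (N : ℝ) * (m x * gradSq U x) = ∑ j, ∑ k : Fin N, m x * U j x ^ 2 := by
        simp [gradSq, Finset.mul_sum]
      have : 4 * d x * radialPart U x ^ 2 + 2 * m x * gradSq U x
          + 2 * m x * radialPart U x * (∑ i, H i i x)
          - (2 * d x * ‖x‖ ^ 2 + N * m x) * gradSq U x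
          = 4 * d x * (radialPart U x ^ 2) + 2 * (m x * gradSq U x)
            + 2 * m x * (radialPart U x * (∑ i, H i i x))
            - 2 * d x * (‖x‖ ^ 2 * gradSq U x) - N * (m x * gradSq U x) := by ring
      rw [this, r5, r1, r2, r3, r4]
      simp only [Finset.mul_sum, ← Finset.sum_add_distrib, ← Finset.sum_sub_distrib]
      refine Finset.sum_congr rfl fun j _ => Finset.sum_congr rfl fun k _ => ?_
      simp only [hA, hB, hs k j]
      ring
    have e2 : ∑ j, C j x = 2 * d x * u x * radialPart U x + m x * gradSq U x
        + m x * u x * ∑ i, H i i x := by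
      simp only [hC, radialPart, gradSq, Finset.mul_sum, ← Finset.sum_add_distrib]
      refine Finset.sum_congr rfl fun j _ => ?_
      ring
    simp only [hT, J, e1, e2, he]
    ring
  exact ⟨(iS.add iS').congr hJT, by rw [← integral_congr_ae hJT, hTint]⟩

lemma IsRadialTest.fderiv_self (hm : IsRadialTest m d) (x : Space N) :
    fderiv ℝ m x x = 2 * d x * ‖x‖ ^ 2 := by
  rw [fderiv_apply_self_eq_sum, norm_sq_eq_sum, Finset.mul_sum]
  refine Finset.sum_congr rfl fun i _ => ?_
  have := hm.partial_eq x i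
  rw [partialDeriv] at this
  rw [this]
  ring

/-- The radial monotonicity of `κ`, tested with `m u²`. -/
lemma RadiallyMonotoneOn.integral_sq_le {K : ℝ} (hκ : RadiallyMonotoneOn κ univ)
    (hκm : AEStronglyMeasurable κ) (hκb : ∀ᵐ x, ‖κ x‖ ≤ K) (hm : IsRadialTest m d)
    (hm0 : ∀ x, 0 ≤ m x) (lu : RealL2Loc u) (lU : ∀ i, RealL2Loc (U i))
    (hU : ∀ i, WeakPartial i u (U i)) :
    let G := fun x => κ x * ((N * m x + 2 * ‖x‖ ^ 2 * d x) * u x ^ 2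
      + 2 * m x * u x * radialPart U x)
    Integrable G ∧ ∫ x, G x ≤ 0 := by
  intro G
  set c₀ : Space N → ℝ := fun x => κ x * (N * m x + 2 * ‖x‖ ^ 2 * d x) with hc₀
  set c : Fin N → Space N → ℝ := fun k x => κ x * (2 * m x * x k) with hc
  have hmc := hm.test.1.continuous
  have q₀c : Continuous fun x : Space N => N * m x + 2 * ‖x‖ ^ 2 * d x :=
    (continuous_const.mul hmc).add ((continuous_const.mul (continuous_norm.pow 2)).mul hm.cont)
  have q₀s : HasCompactSupport fun x : Space N => N * m x + 2 * ‖x‖ ^ 2 * d x :=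
    (hm.test.2.mul_left (f := fun _ => (N : ℝ))).add (hm.supp.mul_left (f := fun x => 2 * ‖x‖ ^ 2))
  have qc : ∀ k : Fin N, Continuous fun x : Space N => 2 * m x * x k := fun k =>
    (continuous_const.mul hmc).mul (contDiff_coord (n := 0) k).continuous
  have qs : ∀ k : Fin N, HasCompactSupport fun x : Space N => 2 * m x * x k := fun k =>
    (hm.test.2.mul_left (f := fun _ => (2 : ℝ))).mul_right
  have bdd : ∀ q : Space N → ℝ, Continuous q → HasCompactSupport q →
      HasCompactSupport (fun x => κ x * q x) ∧ AEStronglyMeasurable (fun x => κ x * q x) ∧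
      ∃ C, ∀ᵐ x, ‖κ x * q x‖ ≤ C := by
    intro q hq hqs
    obtain ⟨C, hC⟩ := hq.bounded_above_of_compact_support hqs
    refine ⟨hqs.mul_left, hκm.mul hq.aestronglyMeasurable, K * C, ?_⟩
    filter_upwards [hκb] with x hx
    rw [norm_mul]
    exact mul_le_mul hx (hC x) (norm_nonneg _) ((norm_nonneg _).trans hx)
  obtain ⟨s₀, m₀, C₀, b₀⟩ := bdd _ q₀c q₀s
  have hk := fun k => bdd _ (qc k) (qs k)
  -- mollification
  set v := fun n => mollify n u with hv
  have sv : ∀ n, ContDiff ℝ ∞ (v n) := fun n => contDiff_mollify n lu.locallyIntegrable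
  have lv : ∀ n, RealL2Loc (v n) := fun n => Continuous.realL2Loc (sv n).continuous
  have lV : ∀ k n, RealL2Loc (mollify n (U k)) := fun k n =>
    Continuous.realL2Loc (contDiff_mollify n (lU k).locallyIntegrable).continuous
  have tv := fun R => tendsto_eLpNorm_mollify_sub_ball lu R
  have tV := fun k R => tendsto_eLpNorm_mollify_sub_ball (lU k) R
  have t₀ := tendsto_integral_mul_mul s₀ m₀ b₀ lu lu lv lv tv tv
  have tk : ∀ k, Tendsto (fun n => ∫ x, c k x * (v n x * mollify n (U k) x)) atTop
      (𝓝 (∫ x, c k x * (u x * U k x))) := by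
    intro k
    obtain ⟨sk, mk, Ck, bk⟩ := hk k
    exact tendsto_integral_mul_mul sk mk bk lu (lU k) lv (lV k) tv (tV k)
  have i₀ : ∀ {f : Space N → ℝ}, RealL2Loc f → Integrable fun x => c₀ x * (f x * f x) :=
    fun hf => integrable_mul_mul s₀ m₀ b₀ hf hf
  have ik : ∀ k {f g : Space N → ℝ}, RealL2Loc f → RealL2Loc g →
      Integrable fun x => c k x * (f x * g x) := by
    intro k f g hf hg
    obtain ⟨sk, mk, Ck, bk⟩ := hk k
    exact integrable_mul_mul sk mk bk hf hg
  have hsplit : ∀ {f : Space N → ℝ} {g : Fin N → Space N → ℝ}, RealL2Loc f →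
      (∀ k, RealL2Loc (g k)) →
      Integrable (fun x => c₀ x * (f x * f x) + ∑ k, c k x * (f x * g k x)) ∧
      ∫ x, (c₀ x * (f x * f x) + ∑ k, c k x * (f x * g k x))
        = (∫ x, c₀ x * (f x * f x)) + ∑ k, ∫ x, c k x * (f x * g k x) := by
    intro f g hf hg
    have hi := integrable_finsetSum Finset.univ fun k _ => ik k hf (hg k)
    refine ⟨(i₀ hf).add hi, ?_⟩
    rw [integral_add (i₀ hf) hi, integral_finsetSum _ fun k _ => ik k hf (hg k)]
  have hpt : ∀ (f : Space N → ℝ) (g : Fin N → Space N → ℝ) (x : Space N),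
      c₀ x * (f x * f x) + ∑ k, c k x * (f x * g k x)
      = κ x * ((N * m x + 2 * ‖x‖ ^ 2 * d x) * f x ^ 2 + 2 * m x * f x * radialPart g x) := by
    intro f g x
    simp only [hc₀, hc, radialPart, Finset.mul_sum, mul_add]
    congr 1
    · ring
    · refine Finset.sum_congr rfl fun k _ => ?_
      ring
  have hG : G = fun x => c₀ x * (u x * u x) + ∑ k, c k x * (u x * U k x) := by
    funext x
    rw [hpt]
  have hlim := t₀.add (tendsto_finsetSum Finset.univ fun k _ => tk k)
  refine ⟨hG ▸ (hsplit lu lU).1, ?_⟩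
  rw [hG, (hsplit lu lU).2]
  refine le_of_tendsto' hlim fun n => ?_
  have e := (hsplit (lv n) fun k => lV k n).2
  -- Monotonicity requires a `C¹` test function, so it is applied to `m v_n²` with `v_n` the
  -- mollification of `u`; the limit is taken in `L²`.
  change (∫ x, c₀ x * (v n x * v n x)) + ∑ k, ∫ x, c k x * (v n x * mollify n (U k) x) ≤ 0
  rw [← e]
  have hw : ContDiff ℝ 1 (fun x => m x * (v n x * v n x)) :=
    (hm.test.1.mul ((sv n).mul (sv n))).of_le (by norm_cast)
  have := hκ _ hw hm.test.2.mul_right (subset_univ _) fun x =>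
    mul_nonneg (hm0 x) (mul_self_nonneg _)
  refine le_of_eq_of_le (integral_congr_ae (Eventually.of_forall fun x => ?_)) this
  simp only [hpt]
  have dv : DifferentiableAt ℝ (v n) x := (sv n).differentiable (by norm_cast) x
  have dm : DifferentiableAt ℝ m x := hm.test.1.differentiable (by norm_cast) x
  rw [radialDiv_mul dm (dv.fun_mul dv), radialDiv_mul dv dv, hm.fderiv_self, radialDiv]
  have hr : radialPart (fun k => mollify n (U k)) x = fderiv ℝ (v n) x x := by
    rw [fderiv_apply_self_eq_sum, radialPart]
    refine Finset.sum_congr rfl fun k _ => ?_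
    rw [← partialDeriv_mollify n (hU k)]
    rfl
  rw [hr]
  ring

/-- The virial inequality. -/
theorem IsRealSolution.virial_le {K : ℝ} (hu : IsRealSolution κ u U H)
    (hκ : RadiallyMonotoneOn κ univ) (hκm : AEStronglyMeasurable κ) (hκb : ∀ᵐ x, ‖κ x‖ ≤ K)
    (hm : IsRadialTest m d) (hm0 : ∀ x, 0 ≤ m x) :
    let F := fun x => (m x - 2 * ‖x‖ ^ 2 * d x) * gradSq U x + 4 * d x * radialPart U x ^ 2
      + κ x * (m x + 2 * ‖x‖ ^ 2 * d x) * u x ^ 2 + 2 * (N - 1) * d x * u x * radialPart U x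
    Integrable F ∧ ∫ x, F x ≤ 0 := by
  intro F
  have hJ := hu.virial_identity hm
  have hG := hκ.integral_sq_le hκm hκb hm hm0 hu.memL2 hu.gradMemL2 hu.grad
  extract_lets J at hJ
  extract_lets G at hG
  -- The terms `κ m u x·∇u` cancel, so no derivative of `κ` is needed, and `N - (N - 1) = 1` copy of
  -- `κ m u²` survives.
  have e : F = fun x => J x + G x := by
    funext x
    simp only [F, J, G]
    ring
  rw [e]
  refine ⟨hJ.1.add hG.1, ?_⟩
  rw [integral_add hJ.1 hG.1, hJ.2, zero_add]
  exact hG.2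

/-- The flux of two real solutions through spheres vanishes. -/
theorem IsRealSolution.flux_eq_zero {a b : Space N → ℝ} {A B : Fin N → Space N → ℝ}
    {HA HB : Fin N → Fin N → Space N → ℝ} (ha : IsRealSolution κ a A HA)
    (hb : IsRealSolution κ b B HB) (hm : IsRadialTest m d) :
    Integrable (fun x => d x * (b x * radialPart A x - a x * radialPart B x)) ∧
    ∫ x, d x * (b x * radialPart A x - a x * radialPart B x) = 0 := by
  -- This is Green's identity for `m (b ∇a - a ∇b)`: the products of gradients cancel, and `b Δa = a
  -- Δb` because both functions solve the same equation. The factor `1 / 2` below comes from `∇m = 2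
  -- d x`.
  have h1 := fun j => integral_weakPartial_mul' (hb.grad j) (ha.hess j j) hb.memL2
    (ha.gradMemL2 j) (hb.gradMemL2 j) (ha.hessMemL2 j j) hm.test
  have h2 := fun j => integral_weakPartial_mul' (ha.grad j) (hb.hess j j) ha.memL2
    (hb.gradMemL2 j) (ha.gradMemL2 j) (hb.hessMemL2 j j) hm.test
  simp only [hm.partial_eq] at h1 h2
  set P : Fin N → Space N → ℝ := fun j x =>
    2 * d x * x j * (b x * A j x) + m x * (B j x * A j x) + m x * (b x * HA j j x) with hP
  set Q : Fin N → Space N → ℝ := fun j x =>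
    2 * d x * x j * (a x * B j x) + m x * (A j x * B j x) + m x * (a x * HB j j x) with hQ
  have i1 : ∀ j, Integrable (fun x => P j x - Q j x) := fun j => (h1 j).1.sub (h2 j).1
  have iS : Integrable (fun x => (1 / 2 : ℝ) * ∑ j, (P j x - Q j x)) :=
    (integrable_finsetSum _ fun j _ => i1 j).const_mul _
  have e : (fun x => (1 / 2 : ℝ) * ∑ j, (P j x - Q j x))
      =ᵐ[volume] fun x => d x * (b x * radialPart A x - a x * radialPart B x) := by
    filter_upwards [ha.eqn, hb.eqn] with x hxa hxb
    have : ∑ j, (P j x - Q j x) = 2 * d x * (b x * radialPart A x - a x * radialPart B x)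
        + m x * (b x * ∑ j, HA j j x - a x * ∑ j, HB j j x) := by
      simp only [hP, hQ, radialPart, Finset.mul_sum, ← Finset.sum_add_distrib,
        ← Finset.sum_sub_distrib]
      refine Finset.sum_congr rfl fun j _ => ?_
      ring
    rw [this, hxa, hxb]
    ring
  refine ⟨iS.congr e, ?_⟩
  rw [← integral_congr_ae e, integral_const_mul, integral_finsetSum _ fun j _ => i1 j,
    Finset.sum_eq_zero, mul_zero]
  intro j _
  rw [integral_sub (h1 j).1 (h2 j).1, (h1 j).2, (h2 j).2, sub_zero]

end ReducedWave

namespace ReducedWave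

open Filter Topology ContinuousLinearMap Metric

variable {N : ℕ}

/-! ### Radial weights -/

/-- The smooth cut-off function `χ(|x| / R)`. -/
noncomputable def radialCutoff {N : ℕ} (R : ℝ) (x : Space N) : ℝ :=
  Real.smoothTransition (2 - ‖x‖ ^ 2 / R ^ 2)

/-- `∇(radialCutoff R) = -2 radialCutoffSlope R (x) x`. -/
noncomputable def radialCutoffSlope {N : ℕ} (R : ℝ) (x : Space N) : ℝ :=
  deriv Real.smoothTransition (2 - ‖x‖ ^ 2 / R ^ 2) / R ^ 2

/-- The weight `(1 + ε² |x|²)^(-b)`. -/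
noncomputable def powWeight {N : ℕ} (b ε : ℝ) (x : Space N) : ℝ := (1 + ε ^ 2 * ‖x‖ ^ 2) ^ (-b)

/-- `∇(powWeight b ε) = -2 powWeightSlope b ε (x) x`. -/
noncomputable def powWeightSlope {N : ℕ} (b ε : ℝ) (x : Space N) : ℝ :=
  b * ε ^ 2 * (1 + ε ^ 2 * ‖x‖ ^ 2) ^ (-b - 1)

lemma hasFDerivAt_norm_sq (x : Space N) :
    HasFDerivAt (fun y : Space N => ‖y‖ ^ 2) (2 • innerSL ℝ x) x := by
  simpa using (hasFDerivAt_id (𝕜 := ℝ) x).norm_sq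

lemma partialDeriv_comp_norm_sq {g : ℝ → ℝ} {g' : ℝ} {x : Space N}
    (hg : HasDerivAt g g' (‖x‖ ^ 2)) (i : Fin N) :
    partialDeriv i (fun y : Space N => g (‖y‖ ^ 2)) x = 2 * g' * x i := by
  have h : HasFDerivAt (fun y : Space N => g (‖y‖ ^ 2)) _ x :=
    hg.comp_hasFDerivAt x (hasFDerivAt_norm_sq x)
  rw [partialDeriv, h.fderiv]
  simp [innerSL_apply_apply, EuclideanSpace.inner_single_right]
  ring

lemma one_add_pos (ε : ℝ) (x : Space N) : 0 < 1 + ε ^ 2 * ‖x‖ ^ 2 := by positivity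

lemma contDiff_radialCutoff (R : ℝ) : ContDiff ℝ ∞ (radialCutoff (N := N) R) :=
  (Real.smoothTransition.contDiff (n := ⊤)).comp
    (contDiff_const.sub ((contDiff_norm_sq ℝ).div_const _))

lemma contDiff_powWeight (b ε : ℝ) : ContDiff ℝ ∞ (powWeight (N := N) b ε) :=
  (contDiff_const.add (contDiff_const.mul (contDiff_norm_sq ℝ))).rpow_const_of_ne
    fun x => (one_add_pos ε x).ne'

lemma radialCutoff_nonneg (R : ℝ) (x : Space N) : 0 ≤ radialCutoff R x :=
  Real.smoothTransition.nonneg _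

lemma radialCutoff_eq_one {R : ℝ} (hR : 0 < R) {x : Space N} (hx : ‖x‖ ≤ R) :
    radialCutoff R x = 1 := by
  refine Real.smoothTransition.one_of_one_le ?_
  have : ‖x‖ ^ 2 / R ^ 2 ≤ 1 := by
    rw [div_le_one (by positivity)]
    gcongr
  linarith

lemma radialCutoffSlope_nonneg (R : ℝ) (x : Space N) : 0 ≤ radialCutoffSlope R x :=
  div_nonneg Real.smoothTransition.monotone.deriv_nonneg (by positivity)

lemma radialCutoffSlope_ne_zero {R : ℝ} (hR : 0 < R) {x : Space N}
    (hx : radialCutoffSlope R x ≠ 0) : R ≤ ‖x‖ ∧ ‖x‖ ≤ 2 * R := by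
  have h : 2 - ‖x‖ ^ 2 / R ^ 2 ∈ Icc (0 : ℝ) 1 := by
    by_contra h
    exact hx (by rw [radialCutoffSlope, deriv_smoothTransition_eq_zero h, zero_div])
  have h1 : 1 ≤ ‖x‖ ^ 2 / R ^ 2 := by linarith [h.2]
  have h2 : ‖x‖ ^ 2 / R ^ 2 ≤ 2 := by linarith [h.1]
  rw [le_div_iff₀ (by positivity)] at h1
  rw [div_le_iff₀ (by positivity)] at h2
  constructor
  · nlinarith [norm_nonneg x]
  · nlinarith [norm_nonneg x]

lemma continuous_radialCutoffSlope (R : ℝ) : Continuous (radialCutoffSlope (N := N) R) :=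
  ((((Real.smoothTransition.contDiff (n := 1)).continuous_deriv le_rfl).comp
    (by fun_prop : Continuous fun x : Space N => 2 - ‖x‖ ^ 2 / R ^ 2))).div_const _

lemma hasCompactSupport_radialCutoff {R : ℝ} (hR : 0 < R) :
    HasCompactSupport (radialCutoff (N := N) R) := by
  refine HasCompactSupport.intro (isCompact_closedBall (0 : Space N) (2 * R)) fun x hx => ?_
  refine Real.smoothTransition.zero_of_nonpos ?_
  have hx' : 2 * R < ‖x‖ := by simpa using hx
  have : 2 ≤ ‖x‖ ^ 2 / R ^ 2 := by
    rw [le_div_iff₀ (by positivity)]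
    nlinarith
  linarith

lemma hasCompactSupport_radialCutoffSlope {R : ℝ} (hR : 0 < R) :
    HasCompactSupport (radialCutoffSlope (N := N) R) := by
  refine HasCompactSupport.intro (isCompact_closedBall (0 : Space N) (2 * R)) fun x hx => ?_
  by_contra h
  exact hx (by simpa using (radialCutoffSlope_ne_zero hR h).2)

lemma continuous_powWeightSlope (b ε : ℝ) : Continuous (powWeightSlope (N := N) b ε) :=
  continuous_const.mul ((by fun_prop : Continuous fun x : Space N =>
    1 + ε ^ 2 * ‖x‖ ^ 2).rpow_const fun x => Or.inl (one_add_pos ε x).ne')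

lemma isRadialTest_radialCutoff {R : ℝ} (hR : 0 < R) :
    IsRadialTest (radialCutoff (N := N) R) (fun x => -radialCutoffSlope R x) where
  test := ⟨contDiff_radialCutoff R, hasCompactSupport_radialCutoff hR⟩
  cont := (continuous_radialCutoffSlope R).neg
  supp := (hasCompactSupport_radialCutoffSlope hR).neg
  partial_eq x i := by
    have h1 : HasDerivAt (fun t : ℝ => 2 - t / R ^ 2) (-(1 / R ^ 2)) (‖x‖ ^ 2) :=
      ((hasDerivAt_id _).div_const _).const_sub 2
    have h2 : HasDerivAt Real.smoothTransition _ (2 - ‖x‖ ^ 2 / R ^ 2) :=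
      ((Real.smoothTransition.contDiff (n := 1)).differentiable (by norm_num) _).hasDerivAt
    have h3 := HasDerivAt.comp (h := fun t : ℝ => 2 - t / R ^ 2) (‖x‖ ^ 2) h2 h1
    have := partialDeriv_comp_norm_sq h3 i
    rw [show radialCutoff (N := N) R = fun y => Real.smoothTransition (2 - ‖y‖ ^ 2 / R ^ 2) from rfl]
    refine this.trans ?_
    rw [radialCutoffSlope]
    ring

lemma partialDeriv_powWeight (b ε : ℝ) (x : Space N) (i : Fin N) :
    partialDeriv i (powWeight b ε) x = 2 * -powWeightSlope b ε x * x i := by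
  have h1 : HasDerivAt (fun t : ℝ => 1 + ε ^ 2 * t) (ε ^ 2) (‖x‖ ^ 2) := by
    simpa using ((hasDerivAt_id (‖x‖ ^ 2)).const_mul (ε ^ 2)).const_add 1
  have h3 := h1.rpow_const (p := -b) (Or.inl (one_add_pos ε x).ne')
  have := partialDeriv_comp_norm_sq h3 i
  rw [show powWeight (N := N) b ε = fun y => (1 + ε ^ 2 * ‖y‖ ^ 2) ^ (-b) from rfl, this,
    powWeightSlope]
  ring

lemma isRadialTest_mul {R : ℝ} (hR : 0 < R) (b ε : ℝ) :
    IsRadialTest (fun x : Space N => radialCutoff R x * powWeight b ε x)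
      (fun x => -(radialCutoffSlope R x * powWeight b ε x
        + radialCutoff R x * powWeightSlope b ε x)) where
  test := ⟨(contDiff_radialCutoff R).mul (contDiff_powWeight b ε),
    (hasCompactSupport_radialCutoff hR).mul_right⟩
  cont := (((continuous_radialCutoffSlope R).mul (contDiff_powWeight b ε).continuous).add
    ((contDiff_radialCutoff R).continuous.mul (continuous_powWeightSlope b ε))).neg
  supp := ((hasCompactSupport_radialCutoffSlope hR).mul_right.add
    (hasCompactSupport_radialCutoff hR).mul_right).neg
  partial_eq x i := by
    rw [partialDeriv_mul ((contDiff_radialCutoff R).differentiable (by norm_cast) x)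
      ((contDiff_powWeight b ε).differentiable (by norm_cast) x),
      (isRadialTest_radialCutoff hR).partial_eq, partialDeriv_powWeight]
    ring

lemma powWeight_pos (b ε : ℝ) (x : Space N) : 0 < powWeight b ε x :=
  Real.rpow_pos_of_pos (one_add_pos ε x) _

lemma powWeightSlope_eq (b ε : ℝ) (x : Space N) :
    powWeightSlope b ε x = b * ε ^ 2 * (powWeight b ε x / (1 + ε ^ 2 * ‖x‖ ^ 2)) := by
  rw [powWeightSlope, powWeight, Real.rpow_sub_one (one_add_pos ε x).ne']

lemma powWeightSlope_nonneg {b : ℝ} (hb : 0 ≤ b) (ε : ℝ) (x : Space N) :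
    0 ≤ powWeightSlope b ε x :=
  mul_nonneg (by positivity) (Real.rpow_nonneg (one_add_pos ε x).le _)

/-- By `2 ε |x| ≤ 1 + ε² |x|²`. The small factor `ε` serves to absorb the term `(N - 1) d u x·∇u` of
the virial inequality. -/
lemma powWeightSlope_mul_norm_le {b ε : ℝ} (hb1 : b ≤ 1) (hε : 0 ≤ ε) (x : Space N) :
    powWeightSlope b ε x * ‖x‖ ≤ ε / 2 * powWeight b ε x := by
  have hq := one_add_pos ε x
  have hψ := powWeight_pos b ε x
  rw [powWeightSlope_eq]
  have h : b * ε ^ 2 * ‖x‖ ≤ ε / 2 * (1 + ε ^ 2 * ‖x‖ ^ 2) := by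
    have h1 : b * (ε ^ 2 * ‖x‖) ≤ 1 * (ε ^ 2 * ‖x‖) := by gcongr
    nlinarith [mul_nonneg hε (sq_nonneg (ε * ‖x‖ - 1))]
  calc b * ε ^ 2 * (powWeight b ε x / (1 + ε ^ 2 * ‖x‖ ^ 2)) * ‖x‖
      = (b * ε ^ 2 * ‖x‖) * powWeight b ε x / (1 + ε ^ 2 * ‖x‖ ^ 2) := by ring
    _ ≤ (ε / 2 * (1 + ε ^ 2 * ‖x‖ ^ 2)) * powWeight b ε x / (1 + ε ^ 2 * ‖x‖ ^ 2) := by gcongr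
    _ = ε / 2 * powWeight b ε x := by field_simp

/-- The loss from differentiating the weight is at most the fraction `2 b`; this is where `b < 1/2`,
hence `δ > 1/2`, is felt. -/
lemma powWeight_lower {b : ℝ} (hb : 0 ≤ b) (ε : ℝ) (x : Space N) :
    (1 - 2 * b) * powWeight b ε x
      ≤ powWeight b ε x - 2 * ‖x‖ ^ 2 * powWeightSlope b ε x := by
  have hq := one_add_pos ε x
  have hψ := powWeight_pos b ε x
  rw [powWeightSlope_eq]
  have h : ε ^ 2 * ‖x‖ ^ 2 * (powWeight b ε x / (1 + ε ^ 2 * ‖x‖ ^ 2)) ≤ powWeight b ε x := by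
    rw [← mul_div_assoc, div_le_iff₀ hq]
    nlinarith
  nlinarith

lemma powWeight_le {b ε R : ℝ} (hb : 0 ≤ b) (hR : 0 ≤ R) {x : Space N} (hx : R ≤ ‖x‖) :
    powWeight b ε x ≤ (1 + ε ^ 2 * R ^ 2) ^ (-b) := by
  apply Real.rpow_le_rpow_of_nonpos (by positivity) _ (by linarith)
  gcongr

/-- For `‖x‖ ≤ 2 R` and `R ≥ 1` one has `1 + ‖x‖ ≤ 3 R`, whence the `9`; and `-2 b ≤ 2 (δ - 1)`
compares the exponents. -/
lemma rpow_le_weight {b ε R δ : ℝ} (hb : 0 ≤ b) (hbδ : 1 - δ ≤ b) (hε : 0 < ε) (hR : 1 ≤ R)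
    {x : Space N} (hx : ‖x‖ ≤ 2 * R) :
    (1 + ε ^ 2 * R ^ 2) ^ (-b) ≤ (9 / ε ^ 2) ^ b * (1 + ‖x‖) ^ (2 * (δ - 1)) := by
  have h0 : 0 ≤ ‖x‖ := norm_nonneg x
  have h1 : (1 + ‖x‖) ^ (-(2 * b)) ≤ (1 + ‖x‖) ^ (2 * (δ - 1)) :=
    Real.rpow_le_rpow_of_exponent_le (by linarith) (by linarith)
  have h2 : (1 + ‖x‖) ^ 2 ≤ 9 / ε ^ 2 * (1 + ε ^ 2 * R ^ 2) := by
    have : 9 / ε ^ 2 * (1 + ε ^ 2 * R ^ 2) = 9 / ε ^ 2 + 9 * R ^ 2 := by field_simp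
    rw [this]
    have : 0 < 9 / ε ^ 2 := by positivity
    nlinarith
  have h3 : (9 / ε ^ 2 * (1 + ε ^ 2 * R ^ 2)) ^ (-b) ≤ ((1 + ‖x‖) ^ 2) ^ (-b) :=
    Real.rpow_le_rpow_of_nonpos (by positivity) h2 (by linarith)
  have h4 : ((1 + ‖x‖) ^ 2) ^ (-b) = (1 + ‖x‖) ^ (-(2 * b)) := by
    rw [← Real.rpow_natCast, ← Real.rpow_mul (by linarith)]
    congr 1
    push_cast
    ring
  have hpos : 0 < (9 / ε ^ 2 : ℝ) := by positivity
  rw [Real.mul_rpow hpos.le (by positivity), h4] at h3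
  calc (1 + ε ^ 2 * R ^ 2) ^ (-b)
      = (9 / ε ^ 2) ^ b * ((9 / ε ^ 2) ^ (-b) * (1 + ε ^ 2 * R ^ 2) ^ (-b)) := by
        rw [← mul_assoc, ← Real.rpow_add hpos]
        simp
    _ ≤ (9 / ε ^ 2) ^ b * (1 + ‖x‖) ^ (2 * (δ - 1)) := by
        gcongr
        exact h3.trans h1

lemma radialPart_sq_le (U : Fin N → Space N → ℝ) (x : Space N) :
    radialPart U x ^ 2 ≤ ‖x‖ ^ 2 * gradSq U x := by
  rw [norm_sq_eq_sum]
  exact Finset.sum_mul_sq_le_sq_mul_sq _ _ _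

/-! ### Pointwise estimates -/

/-- Here `r = |x|`, `E = |∇u|²`, `S = x·∇u`, `n = N - 1`. Cauchy–Schwarz `S² ≤ r² E` turns the
gradient terms into at least `(ψ - 2 r² θ) E ≥ a ψ E`. The mixed term is at most half of `a ψ (E +
k₀ u²)` because `n ε` is small, and the other half is kept. -/
lemma bulk_estimate {ψ θ r E S u κ k₀ a ε n : ℝ} (hψ : 0 < ψ) (hθ : 0 ≤ θ) (hr : 0 ≤ r)
    (hE : 0 ≤ E) (hS : S ^ 2 ≤ r ^ 2 * E) (hn : 0 ≤ n) (hk₀ : 0 ≤ k₀) (hκ : k₀ ≤ κ) (ha : 0 ≤ a)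
    (h1 : a * ψ ≤ ψ - 2 * r ^ 2 * θ) (h2 : θ * r ≤ ε / 2 * ψ) (hε1 : n * ε ≤ a)
    (hε2 : n * ε ≤ a * k₀) :
    a / 2 * k₀ * ψ * u ^ 2 ≤ (ψ + 2 * r ^ 2 * θ) * E - 4 * θ * S ^ 2
      + κ * (ψ - 2 * r ^ 2 * θ) * u ^ 2 - 2 * n * θ * u * S := by
  have hS2 : 2 * (u * S) ≤ r * (u ^ 2 + E) := by
    apply le_of_abs_le
    apply abs_le_of_sq_le_sq _ (by positivity)
    nlinarith [mul_le_mul_of_nonneg_left hS (sq_nonneg u), mul_nonneg (sq_nonneg r)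
      (sq_nonneg (u ^ 2 - E))]
  have e1 : n * θ * (2 * (u * S)) ≤ n * ε / 2 * ψ * (u ^ 2 + E) := by
    calc n * θ * (2 * (u * S)) ≤ n * θ * (r * (u ^ 2 + E)) := by gcongr
      _ = n * (θ * r) * (u ^ 2 + E) := by ring
      _ ≤ n * (ε / 2 * ψ) * (u ^ 2 + E) := by gcongr
      _ = _ := by ring
  have e2 : n * ε / 2 * ψ * (u ^ 2 + E) ≤ a / 2 * ψ * (k₀ * u ^ 2 + E) := by
    have : n * ε * (u ^ 2 + E) ≤ a * (k₀ * u ^ 2 + E) := by nlinarith [sq_nonneg u]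
    nlinarith
  have e3 : (ψ - 2 * r ^ 2 * θ) * E ≤ (ψ + 2 * r ^ 2 * θ) * E - 4 * θ * S ^ 2 := by
    nlinarith
  have e4 : a * ψ * (E + k₀ * u ^ 2) ≤ (ψ - 2 * r ^ 2 * θ) * (E + κ * u ^ 2) := by
    have : 0 ≤ a * ψ := by positivity
    apply mul_le_mul h1 _ (by positivity) (this.trans h1)
    gcongr
  have e5 : 0 ≤ a * ψ * E := by positivity
  nlinarith

/-- The term with `E` has the good sign and is dropped; only the radial derivative `S` and `u`
remain, which are what the radiation condition controls. -/
lemma boundary_estimate {h r E S u κ K n : ℝ} (hh : 0 ≤ h) (hE : 0 ≤ E) (hr : 1 ≤ r)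
    (hn : 0 ≤ n) (hκ : κ ≤ K) (hK : 0 ≤ K) :
    -(h * ((n + 4 + 2 * K) * (S ^ 2 + r ^ 2 * u ^ 2)))
      ≤ h * (2 * r ^ 2 * E - 4 * S ^ 2 - 2 * r ^ 2 * κ * u ^ 2 - 2 * n * u * S) := by
  rw [← mul_neg]
  apply mul_le_mul_of_nonneg_left _ hh
  have h1 : 2 * u * S ≤ S ^ 2 + r ^ 2 * u ^ 2 := by
    have : u ^ 2 ≤ r ^ 2 * u ^ 2 := le_mul_of_one_le_left (sq_nonneg u) (by nlinarith)
    nlinarith [sq_nonneg (u - S)]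
  have h2 : 0 ≤ r ^ 2 * E := by positivity
  have h3 : r ^ 2 * u ^ 2 * κ ≤ r ^ 2 * u ^ 2 * K := by gcongr
  have h4 : 0 ≤ S ^ 2 * K := by positivity
  have h5 : n * (2 * u * S) ≤ n * (S ^ 2 + r ^ 2 * u ^ 2) := by gcongr
  nlinarith [sq_nonneg S, mul_nonneg (sq_nonneg r) (sq_nonneg u)]

/-- The cross terms in the two squares are `2 s k` times a flux density, so division by `k` leaves
the flux with a constant coefficient although `k` varies. Subtracting it leaves `(X + μ a)² / k + k
a²` and its analogue for `b`, which control `X`, `Y`, `a`, `b`. -/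
lemma radiation_estimate {r k k₁ k₂ μ ν s A B a b : ℝ} (hr : 1 ≤ r) (hk₁ : 0 < k₁) (hk : k₁ ≤ k)
    (hk₂ : k ≤ k₂) (hμ : 0 ≤ μ) (hμν : μ ≤ ν) (hs : s ^ 2 = 1) :
    A ^ 2 + r ^ 2 * a ^ 2 + (B ^ 2 + r ^ 2 * b ^ 2)
      ≤ (2 * k₂ + (2 * ν ^ 2 + 1) / k₁) * r *
        (r * ((A / r + μ * a + s * k * b) ^ 2 + (B / r + μ * b - s * k * a) ^ 2) / k
          - 2 * s * (b * A - a * B)) := by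
  have hr0 : 0 < r := by linarith
  have hk0 : 0 < k := by linarith
  obtain ⟨X, rfl⟩ : ∃ X, A = r * X := ⟨A / r, by field_simp⟩
  obtain ⟨Y, rfl⟩ : ∃ Y, B = r * Y := ⟨B / r, by field_simp⟩
  rw [mul_div_cancel_left₀ _ hr0.ne', mul_div_cancel_left₀ _ hr0.ne']
  have e : r * ((X + μ * a + s * k * b) ^ 2 + (Y + μ * b - s * k * a) ^ 2) / k
      - 2 * s * (b * (r * X) - a * (r * Y))
      = r * (((X + μ * a) ^ 2 / k + k * a ^ 2) + ((Y + μ * b) ^ 2 / k + k * b ^ 2)) := by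
    field_simp
    ring_nf
    rw [hs]
    ring
  rw [e]
  have key : ∀ X a : ℝ, X ^ 2 + a ^ 2
      ≤ (2 * k₂ + (2 * ν ^ 2 + 1) / k₁) * ((X + μ * a) ^ 2 / k + k * a ^ 2) := by
    intro X a
    have t1 : X ^ 2 ≤ 2 * (X + μ * a) ^ 2 + 2 * ν ^ 2 * a ^ 2 := by
      have : μ ^ 2 * a ^ 2 ≤ ν ^ 2 * a ^ 2 := by gcongr
      nlinarith [sq_nonneg (X + 2 * μ * a)]
    have t2 : (X + μ * a) ^ 2 ≤ k₂ * ((X + μ * a) ^ 2 / k) := by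
      rw [← mul_div_assoc, le_div_iff₀ hk0, mul_comm]
      gcongr
    have t3 : a ^ 2 ≤ 1 / k₁ * (k * a ^ 2) := by
      rw [one_div, ← div_eq_inv_mul, le_div_iff₀ hk₁, mul_comm]
      gcongr
    have p1 : 0 ≤ (X + μ * a) ^ 2 / k := by positivity
    have p2 : 0 ≤ k * a ^ 2 := by positivity
    have p3 : 0 ≤ (2 * ν ^ 2 + 1) / k₁ := by positivity
    have p4 : 0 ≤ k₂ := by linarith
    calc X ^ 2 + a ^ 2 ≤ 2 * (X + μ * a) ^ 2 + (2 * ν ^ 2 + 1) * a ^ 2 := by linarith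
      _ ≤ 2 * (k₂ * ((X + μ * a) ^ 2 / k)) + (2 * ν ^ 2 + 1) * (1 / k₁ * (k * a ^ 2)) := by gcongr
      _ = 2 * k₂ * ((X + μ * a) ^ 2 / k) + (2 * ν ^ 2 + 1) / k₁ * (k * a ^ 2) := by ring
      _ ≤ _ := by nlinarith [mul_nonneg p4 p2, mul_nonneg p3 p1]
  have k1 := key X a
  have k2 := key Y b
  calc (r * X) ^ 2 + r ^ 2 * a ^ 2 + ((r * Y) ^ 2 + r ^ 2 * b ^ 2)
      = r * r * ((X ^ 2 + a ^ 2) + (Y ^ 2 + b ^ 2)) := by ring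
    _ ≤ r * r * ((2 * k₂ + (2 * ν ^ 2 + 1) / k₁) * ((X + μ * a) ^ 2 / k + k * a ^ 2)
        + (2 * k₂ + (2 * ν ^ 2 + 1) / k₁) * ((Y + μ * b) ^ 2 / k + k * b ^ 2)) := by gcongr
    _ = _ := by ring

end ReducedWave

namespace ReducedWave

open Filter Topology ContinuousLinearMap Metric

variable {N : ℕ}

/-! ### Uniqueness for real systems -/

/-- The integrand of the virial inequality `IsRealSolution.virial_le`. -/
noncomputable def virialDensity {N : ℕ} (κ m d u : Space N → ℝ) (U : Fin N → Space N → ℝ) (x : Space N) : ℝ :=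
  (m x - 2 * ‖x‖ ^ 2 * d x) * gradSq U x + 4 * d x * radialPart U x ^ 2
    + κ x * (m x + 2 * ‖x‖ ^ 2 * d x) * u x ^ 2 + 2 * (N - 1) * d x * u x * radialPart U x

/-- `|D_r^{(s)} (α + i β)|²` in terms of the gradients `A`, `B` of `α`, `β`. -/
noncomputable def radiationSq {N : ℕ} (κ : Space N → ℝ) (s : ℝ) (α : Space N → ℝ)
    (A : Fin N → Space N → ℝ) (β : Space N → ℝ) (B : Fin N → Space N → ℝ) (x : Space N) : ℝ :=
  (radialPart A x / ‖x‖ + (N - 1) / (2 * ‖x‖) * α x + s * √(κ x) * β x) ^ 2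
    + (radialPart B x / ‖x‖ + (N - 1) / (2 * ‖x‖) * β x - s * √(κ x) * α x) ^ 2

lemma gradSq_nonneg (U : Fin N → Space N → ℝ) (x : Space N) : 0 ≤ gradSq U x :=
  Finset.sum_nonneg fun _ _ => sq_nonneg _

/-- The slope of `χ_R ψ` splits into one term with `ψ` differentiated, treated by `bulk_estimate`,
and one with `χ_R` differentiated, treated by `boundary_estimate`. -/
lemma le_virialDensity {κ u : Space N → ℝ} {U : Fin N → Space N → ℝ} {k₀ K a b ε R : ℝ}
    {x : Space N} (hN : 1 ≤ N) (hk₀ : 0 ≤ k₀) (hκ : k₀ ≤ κ x) (hK : κ x ≤ K) (ha : 0 ≤ a)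
    (hab : a ≤ 1 - 2 * b) (hb : 0 ≤ b) (hb1 : b ≤ 1) (hε : 0 ≤ ε) (hε1 : (N - 1) * ε ≤ a)
    (hε2 : (N - 1) * ε ≤ a * k₀) (hR : 1 ≤ R) :
    a / 2 * k₀ * (radialCutoff R x * powWeight b ε x * u x ^ 2)
        - powWeight b ε x * (radialCutoffSlope R x
          * ((N + 3 + 2 * K) * (radialPart U x ^ 2 + ‖x‖ ^ 2 * u x ^ 2)))
      ≤ virialDensity κ (fun x => radialCutoff R x * powWeight b ε x)
        (fun x => -(radialCutoffSlope R x * powWeight b ε x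
          + radialCutoff R x * powWeightSlope b ε x)) u U x := by
  have hn : (0 : ℝ) ≤ N - 1 := by
    have : (1 : ℝ) ≤ N := by exact_mod_cast hN
    linarith
  have hψ := powWeight_pos b ε x
  have h1 := bulk_estimate (u := u x) hψ (powWeightSlope_nonneg hb ε x) (norm_nonneg x)
    (gradSq_nonneg U x) (radialPart_sq_le U x) hn hk₀ hκ ha
    ((mul_le_mul_of_nonneg_right hab hψ.le).trans (powWeight_lower hb ε x))
    (powWeightSlope_mul_norm_le hb1 hε x) hε1 hε2
  have h2 : -(radialCutoffSlope R x
        * (((N - 1 : ℝ) + 4 + 2 * K) * (radialPart U x ^ 2 + ‖x‖ ^ 2 * u x ^ 2)))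
      ≤ radialCutoffSlope R x * (2 * ‖x‖ ^ 2 * gradSq U x - 4 * radialPart U x ^ 2
        - 2 * ‖x‖ ^ 2 * κ x * u x ^ 2 - 2 * (N - 1 : ℝ) * u x * radialPart U x) := by
    by_cases h0 : radialCutoffSlope R x = 0
    · simp [h0]
    · exact boundary_estimate (radialCutoffSlope_nonneg R x) (gradSq_nonneg U x)
        (hR.trans (radialCutoffSlope_ne_zero (by linarith) h0).1) hn hK (hk₀.trans (hκ.trans hK))
  have h3 := mul_le_mul_of_nonneg_left h1 (radialCutoff_nonneg R x)
  have h4 := mul_le_mul_of_nonneg_left h2 hψ.le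
  unfold virialDensity
  linarith

lemma radiationSq_nonneg {κ α β : Space N → ℝ} {A B : Fin N → Space N → ℝ} {s : ℝ}
    (x : Space N) : 0 ≤ radiationSq κ s α A β B x := by
  unfold radiationSq
  positivity

/-- The terms produced by the gradient of the cut-off are controlled by the radiation condition,
up to a multiple of the flux through spheres. -/
lemma cutoff_term_le {κ α β : Space N → ℝ} {A B : Fin N → Space N → ℝ} {s k₀ K Q CT R b ε δ : ℝ}
    (hN : 1 ≤ N) (hk₀ : 0 < k₀) (hQ : 0 ≤ Q) (hs : s ^ 2 = 1)
    (hCT : ∀ t, |deriv Real.smoothTransition t| ≤ CT) (hR : 1 ≤ R) (hb : 0 ≤ b)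
    (hbδ : 1 - δ ≤ b) (hε : 0 < ε) {x : Space N} (hκ : k₀ ≤ κ x) (hK : κ x ≤ K) :
    powWeight b ε x * (radialCutoffSlope R x
        * (Q * (radialPart A x ^ 2 + ‖x‖ ^ 2 * α x ^ 2
          + (radialPart B x ^ 2 + ‖x‖ ^ 2 * β x ^ 2))))
      ≤ 2 * s * (2 * R * Q * (2 * √K + (2 * ((N - 1) / 2) ^ 2 + 1) / √k₀)
            * (1 + ε ^ 2 * R ^ 2) ^ (-b))
          * (-radialCutoffSlope R x * (β x * radialPart A x - α x * radialPart B x))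
        + 4 * Q * (2 * √K + (2 * ((N - 1) / 2) ^ 2 + 1) / √k₀) * CT / √k₀ * (9 / ε ^ 2) ^ b
          * {y : Space N | R ≤ ‖y‖}.indicator
            (fun y => (1 + ‖y‖) ^ (2 * (δ - 1)) * radiationSq κ s α A β B y) x := by
  have hn : (0 : ℝ) ≤ N - 1 := by
    have : (1 : ℝ) ≤ N := by exact_mod_cast hN
    linarith
  have hk1 : 0 < √k₀ := Real.sqrt_pos.2 hk₀
  have hCT0 : 0 ≤ CT := (abs_nonneg _).trans (hCT 0)
  set C₁ : ℝ := 2 * √K + (2 * ((N - 1) / 2) ^ 2 + 1) / √k₀ with hC₁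
  have hC₁0 : 0 < C₁ := by positivity
  have hD := radiationSq_nonneg (κ := κ) (s := s) (α := α) (A := A) (β := β) (B := B) x
  have hI : 0 ≤ {y : Space N | R ≤ ‖y‖}.indicator
      (fun y => (1 + ‖y‖) ^ (2 * (δ - 1)) * radiationSq κ s α A β B y) x :=
    indicator_nonneg (fun y _ => mul_nonneg (Real.rpow_nonneg (by positivity) _)
      (radiationSq_nonneg y)) x
  by_cases h0 : radialCutoffSlope R x = 0
  · rw [h0]
    simp only [zero_mul, mul_zero, neg_zero, zero_add]
    positivity
  obtain ⟨hx1, hx2⟩ := radialCutoffSlope_ne_zero (by linarith) h0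
  have hr1 : 1 ≤ ‖x‖ := hR.trans hx1
  have hh := radialCutoffSlope_nonneg R x
  have hψ := powWeight_pos b ε x
  have hrad := radiation_estimate (A := radialPart A x) (B := radialPart B x) (a := α x)
    (b := β x) hr1 hk1 (Real.sqrt_le_sqrt hκ) (Real.sqrt_le_sqrt hK)
    (show 0 ≤ ((N : ℝ) - 1) / (2 * ‖x‖) by positivity)
    (show ((N : ℝ) - 1) / (2 * ‖x‖) ≤ (N - 1) / 2 by
      apply div_le_div_of_nonneg_left hn (by norm_num)
      linarith) hs
  rw [← hC₁] at hrad
  set Z := ‖x‖ * ((radialPart A x / ‖x‖ + (N - 1) / (2 * ‖x‖) * α x + s * √(κ x) * β x) ^ 2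
    + (radialPart B x / ‖x‖ + (N - 1) / (2 * ‖x‖) * β x - s * √(κ x) * α x) ^ 2) / √(κ x)
    - 2 * s * (β x * radialPart A x - α x * radialPart B x) with hZ
  have hZ' : Z = ‖x‖ * radiationSq κ s α A β B x / √(κ x)
      - 2 * s * (β x * radialPart A x - α x * radialPart B x) := rfl
  set T := radialPart A x ^ 2 + ‖x‖ ^ 2 * α x ^ 2
    + (radialPart B x ^ 2 + ‖x‖ ^ 2 * β x ^ 2) with hT
  have hT0 : 0 ≤ T := by positivity
  -- `Z` contains the flux with a sign, but it is nonnegative because it dominates `T`; so its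
  -- coefficients may be increased.
  have hZ0 : 0 ≤ Z := by
    by_contra hneg
    push Not at hneg
    have : C₁ * ‖x‖ * Z < 0 := mul_neg_of_pos_of_neg (by positivity) hneg
    linarith
  set P : ℝ := (1 + ε ^ 2 * R ^ 2) ^ (-b) with hP
  have hP0 : 0 ≤ P := Real.rpow_nonneg (by positivity) _
  have hψP : powWeight b ε x ≤ P := powWeight_le hb (by linarith) hx1
  have hPw : P ≤ (9 / ε ^ 2) ^ b * (1 + ‖x‖) ^ (2 * (δ - 1)) :=
    rpow_le_weight hb hbδ hε hR hx2
  have hhR : radialCutoffSlope R x ≤ CT / R ^ 2 := by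
    unfold radialCutoffSlope
    gcongr
    exact (le_abs_self _).trans (hCT _)
  have hmem : x ∈ {y : Space N | R ≤ ‖y‖} := hx1
  rw [indicator_of_mem hmem]
  -- Replacing `ψ` and `‖x‖` by the constants `P` and `2 R` makes the coefficient of the flux
  -- independent of `x`, so that its integral will vanish.
  have e1 : powWeight b ε x * (radialCutoffSlope R x * (Q * T))
      ≤ P * (radialCutoffSlope R x * (Q * (C₁ * (2 * R) * Z))) := by
    have : T ≤ C₁ * (2 * R) * Z := hrad.trans (by gcongr)
    gcongr
  -- The two factors `2 R` cancel the `R²` in the bound for the slope of the cut-off, so the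
  -- constant does not depend on `R`.
  have e2 : P * (radialCutoffSlope R x * (Q * (C₁ * (2 * R)
        * (‖x‖ * radiationSq κ s α A β B x / √(κ x)))))
      ≤ 4 * Q * C₁ * CT / √k₀ * (9 / ε ^ 2) ^ b
        * ((1 + ‖x‖) ^ (2 * (δ - 1)) * radiationSq κ s α A β B x) := by
    have hk2 : √k₀ ≤ √(κ x) := Real.sqrt_le_sqrt hκ
    calc P * (radialCutoffSlope R x * (Q * (C₁ * (2 * R)
            * (‖x‖ * radiationSq κ s α A β B x / √(κ x)))))
        ≤ ((9 / ε ^ 2) ^ b * (1 + ‖x‖) ^ (2 * (δ - 1))) * (CT / R ^ 2 * (Q * (C₁ * (2 * R)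
            * ((2 * R) * radiationSq κ s α A β B x / √k₀)))) := by gcongr
      _ = _ := by
        have : R ≠ 0 := by positivity
        field_simp
        ring
  have e3 : P * (radialCutoffSlope R x * (Q * (C₁ * (2 * R) * Z)))
      = P * (radialCutoffSlope R x * (Q * (C₁ * (2 * R)
        * (‖x‖ * radiationSq κ s α A β B x / √(κ x)))))
        + 2 * s * (2 * R * Q * C₁ * P)
          * (-radialCutoffSlope R x * (β x * radialPart A x - α x * radialPart B x)) := by
    rw [hZ']
    ring
  linarith

/-- The weighted `L²` norm over a ball is controlled by the tail of the radiation integral. -/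
lemma integral_cutoff_le {κ α β : Space N → ℝ} {A B : Fin N → Space N → ℝ}
    {HA HB : Fin N → Fin N → Space N → ℝ} {s k₀ K CT R a b ε δ : ℝ}
    (hα : IsRealSolution κ α A HA) (hβ : IsRealSolution κ β B HB)
    (hκr : RadiallyMonotoneOn κ univ) (hκm : AEStronglyMeasurable κ)
    (hκb : ∀ᵐ x, k₀ ≤ κ x ∧ κ x ≤ K)
    (hN : 1 ≤ N) (hk₀ : 0 < k₀) (hK : 0 ≤ K) (hs : s ^ 2 = 1)
    (hCT : ∀ t, |deriv Real.smoothTransition t| ≤ CT) (hR : 1 ≤ R) (ha : 0 ≤ a)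
    (hab : a ≤ 1 - 2 * b) (hb : 0 ≤ b) (hb1 : b ≤ 1)
    (hbδ : 1 - δ ≤ b) (hε : 0 < ε) (hε1 : (N - 1) * ε ≤ a)
    (hε2 : (N - 1) * ε ≤ a * k₀)
    (hW : IntegrableOn (fun x => (1 + ‖x‖) ^ (2 * (δ - 1)) * radiationSq κ s α A β B x)
      {x : Space N | R ≤ ‖x‖}) :
    a / 2 * k₀ * ∫ x, radialCutoff R x * powWeight b ε x * (α x ^ 2 + β x ^ 2)
      ≤ 4 * (N + 3 + 2 * K) * (2 * √K + (2 * ((N - 1) / 2) ^ 2 + 1) / √k₀) * CT / √k₀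
          * (9 / ε ^ 2) ^ b
        * ∫ x in {x : Space N | R ≤ ‖x‖},
          (1 + ‖x‖) ^ (2 * (δ - 1)) * radiationSq κ s α A β B x := by
  have hR0 : 0 < R := by linarith
  have hκn : ∀ᵐ x, ‖κ x‖ ≤ K := by
    filter_upwards [hκb] with x hx
    rw [Real.norm_of_nonneg (hk₀.le.trans hx.1)]
    exact hx.2
  have hm0 : ∀ x : Space N, 0 ≤ radialCutoff R x * powWeight b ε x := fun x =>
    mul_nonneg (radialCutoff_nonneg R x) (powWeight_pos b ε x).le
  have hm := isRadialTest_mul (N := N) hR0 b ε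
  have vα : Integrable (virialDensity κ _ _ α A) ∧ ∫ x, virialDensity κ _ _ α A x ≤ 0 :=
    hα.virial_le hκr hκm hκn hm hm0
  have vβ : Integrable (virialDensity κ _ _ β B) ∧ ∫ x, virialDensity κ _ _ β B x ≤ 0 :=
    hβ.virial_le hκr hκm hκn hm hm0
  obtain ⟨f1, f2⟩ := hα.flux_eq_zero hβ (isRadialTest_radialCutoff (N := N) hR0)
  have hRm : MeasurableSet {x : Space N | R ≤ ‖x‖} := measurableSet_le measurable_const
    measurable_norm
  have hmt := hm.test
  have iα : Integrable fun x => radialCutoff R x * powWeight b ε x * (α x * α x) :=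
    integrable_testFunction_mul_mul hmt.1.continuous hmt.2 hα.memL2 hα.memL2
  have iβ : Integrable fun x => radialCutoff R x * powWeight b ε x * (β x * β x) :=
    integrable_testFunction_mul_mul hmt.1.continuous hmt.2 hβ.memL2 hβ.memL2
  have iαβ : Integrable fun x => radialCutoff R x * powWeight b ε x * (α x ^ 2 + β x ^ 2) := by
    refine (iα.add iβ).congr (Eventually.of_forall fun x => ?_)
    simp only [Pi.add_apply]
    ring
  rw [← integral_const_mul, ← integral_indicator hRm, ← integral_const_mul]
  set C : ℝ := 4 * (N + 3 + 2 * K) * (2 * √K + (2 * ((N - 1) / 2) ^ 2 + 1) / √k₀) * CT / √k₀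
          * (9 / ε ^ 2) ^ b with hC
  set c : ℝ := 2 * s * (2 * R * (N + 3 + 2 * K)
    * (2 * √K + (2 * ((N - 1) / 2) ^ 2 + 1) / √k₀) * (1 + ε ^ 2 * R ^ 2) ^ (-b)) with hc
  have iW := (hW.integrable_indicator hRm).const_mul C
  have iV := (vα.1.add vβ.1).add (f1.const_mul c)
  have hle := integral_mono_ae (iαβ.const_mul (a / 2 * k₀)) (iV.add iW) (by
    filter_upwards [hκb] with x hx
    have t1 := le_virialDensity (u := α) (U := A) hN hk₀.le hx.1 hx.2 ha hab hb hb1 hε.le hε1 hε2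
      hR
    have t2 := le_virialDensity (u := β) (U := B) hN hk₀.le hx.1 hx.2 ha hab hb hb1 hε.le hε1 hε2
      hR
    have t3 := cutoff_term_le (α := α) (β := β) (A := A) (B := B) (δ := δ) hN hk₀
      (show (0 : ℝ) ≤ N + 3 + 2 * K by positivity) hs hCT hR hb hbδ hε hx.1 hx.2
    rw [← hc, ← hC] at t3
    simp only [Pi.add_apply]
    linarith)
  refine hle.trans ?_
  simp only [Pi.add_apply]
  -- The virial integrals are nonpositive and the flux integral is zero; only the radiation tail is
  -- left.
  rw [integral_add (by exact iV) iW, integral_add (by exact vα.1.add vβ.1) (f1.const_mul c),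
    integral_add vα.1 vβ.1, integral_const_mul c, f2]
  linarith [vα.2, vβ.2]

theorem ae_eq_zero_of_radiation {κ α β : Space N → ℝ} {A B : Fin N → Space N → ℝ}
    {HA HB : Fin N → Fin N → Space N → ℝ} {s k₀ K δ : ℝ}
    (hα : IsRealSolution κ α A HA) (hβ : IsRealSolution κ β B HB)
    (hκr : RadiallyMonotoneOn κ univ) (hκm : AEStronglyMeasurable κ)
    (hκb : ∀ᵐ x, k₀ ≤ κ x ∧ κ x ≤ K)
    (hN : 1 ≤ N) (hk₀ : 0 < k₀) (hK : 0 ≤ K) (hs : s ^ 2 = 1) (hδ : 1 / 2 < δ)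
    (hW : IntegrableOn (fun x => (1 + ‖x‖) ^ (2 * (δ - 1)) * radiationSq κ s α A β B x)
      {x : Space N | 1 < ‖x‖}) :
    α =ᵐ[volume] 0 ∧ β =ᵐ[volume] 0 := by
  obtain ⟨CT, -, hCT⟩ := exists_bound_deriv_smoothTransition
  -- The decay must match `(1 + |x|)^(2 (δ - 1))` and still leave `a = 1 - 2 b` positive. For `δ ≥
  -- 1` no weight is needed.
  set b : ℝ := max (1 - δ) 0 with hb
  have hb0 : 0 ≤ b := le_max_right _ _
  have hbδ : 1 - δ ≤ b := le_max_left _ _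
  have hb2 : b < 1 / 2 := max_lt (by linarith) (by norm_num)
  set a : ℝ := 1 - 2 * b with ha
  have ha0 : 0 < a := by linarith
  have hN' : (1 : ℝ) ≤ N := by exact_mod_cast hN
  -- Chosen so that `(N - 1) ε` is at most both `a` and `a k₀`, as `bulk_estimate` requires.
  set ε : ℝ := a * min 1 k₀ / N with hε
  have hmin : 0 < min 1 k₀ := lt_min one_pos hk₀
  have hε0 : 0 < ε := by positivity
  have hεN : (N - 1) * ε ≤ a * min 1 k₀ := by
    have : N * ε = a * min 1 k₀ := by rw [hε]; field_simp
    linarith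
  have hε1 : (N - 1) * ε ≤ a :=
    hεN.trans (mul_le_of_le_one_right ha0.le (min_le_left _ _))
  have hε2 : (N - 1) * ε ≤ a * k₀ :=
    hεN.trans (mul_le_mul_of_nonneg_left (min_le_right _ _) ha0.le)
  set w : Space N → ℝ := fun x => (1 + ‖x‖) ^ (2 * (δ - 1)) * radiationSq κ s α A β B x with hw
  have htail : Tendsto (fun n : ℕ => ∫ x in {x : Space N | (n : ℝ) + 2 ≤ ‖x‖}, w x) atTop
      (𝓝 0) := by
    have hms : ∀ n : ℕ, MeasurableSet {x : Space N | (n : ℝ) + 2 ≤ ‖x‖} := fun n =>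
      measurableSet_le measurable_const measurable_norm
    have hanti : Antitone fun n : ℕ => {x : Space N | (n : ℝ) + 2 ≤ ‖x‖} := by
      intro n m hnm x hx
      have : (n : ℝ) ≤ m := by exact_mod_cast hnm
      simp only [mem_ofPred_eq] at hx ⊢
      linarith
    have hint : IntegrableOn w {x : Space N | ((0 : ℕ) : ℝ) + 2 ≤ ‖x‖} :=
      hW.mono_set fun x hx => by
        simp only [mem_ofPred_eq, Nat.cast_zero] at hx ⊢
        linarith
    have := tendsto_setIntegral_of_antitone hms hanti ⟨0, hint⟩
    have hempty : ⋂ n : ℕ, {x : Space N | (n : ℝ) + 2 ≤ ‖x‖} = ∅ := by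
      rw [eq_empty_iff_forall_notMem]
      intro x hx
      rw [mem_iInter] at hx
      obtain ⟨n, hn⟩ := exists_nat_gt ‖x‖
      have := hx n
      simp only [mem_ofPred_eq] at this
      linarith
    rwa [hempty, setIntegral_empty] at this
  have key : ∀ r : ℝ, 0 < r →
      ∀ᵐ x ∂volume.restrict (closedBall (0 : Space N) r), α x = 0 ∧ β x = 0 := by
    intro r hr
    have iαβ : IntegrableOn (fun x => powWeight b ε x * (α x ^ 2 + β x ^ 2))
        (closedBall (0 : Space N) r) := by
      have hm := isRadialTest_mul (N := N) hr b ε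
      have i1 := integrable_testFunction_mul_mul hm.test.1.continuous hm.test.2 hα.memL2 hα.memL2
      have i2 := integrable_testFunction_mul_mul hm.test.1.continuous hm.test.2 hβ.memL2 hβ.memL2
      refine (i1.add i2).integrableOn.congr_fun (fun x hx => ?_) measurableSet_closedBall
      have hx' : ‖x‖ ≤ r := by simpa using hx
      simp only [Pi.add_apply, radialCutoff_eq_one hr hx']
      ring
    have hnn : ∀ x : Space N, 0 ≤ powWeight b ε x * (α x ^ 2 + β x ^ 2) := fun x =>
      mul_nonneg (powWeight_pos b ε x).le (by positivity)
    -- The cut-off radius is `n + 2`: it exceeds `1`, so the tail lies in the domain of the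
    -- radiation condition, and eventually it exceeds `r`, so the cut-off is `1` on this ball. The
    -- constant before the tail does not depend on `n`.
    have hle0 : ∫ x in closedBall (0 : Space N) r, powWeight b ε x * (α x ^ 2 + β x ^ 2) ≤ 0 := by
      have hlim := (htail.const_mul (4 * (N + 3 + 2 * K) * (2 * √K
        + (2 * ((N - 1) / 2) ^ 2 + 1) / √k₀) * CT / √k₀ * (9 / ε ^ 2) ^ b)).const_mul
          (a / 2 * k₀)⁻¹
      rw [mul_zero, mul_zero] at hlim
      refine ge_of_tendsto hlim ?_
      filter_upwards [eventually_ge_atTop ⌈r⌉₊] with n hn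
      have hrn : r ≤ (n : ℝ) + 2 := by
        have h1 : r ≤ ⌈r⌉₊ := Nat.le_ceil r
        have h2 : ((⌈r⌉₊ : ℕ) : ℝ) ≤ n := by exact_mod_cast hn
        linarith
      have hn0 : (0 : ℝ) ≤ n := n.cast_nonneg
      have hR : (1 : ℝ) ≤ (n : ℝ) + 2 := by linarith
      have hR0 : (0 : ℝ) < (n : ℝ) + 2 := by linarith
      have hmain := integral_cutoff_le hα hβ hκr hκm hκb hN hk₀ hK hs hCT hR ha0.le le_rfl hb0
        (by linarith) hbδ hε0 hε1 hε2 (hW.mono_set fun x hx => by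
          simp only [mem_ofPred_eq] at hx ⊢
          linarith)
      rw [le_inv_mul_iff₀ (by positivity)]
      refine le_trans (mul_le_mul_of_nonneg_left ?_ (by positivity)) hmain
      have hm := isRadialTest_mul (N := N) hR0 b ε
      have i1 := integrable_testFunction_mul_mul hm.test.1.continuous hm.test.2 hα.memL2 hα.memL2
      have i2 := integrable_testFunction_mul_mul hm.test.1.continuous hm.test.2 hβ.memL2 hβ.memL2
      rw [setIntegral_congr_fun (g := fun x => radialCutoff ((n : ℝ) + 2) x * powWeight b ε x
        * (α x ^ 2 + β x ^ 2)) measurableSet_closedBall fun x hx => by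
          have hx' : ‖x‖ ≤ r := by simpa using hx
          simp only [radialCutoff_eq_one hR0 (hx'.trans hrn), one_mul]]
      refine setIntegral_le_integral ((i1.add i2).congr (Eventually.of_forall fun x => ?_))
        (Eventually.of_forall fun x => ?_)
      · simp only [Pi.add_apply]
        ring
      · exact mul_nonneg (mul_nonneg (radialCutoff_nonneg _ _) (powWeight_pos b ε x).le)
          (by positivity)
    have h0 := (setIntegral_eq_zero_iff_of_nonneg_ae
      (Eventually.of_forall hnn) iαβ).1 (le_antisymm hle0 (integral_nonneg hnn))
    filter_upwards [h0] with x hx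
    have hx' : α x ^ 2 + β x ^ 2 = 0 := by
      simpa [(powWeight_pos b ε x).ne'] using hx
    constructor
    · nlinarith [sq_nonneg (α x), sq_nonneg (β x)]
    · nlinarith [sq_nonneg (α x), sq_nonneg (β x)]
  have hall : ∀ᵐ x : Space N, α x = 0 ∧ β x = 0 := by
    have h1 : ∀ n : ℕ, ∀ᵐ x : Space N, x ∈ closedBall (0 : Space N) (n + 1) →
        α x = 0 ∧ β x = 0 := fun n =>
      (ae_restrict_iff' measurableSet_closedBall).1 (key _ (by positivity))
    filter_upwards [ae_all_iff.2 h1] with x hx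
    obtain ⟨n, hn⟩ := exists_nat_gt ‖x‖
    refine hx n ?_
    simp only [mem_closedBall, dist_zero_right]
    linarith
  exact ⟨hall.mono fun x hx => hx.1, hall.mono fun x hx => hx.2⟩

end ReducedWave

namespace ReducedWave

open Filter Topology ContinuousLinearMap Metric

variable {N : ℕ}

/-! ### Reduction to real systems -/

lemma laplacian_eq_sum_partialDeriv {φ : Space N → ℝ} (hφ : ContDiff ℝ ∞ φ) (x : Space N) :
    (Δ φ) x = ∑ i, partialDeriv i (partialDeriv i φ) x := by
  have hd : DifferentiableAt ℝ (fderiv ℝ φ) x :=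
    ((hφ.fderiv_right (m := ∞) (by norm_cast)).differentiable (by norm_cast)) x
  rw [InnerProductSpace.laplacian_eq_iteratedFDeriv_orthonormalBasis φ
    (EuclideanSpace.basisFun (Fin N) ℝ)]
  refine Finset.sum_congr rfl fun i _ => ?_
  change _ = fderiv ℝ (fun y => fderiv ℝ φ y _) x _
  rw [fderiv_clm_apply hd (differentiableAt_const _), iteratedFDeriv_two_apply]
  simp

lemma integrable_testFunction_smul {φ : Space N → ℝ} {u : Space N → ℂ} (hφ : IsTestFunction φ)
    (hu : LocallyIntegrable u) : Integrable fun x => φ x • u x :=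
  hu.integrable_smul_left_of_hasCompactSupport hφ.1.continuous hφ.2

lemma locallyIntegrable_clm_comp {u : Space N → ℂ} (hu : LocallyIntegrable u) (l : ℂ →L[ℝ] ℝ) :
    LocallyIntegrable fun x => l (u x) := fun x =>
  let ⟨s, hs, h⟩ := hu x
  ⟨s, hs, l.integrable_comp h⟩

lemma HasWeakPartial.clm_comp {i : Fin N} {u v : Space N → ℂ} (h : HasWeakPartial i u v)
    (l : ℂ →L[ℝ] ℝ) : WeakPartial i (fun x => l (u x)) (fun x => l (v x)) := by
  obtain ⟨hu, hv, hφ⟩ := h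
  refine ⟨locallyIntegrable_clm_comp hu l, locallyIntegrable_clm_comp hv l, fun φ hT => ?_⟩
  have h1 := l.integral_comp_comm (integrable_testFunction_smul (hT.partialDeriv i) hu)
  have h2 := l.integral_comp_comm (integrable_testFunction_smul hT hv)
  simp only [map_smul, smul_eq_mul] at h1 h2
  rw [h1, h2, hφ φ hT, map_neg]

lemma HasWeakPartial.sub {i : Fin N} {u v u' v' : Space N → ℂ} (h : HasWeakPartial i u v)
    (h' : HasWeakPartial i u' v') :
    HasWeakPartial i (fun x => u x - u' x) (fun x => v x - v' x) := by
  refine ⟨h.1.sub h'.1, h.2.1.sub h'.2.1, fun φ hT => ?_⟩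
  simp only [smul_sub]
  rw [integral_sub (integrable_testFunction_smul (hT.partialDeriv i) h.1)
    (integrable_testFunction_smul (hT.partialDeriv i) h'.1),
    integral_sub (integrable_testFunction_smul hT h.2.1) (integrable_testFunction_smul hT h'.2.1),
    h.2.2 φ hT, h'.2.2 φ hT]
  ring

lemma HasWeakPartial.unique {i : Fin N} {u v v' : Space N → ℂ} (h : HasWeakPartial i u v)
    (h' : HasWeakPartial i u v') : v =ᵐ[volume] v' := by
  refine ae_eq_of_integral_contDiff_smul_eq h.2.1 h'.2.1 fun φ hφ hφc => ?_
  exact neg_injective ((h.2.2 φ ⟨hφ, hφc⟩).symm.trans (h'.2.2 φ ⟨hφ, hφc⟩))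

/-- The distributional Laplacian of an `H²_loc` function is the trace of its Hessian. -/
lemma HasWeakLaplacian.ae_eq_sum {u w : Space N → ℂ} {G : Fin N → Space N → ℂ}
    {H : Fin N → Fin N → Space N → ℂ} (h : HasWeakLaplacian u w)
    (hG : ∀ i, HasWeakPartial i u (G i)) (hH : ∀ i j, HasWeakPartial j (G i) (H i j)) :
    (fun x => ∑ i, H i i x) =ᵐ[volume] w := by
  refine ae_eq_of_integral_contDiff_smul_eq
    (locallyIntegrable_finsetSum _ fun i _ => (hH i i).2.1) h.2.1 fun φ hφ hφc => ?_
  have hT : IsTestFunction φ := ⟨hφ, hφc⟩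
  rw [← h.2.2 φ hT]
  simp only [laplacian_eq_sum_partialDeriv hφ, Finset.smul_sum, Finset.sum_smul]
  rw [integral_finsetSum _ fun i _ => integrable_testFunction_smul hT (hH i i).2.1,
    integral_finsetSum _ fun i _ => integrable_testFunction_smul
      ((hT.partialDeriv i).partialDeriv i) h.1]
  refine Finset.sum_congr rfl fun i _ => ?_
  have h1 := (hH i i).2.2 φ hT
  have h2 := (hG i).2.2 _ (hT.partialDeriv i)
  rw [h2, h1, neg_neg]

lemma MemL2Loc.sub {u v : Space N → ℂ} (hu : MemL2Loc u) (hv : MemL2Loc v) :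
    MemL2Loc fun x => u x - v x := fun K hK => (hu K hK).sub (hv K hK)

lemma MemL2Loc.clm_comp {u : Space N → ℂ} (hu : MemL2Loc u) (l : ℂ →L[ℝ] ℝ) :
    RealL2Loc fun x => l (u x) := fun K hK => l.comp_memLp' (hu K hK)

/-- Since `κ` is real, every real-linear functional commutes with the equation; it is used for the
real and imaginary parts. -/
lemma isRealSolution_clm_comp {κ : Space N → ℝ} {u : Space N → ℂ} {G : Fin N → Space N → ℂ}
    {H : Fin N → Fin N → Space N → ℂ} (l : ℂ →L[ℝ] ℝ) (hu : MemL2Loc u)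
    (hG : ∀ i, HasWeakPartial i u (G i) ∧ MemL2Loc (G i))
    (hH : ∀ i j, HasWeakPartial j (G i) (H i j) ∧ MemL2Loc (H i j))
    (heq : ∀ᵐ x, ∑ i, H i i x = -(κ x : ℂ) * u x) :
    IsRealSolution κ (fun x => l (u x)) (fun i x => l (G i x)) (fun i j x => l (H i j x)) where
  memL2 := hu.clm_comp l
  gradMemL2 i := (hG i).2.clm_comp l
  hessMemL2 i j := (hH i j).2.clm_comp l
  grad i := (hG i).1.clm_comp l
  hess i j := (hH i j).1.clm_comp l
  eqn := by
    filter_upwards [heq] with x hx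
    rw [← map_sum, hx, ← smul_eq_mul (-κ x), ← map_smul, Complex.real_smul]
    simp

lemma radiationTerm_sub (μ₀ : Space N → ℝ) (lam : ℝ) (s : ℤˣ) (u v : Space N → ℂ)
    (G G' : Fin N → Space N → ℂ) (x : Space N) :
    radiationTerm μ₀ lam s (fun x => u x - v x) (fun i x => G i x - G' i x) x
      = radiationTerm μ₀ lam s u G x - radiationTerm μ₀ lam s v G' x := by
  simp only [radiationTerm, mul_sub, Finset.sum_sub_distrib]
  ring

lemma norm_sq_radiationTerm (μ₀ : Space N → ℝ) (lam : ℝ) (s : ℤˣ) (u : Space N → ℂ)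
    (G : Fin N → Space N → ℂ) (x : Space N) :
    ‖radiationTerm μ₀ lam s u G x‖ ^ 2
      = radiationSq (fun x => lam * μ₀ x) (s : ℤ) (fun x => (u x).re) (fun i x => (G i x).re)
        (fun x => (u x).im) (fun i x => (G i x).im) x := by
  rw [← Complex.normSq_eq_norm_sq, Complex.normSq_apply]
  have hre : (radiationTerm μ₀ lam s u G x).re = radialPart (fun i x => (G i x).re) x / ‖x‖
      + (N - 1) / (2 * ‖x‖) * (u x).re + (s : ℤ) * √(lam * μ₀ x) * (u x).im := by
    simp only [radiationTerm, waveNumber, radialPart, Complex.sub_re, Complex.add_re,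
      Complex.re_sum, Complex.re_ofReal_mul, Finset.sum_div]
    simp [div_mul_eq_mul_div]
  have him : (radiationTerm μ₀ lam s u G x).im = radialPart (fun i x => (G i x).im) x / ‖x‖
      + (N - 1) / (2 * ‖x‖) * (u x).im - (s : ℤ) * √(lam * μ₀ x) * (u x).re := by
    simp only [radiationTerm, waveNumber, radialPart, Complex.sub_im, Complex.add_im,
      Complex.im_sum, Complex.im_ofReal_mul, Finset.sum_div]
    simp [div_mul_eq_mul_div]
  rw [hre, him, radiationSq]
  ring

lemma aestronglyMeasurable_radiationTerm {μ₀ : Space N → ℝ} (hμ : AEStronglyMeasurable μ₀)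
    (lam : ℝ) (s : ℤˣ) {u : Space N → ℂ} {G : Fin N → Space N → ℂ}
    (hu : AEStronglyMeasurable u) (hG : ∀ i, AEStronglyMeasurable (G i)) :
    AEStronglyMeasurable (radiationTerm μ₀ lam s u G) := by
  have hk : AEStronglyMeasurable (fun x => (waveNumber μ₀ lam x : ℂ)) :=
    Complex.continuous_ofReal.comp_aestronglyMeasurable
      (Real.continuous_sqrt.comp_aestronglyMeasurable (hμ.const_mul lam))
  have hx : ∀ i : Fin N, Measurable fun x : Space N => ((x i / ‖x‖ : ℝ) : ℂ) := fun i => by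
    have : Measurable fun x : Space N => x i := (contDiff_coord (n := 0) i).continuous.measurable
    fun_prop
  have hr : Measurable fun x : Space N => ((((N : ℝ) - 1) / (2 * ‖x‖) : ℝ) : ℂ) := by fun_prop
  unfold radiationTerm
  exact ((Finset.aestronglyMeasurable_fun_sum _ fun i _ =>
    (hx i).aestronglyMeasurable.mul (hG i)).add (hr.aestronglyMeasurable.mul hu)).sub
      ((hk.const_mul _).mul hu)

lemma integrableOn_of_weightedNorm_lt_top {t : ℝ} {D : Set (Space N)} {v : Space N → ℂ}
    (hv : AEStronglyMeasurable v) (h : weightedNorm t D v < ⊤) :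
    IntegrableOn (fun x => (1 + ‖x‖) ^ (2 * t) * ‖v x‖ ^ 2) D := by
  have hw : Continuous fun x : Space N => (1 + ‖x‖) ^ (2 * t) :=
    (by fun_prop : Continuous fun x : Space N => 1 + ‖x‖).rpow_const fun x =>
      Or.inl (by positivity)
  refine ⟨(hw.aestronglyMeasurable.mul (hv.norm.pow 2)).restrict, ?_⟩
  rw [weightedNorm, ENNReal.rpow_lt_top_iff_of_pos (by norm_num)] at h
  refine lt_of_le_of_lt (lintegral_mono fun x => ?_) h
  rw [enorm_mul, enorm_pow, enorm_norm, Real.enorm_of_nonneg (by positivity)]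

/-- The gradient supplied by the radiation condition need not be the one from `H²_loc`; uniqueness
of weak derivatives identifies them almost everywhere. -/
lemma RadiationCondition.integrableOn {μ₀ : Space N → ℝ} (hμ : AEStronglyMeasurable μ₀)
    {lam δ : ℝ} {s : ℤˣ} {u : Space N → ℂ} (h : RadiationCondition μ₀ lam δ s u)
    (hu : AEStronglyMeasurable u) {G : Fin N → Space N → ℂ}
    (hG : ∀ i, HasWeakPartial i u (G i)) :
    IntegrableOn (fun x => (1 + ‖x‖) ^ (2 * (δ - 1)) * ‖radiationTerm μ₀ lam s u G x‖ ^ 2)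
      {x | 1 < ‖x‖} := by
  obtain ⟨G', hG', hn⟩ := h
  have hae : ∀ᵐ x, ∀ i, G' i x = G i x := ae_all_iff.2 fun i => (hG' i).unique (hG i)
  refine (integrableOn_of_weightedNorm_lt_top (aestronglyMeasurable_radiationTerm hμ lam s
    hu fun i => (hG' i).2.1.aestronglyMeasurable) hn).congr (ae_restrict_of_ae ?_)
  filter_upwards [hae] with x hx
  simp only [radiationTerm, hx]

lemma RadiallyMonotoneOn.const_mul {μ : Space N → ℝ} {V : Set (Space N)}
    (h : RadiallyMonotoneOn μ V) {c : ℝ} (hc : 0 ≤ c) :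
    RadiallyMonotoneOn (fun x => c * μ x) V := by
  intro w h1 h2 h3 h4
  simp only [mul_assoc]
  rw [integral_const_mul]
  exact mul_nonpos_of_nonneg_of_nonpos hc (h w h1 h2 h3 h4)

end ReducedWave

/-! ### The uniqueness theorem -/

open ReducedWave

theorem corollary3p4 {N : ℕ} (hN : 2 ≤ N) (L : Set ℤ)
    (Ω Sm Sp : ℤ → Set (ReducedWave.Space N)) (ν : ℤ → ℝ) (μ₀ : ReducedWave.Space N → ℝ)
    (hμ : ReducedWave.IsLayeredMedium L Ω Sm Sp ν μ₀)
    (lam : ℝ) (hlam : 0 < lam) (δ : ℝ) (hδ : 1 / 2 < δ) (s : ℤˣ)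
    (f : ReducedWave.Space N → ℂ) (hf : ReducedWave.MemL2Loc f)
    (u₁ u₂ : ReducedWave.Space N → ℂ)
    (h₁ : ReducedWave.MemH2Loc u₁) (h₂ : ReducedWave.MemH2Loc u₂)
    (he₁ : ReducedWave.SolvesReducedWave μ₀ lam f u₁)
    (he₂ : ReducedWave.SolvesReducedWave μ₀ lam f u₂)
    (hr₁ : ReducedWave.RadiationCondition μ₀ lam δ s u₁)
    (hr₂ : ReducedWave.RadiationCondition μ₀ lam δ s u₂) :
    u₁ =ᵐ[MeasureTheory.volume] u₂ := by
  obtain ⟨m₁, G₁, H₁, hG₁, hH₁⟩ := h₁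
  obtain ⟨m₂, G₂, H₂, hG₂, hH₂⟩ := h₂
  obtain ⟨w₁, hw₁, e₁⟩ := he₁
  obtain ⟨w₂, hw₂, e₂⟩ := he₂
  obtain ⟨m, M, hm, hb⟩ := hμ.exists_bounds
  have hμm := hμ.exists_measurable
  have hM : 0 ≤ M := by
    obtain ⟨x, hx⟩ := hb.exists
    linarith
  have heq : ∀ᵐ x, ∑ i, (H₁ i i x - H₂ i i x)
      = -((lam * μ₀ x : ℝ) : ℂ) * (u₁ x - u₂ x) := by
    filter_upwards [hw₁.ae_eq_sum (fun i => (hG₁ i).1) (fun i j => (hH₁ i j).1),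
      hw₂.ae_eq_sum (fun i => (hG₂ i).1) (fun i j => (hH₂ i j).1), e₁, e₂] with x a₁ a₂ b₁ b₂
    have hne : ((μ₀ x : ℝ) : ℂ) ≠ 0 := by exact_mod_cast (hμ.pos x).ne'
    rw [Finset.sum_sub_distrib, a₁, a₂]
    -- The right-hand side `f` is eliminated here, leaving the homogeneous equation for the
    -- difference.
    have h := b₁.trans b₂.symm
    push_cast at h ⊢
    field_simp at h
    linear_combination -h
  have hsol := fun l : ℂ →L[ℝ] ℝ => isRealSolution_clm_comp (κ := fun x => lam * μ₀ x) l
    (m₁.sub m₂)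
    (fun i => ⟨(hG₁ i).1.sub (hG₂ i).1, (hG₁ i).2.sub (hG₂ i).2⟩)
    (fun i j => ⟨(hH₁ i j).1.sub (hH₂ i j).1, (hH₁ i j).2.sub (hH₂ i j).2⟩) heq
  have hW : IntegrableOn (fun x => (1 + ‖x‖) ^ (2 * (δ - 1))
      * ‖radiationTerm μ₀ lam s (fun x => u₁ x - u₂ x) (fun i x => G₁ i x - G₂ i x) x‖ ^ 2)
      {x | 1 < ‖x‖} := by
    have i₁ := hr₁.integrableOn hμm hw₁.1.aestronglyMeasurable fun i => (hG₁ i).1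
    have i₂ := hr₂.integrableOn hμm hw₂.1.aestronglyMeasurable fun i => (hG₂ i).1
    refine Integrable.mono' ((i₁.const_mul 2).add (i₂.const_mul 2)) ?_
      (Filter.Eventually.of_forall fun x => ?_)
    · have hm := aestronglyMeasurable_radiationTerm hμm lam s
        (hw₁.1.sub hw₂.1).aestronglyMeasurable
        fun i => ((hG₁ i).1.2.1.sub (hG₂ i).1.2.1).aestronglyMeasurable
      have hw : Continuous fun x : Space N => (1 + ‖x‖) ^ (2 * (δ - 1)) :=
        (by fun_prop : Continuous fun x : Space N => 1 + ‖x‖).rpow_const fun x =>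
          Or.inl (by positivity)
      exact (hw.aestronglyMeasurable.mul (hm.norm.pow 2)).restrict
    · rw [radiationTerm_sub, Real.norm_of_nonneg (by positivity)]
      simp only [Pi.add_apply]
      set a := radiationTerm μ₀ lam s u₁ G₁ x
      set b := radiationTerm μ₀ lam s u₂ G₂ x
      have h : ‖a - b‖ ^ 2 ≤ 2 * ‖a‖ ^ 2 + 2 * ‖b‖ ^ 2 := by
        have := norm_sub_le a b
        nlinarith [norm_nonneg (a - b), sq_nonneg (‖a‖ - ‖b‖)]
      have hw : 0 ≤ (1 + ‖x‖) ^ (2 * (δ - 1)) := by positivity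
      nlinarith [mul_le_mul_of_nonneg_left h hw]
  simp only [norm_sq_radiationTerm] at hW
  have hs : (((s : ℤ) : ℝ)) ^ 2 = 1 := by
    rcases Int.units_eq_one_or s with rfl | rfl <;> simp
  obtain ⟨z₁, z₂⟩ := ae_eq_zero_of_radiation (hsol Complex.reCLM) (hsol Complex.imCLM)
    (k₀ := lam * m) (K := lam * M)
    ((hμ.radiallyMonotoneOn_univ hN).const_mul hlam.le) (hμm.const_mul lam)
    (by
      filter_upwards [hb] with x hx
      exact ⟨mul_le_mul_of_nonneg_left hx.1 hlam.le, mul_le_mul_of_nonneg_left hx.2 hlam.le⟩)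
    (by lia) (by positivity) (by positivity) hs hδ hW
  filter_upwards [z₁, z₂] with x h1 h2
  have h3 : u₁ x - u₂ x = 0 := Complex.ext h1 h2
  exact sub_eq_zero.1 h3
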